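/- Let $r>0$. For $f,g$ in the Sobolev space $\mathcal H^1(\mathbb R)$ (identified with their continuous representatives) let $$t_C(f,g)=\tfrac12\langle f',g'\rangle+2\ln(r)\,\overline{f(0)}g(0)-C_0(f,g),$$ where the inner product is that of $L^2(\mathbb R)$ and $C_0$ is the continuous extension to $\mathcal H^1(\mathbb R)$ of the form defined on Schwartz functions by $$C_0(f,g)=-\int_0^\infty\ln(2x)\,(\overline f g)'(x)\,dx+\int_{-\infty}^0\ln(-2x)\,(\overline f g)'(x)\,dx .$$ Let $H_C=H_C(r)$ be the self-adjoint operator on $L^2(\mathbb R)$ generated by $t_C$: a function $\psi\in\mathcal H^1(\mathbb R)$ belongs to its domain if and only if there is $F\in L^2(\mathbb R)$ with $t_C(\phi,\psi)=\langle\phi,F\rangle$ for all $\phi\in\mathcal H^1(\mathbb R)$, and then $H_C\psi=F$. Let $(P_\pm f)(x)=\frac{f(x)\pm f(-x)}2$; $\psi$ is called even (odd) if it lies in the range of $P_+$ (of $P_-$). Let $\gamma$ be Euler's constant and let $\Gamma'/\Gamma$ be the digamma function. Then: (i) Every negative eigenvalue of $H_C$ is non-degenerate (its eigenspace is one-dimensional),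 and every eigenfunction of $H_C$ is an eigenfunction of $P_+$ and $P_-$, i.e. it is either even or odd. (ii) For every $N\in\{1,2,\dots\}$ the number $E=-\frac1{2N^2}$ is an eigenvalue of $H_C$, and its eigenspace is spanned by an odd function $\phi_{odd,N}\neq0$ that does not depend on $r$. There are no other odd eigenfunctions with negative eigenvalue. (iii) For every $k\in\{1,2,\dots\}$ the equation $$\frac{\Gamma'(1-\alpha)}{\Gamma(1-\alpha)}+2\gamma+\frac1{2\alpha}-\ln\alpha+\ln r=0$$ has exactly one solution $\alpha_k=\alpha_k(r)$ in the interval $(k-1,k)$, the number $E=-\frac1{2\alpha_k^2}$ is an eigenvalue of $H_C$, and its eigenspace is spanned by an even function $\phi_{even,k}\ne0$. There are no other even eigenfunctions with negative eigenvalue. -/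

import Mathlib

open MeasureTheory Set Filter Topology
open scoped ENNReal SchwartzMap ComplexConjugate

/-! ### The Sobolev space `H¹(ℝ)` -/

/-- `f` is the continuous representative of an element of `H¹(ℝ)`: `f` is square integrable and is
the primitive of a square integrable function (which is then its weak derivative, and which is
equal to `deriv f` almost everywhere). -/
def MemH1 (f : ℝ → ℂ) : Prop :=
  MemLp f 2 volume ∧ ∃ g : ℝ → ℂ, MemLp g 2 volume ∧ ∀ x, f x = f 0 + ∫ t in (0 : ℝ)..x, g t

namespace MemH1

variable {f g : ℝ → ℂ}

lemma intervalIntegrable_of_memLp (hf : MemLp f 2 volume) (a b : ℝ) :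
    IntervalIntegrable f volume a b :=
  ((hf.locallyIntegrable (by norm_num)).integrableOn_isCompact isCompact_uIcc).intervalIntegrable

lemma memLp (hf : MemH1 f) : MemLp f 2 volume := hf.1

lemma exists_deriv (hf : MemH1 f) : ∃ g : ℝ → ℂ, MemLp g 2 volume ∧
    (∀ᵐ x, HasDerivAt f (g x) x) := by
  obtain ⟨-, g, hg, hfg⟩ := hf
  refine ⟨g, hg, ?_⟩
  have hl : LocallyIntegrable g volume := hg.locallyIntegrable (by norm_num)
  filter_upwards [LocallyIntegrable.ae_hasDerivAt_integral hl] with x hx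
  have h := (hx 0).const_add (f 0)
  have e : f = fun x => f 0 + ∫ t in (0 : ℝ)..x, g t := funext hfg
  rw [e]
  simpa using h

lemma ae_hasDerivAt (hf : MemH1 f) : ∀ᵐ x, HasDerivAt f (deriv f x) x := by
  obtain ⟨g, -, h⟩ := hf.exists_deriv
  filter_upwards [h] with x hx using hx.differentiableAt.hasDerivAt

lemma memLp_deriv (hf : MemH1 f) : MemLp (deriv f) 2 volume := by
  obtain ⟨g, hg, h⟩ := hf.exists_deriv
  refine (memLp_congr_ae ?_).1 hg
  filter_upwards [h] with x hx using hx.deriv.symm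

lemma continuous (hf : MemH1 f) : Continuous f := by
  obtain ⟨-, g, hg, hfg⟩ := hf
  have e : f = fun x => f 0 + ∫ t in (0 : ℝ)..x, g t := funext hfg
  rw [e]
  exact continuous_const.add
    (intervalIntegral.continuous_primitive (fun a b => intervalIntegrable_of_memLp hg a b) 0)

lemma add (hf : MemH1 f) (hg : MemH1 g) : MemH1 (fun x => f x + g x) := by
  obtain ⟨h1, f', hf', e1⟩ := hf
  obtain ⟨h2, g', hg', e2⟩ := hg
  refine ⟨h1.add h2, fun x => f' x + g' x, hf'.add hg', fun x => ?_⟩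
  simp only
  rw [intervalIntegral.integral_add (intervalIntegrable_of_memLp hf' 0 x)
    (intervalIntegrable_of_memLp hg' 0 x), e1 x, e2 x]
  ring

lemma const_mul (c : ℂ) (hf : MemH1 f) : MemH1 (fun x => c * f x) := by
  obtain ⟨h1, f', hf', e1⟩ := hf
  refine ⟨h1.const_mul c, fun x => c * f' x, hf'.const_mul c, fun x => ?_⟩
  simp only
  rw [intervalIntegral.integral_const_mul, e1 x]
  ring

lemma zero : MemH1 (fun _ => 0) :=
  ⟨MemLp.zero', fun _ => 0, MemLp.zero', by simp⟩

lemma of_contDiff (hf : ContDiff ℝ 1 f) (h0 : MemLp f 2 volume) (h1 : MemLp (deriv f) 2 volume) :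
    MemH1 f := by
  refine ⟨h0, deriv f, h1, fun x => ?_⟩
  rw [intervalIntegral.integral_deriv_eq_sub
    (fun y _ => (hf.differentiable (by norm_num)).differentiableAt)
    ((hf.continuous_deriv le_rfl).intervalIntegrable _ _)]
  ring

lemma schwartz (f : 𝓢(ℝ, ℂ)) : MemH1 f := by
  refine of_contDiff (f.smooth 1) (f.memLp 2 volume) ?_
  have := (SchwartzMap.derivCLM ℝ ℂ f).memLp 2 volume
  exact this

end MemH1

/-! ### The quadratic form -/

/-- The regularised Coulomb form `C₀` on `H¹(ℝ)`, that is, the continuous extension to `H¹(ℝ)` of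
`C₀(f, g) = -∫₀^∞ ln(2x) (f̄ g)'(x) dx + ∫_{-∞}^0 ln(-2x) (f̄ g)'(x) dx`. Integrating by parts
on `|x| > 1/2`, where the boundary terms carry the factor `ln 1 = 0`, gives the expression below,
whose integrals converge absolutely for all `f, g ∈ H¹(ℝ)`; see `coulombForm_schwartz`. -/
noncomputable def coulombForm (f g : ℝ → ℂ) : ℂ :=
  -(∫ x in (0 : ℝ)..(1 / 2), (Real.log (2 * x) : ℂ) * deriv (fun y => conj (f y) * g y) x)
    + (∫ x in (-(1 / 2) : ℝ)..0, (Real.log (-2 * x) : ℂ) * deriv (fun y => conj (f y) * g y) x)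
    + ∫ x in {x : ℝ | 1 / 2 < |x|}, ((1 / |x| : ℝ) : ℂ) * (conj (f x) * g x)

/-- The sesquilinear form `t_C(f, g) = ½⟨f', g'⟩ + 2 ln(r) f̄(0) g(0) - C₀(f, g)` on `H¹(ℝ)`. -/
noncomputable def formTC (r : ℝ) (f g : ℝ → ℂ) : ℂ :=
  1 / 2 * (∫ x, conj (deriv f x) * deriv g x) + 2 * (Real.log r : ℂ) * (conj (f 0) * g 0)
    - coulombForm f g

lemma hasDerivAt_conj_mul {f g : ℝ → ℂ} {f' g' : ℂ} {x : ℝ} (hf : HasDerivAt f f' x)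
    (hg : HasDerivAt g g' x) :
    HasDerivAt (fun y => conj (f y) * g y) (conj f' * g x + conj (f x) * g') x :=
  hf.star.mul hg

lemma memLp_conj {f : ℝ → ℂ} {p : ℝ≥0∞} (hf : MemLp f p volume) :
    MemLp (fun x => conj (f x)) p volume :=
  hf.star

lemma integrable_conj_mul {f g : ℝ → ℂ} (hf : MemLp f 2 volume) (hg : MemLp g 2 volume) :
    Integrable (fun x => conj (f x) * g x) volume :=
  (memLp_conj hf).integrable_mul hg

lemma memLp_log_right :
    MemLp (fun x : ℝ => (Real.log (2 * x) : ℂ)) 2 (volume.restrict (uIoc 0 (1 / 2))) := by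
  have hm : AEStronglyMeasurable (fun x : ℝ => (Real.log (2 * x) : ℂ))
      (volume.restrict (uIoc 0 (1 / 2))) :=
    (Complex.measurable_ofReal.comp
      (Real.measurable_log.comp (measurable_const.mul measurable_id))).aestronglyMeasurable
  rw [memLp_two_iff_integrable_sq_norm hm]
  have hi : IntegrableOn (fun x : ℝ => 16 * ((2 : ℝ) ^ (-(1 / 2) : ℝ) * x ^ (-(1 / 2) : ℝ)))
      (uIoc 0 (1 / 2)) volume := by
    rw [← intervalIntegrable_iff]
    exact ((intervalIntegral.intervalIntegrable_rpow' (by norm_num)).const_mul _).const_mul _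
  refine Integrable.mono' hi (hm.norm.pow 2) ?_
  filter_upwards [ae_restrict_mem measurableSet_uIoc] with x hx
  rw [uIoc_of_le (by norm_num)] at hx
  have h0 : 0 < 2 * x := by linarith [hx.1]
  have h := Real.abs_log_mul_self_rpow_lt (2 * x) (1 / 4) h0 (by linarith [hx.2]) (by norm_num)
  have hp : 0 < (2 * x) ^ (1 / 4 : ℝ) := Real.rpow_pos_of_pos h0 _
  rw [abs_mul, abs_of_pos hp] at h
  have h2 : |Real.log (2 * x)| ≤ 4 * (2 * x) ^ (-(1 / 4) : ℝ) := by
    rw [Real.rpow_neg h0.le, ← div_eq_mul_inv, le_div_iff₀ hp]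
    linarith
  rw [Real.norm_of_nonneg (by positivity), Complex.norm_real, Real.norm_eq_abs,
    ← Real.mul_rpow (by norm_num) hx.1.le]
  calc |Real.log (2 * x)| ^ 2 ≤ (4 * (2 * x) ^ (-(1 / 4) : ℝ)) ^ 2 := by gcongr
    _ = 16 * (2 * x) ^ (-(1 / 2) : ℝ) := by
      rw [mul_pow, ← Real.rpow_natCast, ← Real.rpow_natCast, ← Real.rpow_mul h0.le]
      norm_num

lemma memLp_log_left :
    MemLp (fun x : ℝ => (Real.log (-2 * x) : ℂ)) 2 (volume.restrict (uIoc (-(1 / 2)) 0)) := by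
  have h : MeasurePreserving (fun x : ℝ => -x) (volume.restrict (Ico (-(1 / 2)) 0))
      (volume.restrict (Ioc 0 (1 / 2))) := by
    have := (Measure.measurePreserving_neg (volume : Measure ℝ)).restrict_preimage
      (measurableSet_Ioc (a := (0 : ℝ)) (b := 1 / 2))
    convert! this using 2
    ext x
    simp only [mem_Ico, mem_preimage, mem_Ioc]
    constructor <;> rintro ⟨h1, h2⟩ <;> constructor <;> linarith
  have h2 := memLp_log_right
  rw [uIoc_of_le (by norm_num)] at h2 ⊢
  have h3 := h2.comp_measurePreserving h
  rw [Measure.restrict_congr_set Ico_ae_eq_Ioc] at h3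
  refine (memLp_congr_ae (Eventually.of_forall fun x => ?_)).1 h3
  simp

lemma intervalIntegrable_log_mul_deriv {f g : ℝ → ℂ} (hf : MemH1 f) (hg : MemH1 g) {c a b : ℝ}
    (hc : MemLp (fun x : ℝ => (Real.log (c * x) : ℂ)) 2 (volume.restrict (uIoc a b))) :
    IntervalIntegrable
      (fun x => (Real.log (c * x) : ℂ) * deriv (fun y => conj (f y) * g y) x) volume a b := by
  rw [intervalIntegrable_iff]
  have key : ∀ {u v : ℝ → ℂ}, MemLp u 2 volume → Continuous v →
      IntegrableOn (fun x => (Real.log (c * x) : ℂ) * (u x * v x)) (uIoc a b) volume := by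
    intro u v hu hv
    have h1 := hc.integrable_mul (hu.restrict (uIoc a b))
    have h2 : IntegrableOn (fun x => v x * ((Real.log (c * x) : ℂ) * u x)) (uIoc a b) volume := by
      obtain ⟨C, hC⟩ := (isCompact_uIcc (a := a) (b := b)).exists_bound_of_continuousOn
        hv.continuousOn
      refine Integrable.bdd_mul (c := C) h1 hv.aestronglyMeasurable ?_
      filter_upwards [ae_restrict_mem measurableSet_uIoc] with x hx
      exact hC x (uIoc_subset_uIcc hx)
    refine h2.congr (Eventually.of_forall fun x => ?_)
    simp only
    ring
  have h := (key (memLp_conj hf.memLp_deriv) hg.continuous).add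
    (key hg.memLp_deriv (Complex.continuous_conj.comp hf.continuous))
  refine h.congr (ae_restrict_of_ae ?_)
  filter_upwards [hf.ae_hasDerivAt, hg.ae_hasDerivAt] with x hx hy
  simp only [Pi.add_apply]
  rw [(hasDerivAt_conj_mul hx hy).deriv, Function.comp_apply]
  ring

lemma integrableOn_coulomb {f g : ℝ → ℂ} (hf : MemH1 f) (hg : MemH1 g) :
    IntegrableOn (fun x => ((1 / |x| : ℝ) : ℂ) * (conj (f x) * g x)) {x : ℝ | 1 / 2 < |x|}
      volume := by
  refine Integrable.bdd_mul (c := 2) (integrable_conj_mul hf.memLp hg.memLp).restrict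
    (Complex.measurable_ofReal.comp
      (measurable_const.div measurable_norm)).aestronglyMeasurable ?_
  filter_upwards [ae_restrict_mem (measurableSet_lt measurable_const measurable_norm)] with x hx
  replace hx : 1 / 2 < |x| := hx
  rw [Complex.norm_real, Real.norm_of_nonneg (by positivity), div_le_iff₀ (by linarith)]
  linarith

lemma coulombForm_add {f g h : ℝ → ℂ} (hf : MemH1 f) (hg : MemH1 g) (hh : MemH1 h) :
    coulombForm f (fun x => g x + h x) = coulombForm f g + coulombForm f h := by
  have hd : ∀ᵐ x, deriv (fun y => conj (f y) * (g y + h y)) x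
      = deriv (fun y => conj (f y) * g y) x + deriv (fun y => conj (f y) * h y) x := by
    filter_upwards [hf.ae_hasDerivAt, hg.ae_hasDerivAt, hh.ae_hasDerivAt] with x hx hy hz
    rw [(hasDerivAt_conj_mul hx (hy.fun_add hz)).deriv, (hasDerivAt_conj_mul hx hy).deriv,
      (hasDerivAt_conj_mul hx hz).deriv]
    ring
  have hi : ∀ c a b : ℝ,
      MemLp (fun x : ℝ => (Real.log (c * x) : ℂ)) 2 (volume.restrict (uIoc a b)) →
      (∫ x in a..b, (Real.log (c * x) : ℂ) * deriv (fun y => conj (f y) * (g y + h y)) x)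
      = (∫ x in a..b, (Real.log (c * x) : ℂ) * deriv (fun y => conj (f y) * g y) x)
      + ∫ x in a..b, (Real.log (c * x) : ℂ) * deriv (fun y => conj (f y) * h y) x := by
    intro c a b hc
    rw [← intervalIntegral.integral_add (intervalIntegrable_log_mul_deriv hf hg hc)
      (intervalIntegrable_log_mul_deriv hf hh hc)]
    refine intervalIntegral.integral_congr_ae ?_
    filter_upwards [hd] with x hx _
    rw [hx, mul_add]
  have hj : (∫ x in {x : ℝ | 1 / 2 < |x|}, ((1 / |x| : ℝ) : ℂ) * (conj (f x) * (g x + h x)))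
      = (∫ x in {x : ℝ | 1 / 2 < |x|}, ((1 / |x| : ℝ) : ℂ) * (conj (f x) * g x))
      + ∫ x in {x : ℝ | 1 / 2 < |x|}, ((1 / |x| : ℝ) : ℂ) * (conj (f x) * h x) := by
    rw [← integral_add (integrableOn_coulomb hf hg) (integrableOn_coulomb hf hh)]
    congr 1
    ext x
    ring
  unfold coulombForm
  rw [hi _ _ _ memLp_log_right, hi _ _ _ memLp_log_left, hj]
  ring

lemma coulombForm_const_mul (c : ℂ) {f g : ℝ → ℂ} (hf : MemH1 f) (hg : MemH1 g) :
    coulombForm f (fun x => c * g x) = c * coulombForm f g := by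
  have hd : ∀ᵐ x, deriv (fun y => conj (f y) * (c * g y)) x
      = c * deriv (fun y => conj (f y) * g y) x := by
    filter_upwards [hf.ae_hasDerivAt, hg.ae_hasDerivAt] with x hx hy
    rw [(hasDerivAt_conj_mul hx (hy.const_mul c)).deriv, (hasDerivAt_conj_mul hx hy).deriv]
    ring
  have hi : ∀ k a b : ℝ,
      (∫ x in a..b, (Real.log (k * x) : ℂ) * deriv (fun y => conj (f y) * (c * g y)) x)
      = c * (∫ x in a..b, (Real.log (k * x) : ℂ) * deriv (fun y => conj (f y) * g y) x) := by
    intro k a b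
    rw [← intervalIntegral.integral_const_mul]
    refine intervalIntegral.integral_congr_ae ?_
    filter_upwards [hd] with x hx _
    rw [hx]
    ring
  have hj : (∫ x in {x : ℝ | 1 / 2 < |x|}, ((1 / |x| : ℝ) : ℂ) * (conj (f x) * (c * g x)))
      = c * ∫ x in {x : ℝ | 1 / 2 < |x|}, ((1 / |x| : ℝ) : ℂ) * (conj (f x) * g x) := by
    rw [← integral_const_mul]
    congr 1
    ext x
    ring
  unfold coulombForm
  rw [hi, hi, hj]
  ring

lemma formTC_add (r : ℝ) {f g h : ℝ → ℂ} (hf : MemH1 f) (hg : MemH1 g) (hh : MemH1 h) :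
    formTC r f (fun x => g x + h x) = formTC r f g + formTC r f h := by
  have hk : (∫ x, conj (deriv f x) * deriv (fun x => g x + h x) x)
      = (∫ x, conj (deriv f x) * deriv g x) + ∫ x, conj (deriv f x) * deriv h x := by
    rw [← integral_add (integrable_conj_mul hf.memLp_deriv hg.memLp_deriv)
      (integrable_conj_mul hf.memLp_deriv hh.memLp_deriv)]
    refine integral_congr_ae ?_
    filter_upwards [hg.ae_hasDerivAt, hh.ae_hasDerivAt] with x hy hz
    have := (hy.add hz).deriv
    rw [show (fun x => g x + h x) = g + h from rfl, this, mul_add]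
  unfold formTC
  rw [hk, coulombForm_add hf hg hh]
  ring

lemma formTC_const_mul (r : ℝ) (c : ℂ) {f g : ℝ → ℂ} (hf : MemH1 f) (hg : MemH1 g) :
    formTC r f (fun x => c * g x) = c * formTC r f g := by
  have hk : (∫ x, conj (deriv f x) * deriv (fun x => c * g x) x)
      = c * (∫ x, conj (deriv f x) * deriv g x) := by
    rw [← integral_const_mul]
    refine integral_congr_ae ?_
    filter_upwards [hg.ae_hasDerivAt] with x hy
    rw [(hy.const_mul c).deriv]
    ring
  unfold formTC
  rw [hk, coulombForm_const_mul c hf hg]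
  ring

lemma integral_log_mul_deriv_schwartz (f g : 𝓢(ℝ, ℂ)) :
    IntegrableOn (fun x => (Real.log (2 * x) : ℂ) * deriv (fun y => conj (f y) * g y) x)
      (Ioi (1 / 2)) volume ∧
    ∫ x in Ioi (1 / 2 : ℝ), (Real.log (2 * x) : ℂ) * deriv (fun y => conj (f y) * g y) x
      = -∫ x in Ioi (1 / 2 : ℝ), ((1 / |x| : ℝ) : ℂ) * (conj (f x) * g x) := by
  have hdf : ∀ x, HasDerivAt f (deriv f x) x := fun x => f.differentiableAt.hasDerivAt
  have hdg : ∀ x, HasDerivAt g (deriv g x) x := fun x => g.differentiableAt.hasDerivAt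
  have hd : ∀ x, HasDerivAt (fun y => conj (f y) * g y)
      (conj (deriv f x) * g x + conj (f x) * deriv g x) x :=
    fun x => hasDerivAt_conj_mul (hdf x) (hdg x)
  have hbd : ∀ u : 𝓢(ℝ, ℂ), ∃ C, 0 ≤ C ∧ ∀ x ∈ Ioi (1 / 2 : ℝ),
      ‖(Real.log (2 * x) : ℂ) * conj (u x)‖ ≤ C := by
    intro u
    obtain ⟨C, hC⟩ := u.decay 1 0
    refine ⟨2 * C, by linarith [hC.1], fun x (hx : 1 / 2 < x) => ?_⟩
    have h1 := hC.2 x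
    rw [norm_iteratedFDeriv_zero, pow_one, Real.norm_of_nonneg (by linarith)] at h1
    have h2 : Real.log (2 * x) ≤ 2 * x := Real.log_le_self (by linarith)
    have h3 : 0 ≤ Real.log (2 * x) := Real.log_nonneg (by linarith)
    rw [norm_mul, Complex.norm_real, Real.norm_of_nonneg h3, RCLike.norm_conj]
    nlinarith [norm_nonneg (u x)]
  have hml : Measurable (fun x : ℝ => (Real.log (2 * x) : ℂ)) :=
    Complex.measurable_ofReal.comp (Real.measurable_log.comp (measurable_const.mul measurable_id))
  have hint : ∀ u v : 𝓢(ℝ, ℂ), IntegrableOn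
      (fun x => (Real.log (2 * x) : ℂ) * conj (u x) * v x) (Ioi (1 / 2)) volume := by
    intro u v
    obtain ⟨C, -, hC⟩ := hbd u
    refine Integrable.bdd_mul (c := C) v.integrable.restrict
      (hml.aestronglyMeasurable.mul
        (Complex.continuous_conj.comp u.continuous).aestronglyMeasurable) ?_
    filter_upwards [ae_restrict_mem measurableSet_Ioi] with x hx using hC x hx
  have hI : IntegrableOn (fun x => (Real.log (2 * x) : ℂ) *
      (conj (deriv f x) * g x + conj (f x) * deriv g x)) (Ioi (1 / 2)) volume := by
    refine ((hint (SchwartzMap.derivCLM ℝ ℂ f) g).add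
      (hint f (SchwartzMap.derivCLM ℝ ℂ g))).congr (Eventually.of_forall fun x => ?_)
    simp only [Pi.add_apply, SchwartzMap.derivCLM_apply]
    ring
  have hdd : (deriv fun y => conj (f y) * g y)
      = fun x => conj (deriv f x) * g x + conj (f x) * deriv g x := funext fun x => (hd x).deriv
  rw [hdd]
  refine ⟨hI, ?_⟩
  have hl : ∀ x ∈ Ioi (1 / 2 : ℝ),
      HasDerivAt (fun x : ℝ => (Real.log (2 * x) : ℂ)) ((1 / |x| : ℝ) : ℂ) x := by
    intro x (hx : 1 / 2 < x)
    have h := ((hasDerivAt_id x).const_mul 2).log (by simp only [id]; linarith)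
    have e : 2 * 1 / (2 * id x) = 1 / |x| := by
      rw [abs_of_pos (by linarith), id, mul_div_mul_left _ _ (by norm_num)]
    rw [e] at h
    exact h.ofReal_comp
  have h0 : Tendsto ((fun x : ℝ => (Real.log (2 * x) : ℂ)) * fun y => conj (f y) * g y)
      (𝓝[>] (1 / 2)) (𝓝 0) := by
    have hc : ContinuousAt ((fun x : ℝ => (Real.log (2 * x) : ℂ)) * fun y => conj (f y) * g y)
        (1 / 2) := by
      refine ContinuousAt.mul ?_ (hd _).continuousAt
      refine Complex.continuous_ofReal.continuousAt.comp ?_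
      exact ContinuousAt.log (by fun_prop) (by norm_num)
    have h := hc.tendsto
    simp only [Pi.mul_apply] at h
    norm_num at h
    exact h.mono_left nhdsWithin_le_nhds
  have hinf : Tendsto ((fun x : ℝ => (Real.log (2 * x) : ℂ)) * fun y => conj (f y) * g y)
      atTop (𝓝 0) := by
    obtain ⟨C, hC0, hC⟩ := hbd f
    have hg0 : Tendsto (fun x => C * ‖g x‖) atTop (𝓝 0) := by
      have h := (g.toZeroAtInfty.zero_at_infty'.mono_left atTop_le_cocompact).norm.const_mul C
      simpa using h
    refine squeeze_zero_norm' ?_ hg0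
    filter_upwards [eventually_gt_atTop (1 / 2)] with x hx
    rw [Pi.mul_apply, ← mul_assoc, norm_mul]
    exact mul_le_mul_of_nonneg_right (hC x hx) (norm_nonneg _)
  have hJ := (integrableOn_coulomb (MemH1.schwartz f) (MemH1.schwartz g)).mono_set
    (fun x (hx : 1 / 2 < x) => show 1 / 2 < |x| from hx.trans_le (le_abs_self x))
  have := integral_Ioi_mul_deriv_eq_deriv_mul hl (fun x _ => hd x) hI hJ h0 hinf
  rw [this]
  simp

lemma integral_log_mul_deriv_schwartz' (f g : 𝓢(ℝ, ℂ)) :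
    IntegrableOn (fun x => (Real.log (-2 * x) : ℂ) * deriv (fun y => conj (f y) * g y) x)
      (Iio (-(1 / 2))) volume ∧
    ∫ x in Iio (-(1 / 2) : ℝ), (Real.log (-2 * x) : ℂ) * deriv (fun y => conj (f y) * g y) x
      = ∫ x in Iio (-(1 / 2) : ℝ), ((1 / |x| : ℝ) : ℂ) * (conj (f x) * g x) := by
  let R := SchwartzMap.compCLMOfContinuousLinearEquiv ℝ (F := ℂ)
    (ContinuousLinearEquiv.neg ℝ : ℝ ≃L[ℝ] ℝ)
  have hR : ∀ (u : 𝓢(ℝ, ℂ)) x, R u x = u (-x) := fun u x => rfl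
  obtain ⟨h1, h2⟩ := integral_log_mul_deriv_schwartz (R f) (R g)
  have hd : ∀ x, deriv (fun y => conj (R f y) * R g y) x
      = -deriv (fun y => conj (f y) * g y) (-x) := fun x =>
    deriv_comp_neg (fun y => conj (f y) * g y) x
  simp only [hd, mul_neg, integral_neg, neg_inj] at h1 h2
  simp only [hR] at h2
  have e : ∀ x : ℝ, -2 * x = 2 * -x := fun x => by ring
  simp only [e]
  constructor
  · have h3 := h1.neg
    rw [← neg_neg (1 / 2 : ℝ)] at h3
    simpa using h3.comp_neg_Iio
  · have h3 := integral_comp_neg_Ioi (1 / 2)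
      (fun x => (Real.log (2 * -x) : ℂ) * deriv (fun y => conj (f y) * g y) x)
    have h4 := integral_comp_neg_Ioi (1 / 2) (fun x => ((1 / |x| : ℝ) : ℂ) * (conj (f x) * g x))
    simp only [neg_neg, abs_neg] at h3 h4
    rw [← integral_Iic_eq_integral_Iio, ← integral_Iic_eq_integral_Iio, ← h3, ← h4, h2]

/-- On Schwartz functions, `C₀` is given by its defining formula. -/
lemma coulombForm_schwartz (f g : 𝓢(ℝ, ℂ)) :
    coulombForm f g =
      -(∫ x in Ioi (0 : ℝ), (Real.log (2 * x) : ℂ) * deriv (fun y => conj (f y) * g y) x)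
      + ∫ x in Iio (0 : ℝ), (Real.log (-2 * x) : ℂ) * deriv (fun y => conj (f y) * g y) x := by
  obtain ⟨i1, e1⟩ := integral_log_mul_deriv_schwartz f g
  obtain ⟨i2, e2⟩ := integral_log_mul_deriv_schwartz' f g
  have j1 := intervalIntegrable_log_mul_deriv (MemH1.schwartz f) (MemH1.schwartz g) memLp_log_right
  have j2 := intervalIntegrable_log_mul_deriv (MemH1.schwartz f) (MemH1.schwartz g) memLp_log_left
  have hc := integrableOn_coulomb (MemH1.schwartz f) (MemH1.schwartz g)
  have hs : {x : ℝ | 1 / 2 < |x|} = Ioi (1 / 2) ∪ Iio (-(1 / 2)) := by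
    ext x
    change 1 / 2 < |x| ↔ 1 / 2 < x ∨ x < -(1 / 2)
    rw [lt_abs]
    constructor <;> rintro (h | h) <;> first | (left; linarith) | (right; linarith)
  have hdj : Disjoint (Ioi (1 / 2 : ℝ)) (Iio (-(1 / 2))) := by
    rw [Set.disjoint_left]
    intro x (hx : 1 / 2 < x) (hy : x < -(1 / 2))
    linarith
  rw [hs] at hc
  rw [coulombForm, hs, setIntegral_union hdj measurableSet_Iio hc.left_of_union hc.right_of_union,
    intervalIntegral.integral_of_le (by norm_num), intervalIntegral.integral_of_le (by norm_num),
    ← e2, ← neg_eq_iff_eq_neg.2 e1, ← Ioc_union_Ioi_eq_Ioi (show (0 : ℝ) ≤ 1 / 2 by norm_num),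
    setIntegral_union Ioc_disjoint_Ioi_same measurableSet_Ioi
      ((intervalIntegrable_iff_integrableOn_Ioc_of_le (by norm_num)).1 j1) i1,
    ← integral_Iic_eq_integral_Iio (x := (0 : ℝ)),
    ← integral_Iic_eq_integral_Iio (x := (-(1 / 2) : ℝ)),
    ← Iic_union_Ioc_eq_Iic (show (-(1 / 2) : ℝ) ≤ 0 by norm_num),
    setIntegral_union (Iic_disjoint_Ioc le_rfl) measurableSet_Ioc
      (i2.congr_set_ae Iio_ae_eq_Iic.symm)
      ((intervalIntegrable_iff_integrableOn_Ioc_of_le (by norm_num)).1 j2)]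
  ring

/-! ### The operator -/

/-- The Hilbert space `L²(ℝ)`. -/
abbrev L2R : Type := Lp ℂ 2 (volume : Measure ℝ)

/-- The graph of `H_C`: the pairs `(ψ, F)` in `L²(ℝ) × L²(ℝ)` such that `ψ ∈ H¹(ℝ)` and
`t_C(φ, ψ) = ⟨φ, F⟩` for all `φ ∈ H¹(ℝ)`. -/
noncomputable def graphHC (r : ℝ) : Submodule ℂ (L2R × L2R) where
  carrier := {p | ∃ u : ℝ → ℂ, MemH1 u ∧ p.1 =ᵐ[volume] u ∧
    ∀ φ : ℝ → ℂ, MemH1 φ → formTC r φ u = ∫ x, conj (φ x) * p.2 x}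
  zero_mem' := by
    refine ⟨fun _ => 0, MemH1.zero, Lp.coeFn_zero _ _ _, fun φ hφ => ?_⟩
    have h := formTC_const_mul r 0 hφ MemH1.zero
    simp only [zero_mul] at h
    rw [h, integral_congr_ae (g := fun _ => (0 : ℂ)), integral_zero]
    filter_upwards [Lp.coeFn_zero ℂ 2 (volume : Measure ℝ)] with x hx
    rw [Prod.snd_zero, hx]
    simp
  add_mem' := by
    rintro p q ⟨u, hu, hpu, h1⟩ ⟨v, hv, hqv, h2⟩
    refine ⟨fun x => u x + v x, hu.add hv, ?_, fun φ hφ => ?_⟩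
    · filter_upwards [Lp.coeFn_add p.1 q.1, hpu, hqv] with x hx hy hz
      rw [Prod.fst_add, hx, Pi.add_apply, hy, hz]
    · rw [formTC_add r hφ hu hv, h1 φ hφ, h2 φ hφ,
        ← integral_add (integrable_conj_mul hφ.memLp (Lp.memLp p.2))
        (integrable_conj_mul hφ.memLp (Lp.memLp q.2))]
      refine integral_congr_ae ?_
      filter_upwards [Lp.coeFn_add p.2 q.2] with x hx
      rw [Prod.snd_add, hx]
      simp only [Pi.add_apply]
      ring
  smul_mem' := by
    rintro c p ⟨u, hu, hpu, h1⟩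
    refine ⟨fun x => c * u x, hu.const_mul c, ?_, fun φ hφ => ?_⟩
    · filter_upwards [Lp.coeFn_smul c p.1, hpu] with x hx hy
      rw [Prod.smul_fst, hx, Pi.smul_apply, hy, smul_eq_mul]
    · rw [formTC_const_mul r c hφ hu, h1 φ hφ, ← integral_const_mul]
      refine integral_congr_ae ?_
      filter_upwards [Lp.coeFn_smul c p.2] with x hx
      rw [Prod.smul_snd, hx, Pi.smul_apply, smul_eq_mul]
      ring

/-- The self-adjoint operator `H_C` on `L²(ℝ)` generated by the form `t_C`. -/
noncomputable def operatorHC (r : ℝ) : L2R →ₗ.[ℂ] L2R := (graphHC r).toLinearPMap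

lemma eq_zero_of_forall_integral (F : L2R)
    (h : ∀ φ : ℝ → ℂ, MemH1 φ → ∫ x, conj (φ x) * F x = 0) : F = 0 := by
  rw [Lp.eq_zero_iff_ae_eq_zero]
  refine ae_eq_zero_of_integral_contDiff_smul_eq_zero
    ((Lp.memLp F).locallyIntegrable (by norm_num)) fun φ hφ hc => ?_
  have h1 : ContDiff ℝ 1 (fun x => (φ x : ℂ)) :=
    Complex.ofRealCLM.contDiff.comp (hφ.of_le (by simp))
  have hcs : HasCompactSupport (fun x => (φ x : ℂ)) := hc.comp_left (g := Complex.ofReal) (by simp)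
  have := h (fun x => (φ x : ℂ)) (MemH1.of_contDiff h1
    (h1.continuous.memLp_of_hasCompactSupport hcs)
    ((h1.continuous_deriv le_rfl).memLp_of_hasCompactSupport hcs.deriv))
  simpa using this

/-- `graphHC r` is indeed the graph of the operator `operatorHC r`. -/
lemma graph_operatorHC (r : ℝ) : (operatorHC r).graph = graphHC r := by
  refine Submodule.toLinearPMap_graph_eq _ ?_
  rintro ⟨ψ, F⟩ ⟨u, hu, hψ, h⟩ (h0 : ψ = 0)
  refine eq_zero_of_forall_integral F fun φ hφ => ?_
  have hu0 : u = fun _ => 0 := by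
    refine (Continuous.ae_eq_iff_eq volume hu.continuous continuous_const).1 ?_
    refine hψ.symm.trans ?_
    simp only [h0]
    exact Lp.coeFn_zero _ _ _
  have h2 := formTC_const_mul r 0 hφ MemH1.zero
  simp only [zero_mul] at h2
  rw [← h φ hφ, hu0, h2]

/-- The space of all `ψ` in the domain of `H_C` with `H_C ψ = E ψ`. -/
noncomputable def eigenspaceHC (r E : ℝ) : Submodule ℂ L2R :=
  (operatorHC r).graph.comap (LinearMap.prod LinearMap.id ((E : ℂ) • LinearMap.id))

lemma mem_eigenspaceHC (r E : ℝ) (ψ : L2R) : ψ ∈ eigenspaceHC r E ↔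
    ∃ h : ψ ∈ (operatorHC r).domain, operatorHC r ⟨ψ, h⟩ = (E : ℂ) • ψ := by
  simp only [eigenspaceHC, Submodule.mem_comap, LinearMap.prod_apply, Function.prod_apply,
    LinearMap.id_apply, LinearMap.smul_apply, LinearPMap.mem_graph_iff]
  simp

/-- `ψ` is an eigenfunction of `H_C` with eigenvalue `E`. -/
def IsEigenfunctionHC (r E : ℝ) (ψ : L2R) : Prop :=
  ψ ≠ 0 ∧ ∃ h : ψ ∈ (operatorHC r).domain, operatorHC r ⟨ψ, h⟩ = (E : ℂ) • ψ

/-! ### Parity -/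

/-- The reflection `ψ(x) ↦ ψ(-x)` on `L²(ℝ)`. -/
noncomputable def reflection : L2R →ₗ[ℂ] L2R :=
  Lp.compMeasurePreservingₗ ℂ (fun x : ℝ => -x) (Measure.measurePreserving_neg volume)

/-- The projection `P₊` onto the even sector, `(P₊ψ)(x) = (ψ(x) + ψ(-x)) / 2`. -/
noncomputable def parityPlus : L2R →ₗ[ℂ] L2R := (1 / 2 : ℂ) • (LinearMap.id + reflection)

/-- The projection `P₋` onto the odd sector, `(P₋ψ)(x) = (ψ(x) - ψ(-x)) / 2`. -/
noncomputable def parityMinus : L2R →ₗ[ℂ] L2R := (1 / 2 : ℂ) • (LinearMap.id - reflection)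

/-- `ψ` is even: it belongs to the even sector `Ran P₊`. -/
def IsEven (ψ : L2R) : Prop := ψ ∈ LinearMap.range parityPlus

/-- `ψ` is odd: it belongs to the odd sector `Ran P₋`. -/
def IsOdd (ψ : L2R) : Prop := ψ ∈ LinearMap.range parityMinus

/-! ### The quantisation condition -/

/-- `f(α, r) = ψ(1 - α) + 2γ + 1/(2α) - ln α + ln r`, where `ψ = Γ'/Γ` is the digamma function and
`γ` is Euler's constant. -/
noncomputable def quantF (α r : ℝ) : ℝ :=
  logDeriv Real.Gamma (1 - α) + 2 * Real.eulerMascheroniConstant + 1 / (2 * α)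
    - Real.log α + Real.log r

/-!
The eigenvalue equation for the form `t_C` is reduced to an ordinary differential equation, which
is then solved by Whittaker functions.

*Reduction.* For `u ∈ H¹(ℝ)`, the difference `t_C(φ, u) - E⟨φ, u⟩` splits into the contributions
of the two half-lines (`formTC_sub_eq_halfForm_add`). Test functions supported in `(0, ∞)` and the
lemma of du Bois-Reymond show that a weak eigenfunction solves `-u''/2 - u/|x| = E u` classically
away from the origin. Near the origin such a solution has a renormalised slope
`s = lim (u'(x) + 2 ln(2x) u(0))`, and after an integration by parts what is left of the form is a
multiple of the conjugate of `φ(0)`. Hence `u` is an eigenfunction if and only if it solves the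
equation on both sides and the slopes `s`, `t` of `u(x)` and `u(-x)` satisfy the matching condition
`s + t = 4 ln(r) u(0)` (`isWeakEigenfunction_iff`).

*Uniqueness.* The Wronskian of two `H¹` solutions on `(0, ∞)` is constant and integrable, hence
zero, so that such solutions are proportional. A solution with `u(0) = 0` and `s = 0` vanishes
(`IsCoulombSolution.eq_zero_of_hasSlope`). Therefore eigenfunctions of the same parity are
proportional, and an even and an odd eigenfunction cannot share an eigenvalue: proportionality
would give `u(0) = 0`, and then the matching condition would give `s = 0` for the even one. As the
eigenspaces are invariant under reflection, they are one-dimensional and their elements have a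
parity (`eigenspaceHC_eq_span`, `parity_of_mem_eigenspaceHC`).

*Solution.* With `E = -1/(2α²)` and `z = 2x/α` the equation becomes Whittaker's equation
`W'' = (1/4 - α/z) W`. For `0 < α < 1` its decaying solution is an explicit combination of Laplace
integrals, for the index `0` it is `e^{-z/2}`, and `W ↦ (z/2 - κ) W - z W'` raises the index `κ` by
`1` (`IsWhittaker.raise`), which yields the decaying solution for all `α > 0`. For integers `α` it
vanishes at the origin, so that its odd extension satisfies the matching condition for every `r`.
For other `α` it does not vanish at the origin, which rules out odd eigenfunctions, and its slope
is computed from `∫₀^∞ e^{-zt} t^{-κ} (1 + t)^{κ-1} dt = -ln z - (Γ'/Γ)(1 - κ) - 2γ + o(1)`, that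
is, from Gauss' integral for the digamma function. The matching condition for the even extension
is then the quantisation condition.

*Roots.* On `(k - 1, k)` the left-hand side of the quantisation condition decreases strictly from
`∞` to `-∞`, since the digamma function is monotone on `(0, ∞)` and the recurrence for it splits
off its poles (`exists_quantF_eq_zero`).
-/

/-! ### Primitives of integrable functions -/

/-- On `[a, b]` the function `f` is a primitive of the integrable function `f'`. -/
def IsPrimitiveOn (f f' : ℝ → ℂ) (a b : ℝ) : Prop :=
  IntervalIntegrable f' volume a b ∧ ∀ x ∈ Icc a b, f x = f a + ∫ t in a..x, f' t

/-- Complex valued integrals are absolutely continuous. -/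
lemma absolutelyContinuousOnInterval_integral {f : ℝ → ℂ} {a b : ℝ}
    (hf : IntervalIntegrable f volume a b) (c : ℂ) :
    AbsolutelyContinuousOnInterval (fun x => c + ∫ t in a..x, f t) a b := by
  have hr := (hf.norm).absolutelyContinuousOnInterval_intervalIntegral (c := a) (by simp)
  rw [AbsolutelyContinuousOnInterval] at hr ⊢
  refine squeeze_zero' (Eventually.of_forall fun E => Finset.sum_nonneg fun i _ => dist_nonneg)
    ?_ hr
  have hm : ∀ᶠ E in AbsolutelyContinuousOnInterval.totalLengthFilter ⊓
      𝓟 (AbsolutelyContinuousOnInterval.disjWithin a b),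
      E ∈ AbsolutelyContinuousOnInterval.disjWithin a b :=
    eventually_inf_principal.2 (Eventually.of_forall fun _ h => h)
  filter_upwards [hm] with E hE
  refine Finset.sum_le_sum fun i hi => ?_
  obtain ⟨h1, h2⟩ := hE.1 i hi
  have i1 := hf.mono_set (uIcc_subset_uIcc_left h1)
  have i2 := hf.mono_set (uIcc_subset_uIcc_left h2)
  rw [dist_add_left, dist_eq_norm, dist_eq_norm, intervalIntegral.integral_interval_sub_left i1 i2,
    intervalIntegral.integral_interval_sub_left i1.norm i2.norm, Real.norm_eq_abs]
  exact intervalIntegral.norm_integral_le_abs_integral_norm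

lemma integral_deriv_mul_primitive {f g : ℝ → ℂ} {a b : ℝ}
    (hf : IntervalIntegrable f volume a b) (hg : IntervalIntegrable g volume a b) (c d : ℂ) :
    ∫ x in a..b, (f x * (d + ∫ t in a..x, g t) + (c + ∫ t in a..x, f t) * g x)
      = (c + ∫ t in a..b, f t) * (d + ∫ t in a..b, g t) - c * d := by
  have aF := absolutelyContinuousOnInterval_integral hf c
  have aG := absolutelyContinuousOnInterval_integral hg d
  have hi : IntervalIntegrable (fun x => f x * (d + ∫ t in a..x, g t)
      + (c + ∫ t in a..x, f t) * g x) volume a b :=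
    (hf.mul_continuousOn aG.continuousOn).add (hg.continuousOn_mul aF.continuousOn)
  have aP := (aF.smul aG).sub (absolutelyContinuousOnInterval_integral hi 0)
  obtain ⟨C, hC⟩ := aP.const_of_ae_hasDerivAt_zero (by
    filter_upwards [hf.ae_hasDerivAt_integral, hg.ae_hasDerivAt_integral,
      hi.ae_hasDerivAt_integral] with x h1 h2 h3 hx
    have := (((h1 hx a (by simp)).const_add c).mul ((h2 hx a (by simp)).const_add d)).sub
      ((h3 hx a (by simp)).const_add 0)
    refine this.congr_deriv ?_
    ring)
  have e1 := hC a (by simp)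
  have e2 := hC b (by simp)
  simp at e1 e2
  rw [← e1] at e2
  linear_combination -e2

namespace IsPrimitiveOn

variable {f g f' g' : ℝ → ℂ} {a b : ℝ}

lemma mono (hf : IsPrimitiveOn f f' a b) {c : ℝ} (hc : c ∈ Icc a b) : IsPrimitiveOn f f' a c :=
  ⟨hf.1.mono_set (by
    rw [uIcc_of_le hc.1, uIcc_of_le (hc.1.trans hc.2)]
    exact Icc_subset_Icc_right hc.2), fun x hx => hf.2 x ⟨hx.1, hx.2.trans hc.2⟩⟩

lemma continuousOn (hf : IsPrimitiveOn f f' a b) (hab : a ≤ b) : ContinuousOn f (Icc a b) := by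
  have := (absolutelyContinuousOnInterval_integral hf.1 (f a)).continuousOn
  rw [uIcc_of_le hab] at this
  exact this.congr hf.2

lemma integral_eq_sub (hf : IsPrimitiveOn f f' a b) (hab : a ≤ b) :
    ∫ x in a..b, f' x = f b - f a := by
  rw [hf.2 b ⟨hab, le_rfl⟩]
  ring

lemma mul (hf : IsPrimitiveOn f f' a b) (hg : IsPrimitiveOn g g' a b) (hab : a ≤ b) :
    IsPrimitiveOn (fun x => f x * g x) (fun x => f' x * g x + f x * g' x) a b := by
  have hcf := hf.continuousOn hab
  have hcg := hg.continuousOn hab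
  rw [← uIcc_of_le hab] at hcf hcg
  refine ⟨(hf.1.mul_continuousOn hcg).add (hg.1.continuousOn_mul hcf), fun x hx => ?_⟩
  have := integral_deriv_mul_primitive (hf.mono hx).1 (hg.mono hx).1 (f a) (g a)
  rw [← hf.2 x hx, ← hg.2 x hx] at this
  refine eq_add_of_sub_eq' (this.symm.trans ?_)
  refine intervalIntegral.integral_congr fun y hy => ?_
  rw [uIcc_of_le hx.1] at hy
  have hy' : y ∈ Icc a b := ⟨hy.1, hy.2.trans hx.2⟩
  rw [← hf.2 y hy', ← hg.2 y hy']

lemma of_hasDerivAt (hf : ∀ x ∈ Icc a b, HasDerivAt f (f' x) x) (hc : ContinuousOn f' (Icc a b))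
    (hab : a ≤ b) : IsPrimitiveOn f f' a b := by
  refine ⟨(hc.mono (by rw [uIcc_of_le hab])).intervalIntegrable, fun x hx => ?_⟩
  rw [intervalIntegral.integral_eq_sub_of_hasDerivAt]
  · ring
  · intro y hy
    rw [uIcc_of_le hx.1] at hy
    exact hf y ⟨hy.1, hy.2.trans hx.2⟩
  · refine (hc.mono ?_).intervalIntegrable
    rw [uIcc_of_le hx.1]
    exact Icc_subset_Icc_right hx.2

lemma congr (hf : IsPrimitiveOn f f' a b) (h : f' =ᵐ[volume] g') : IsPrimitiveOn f g' a b :=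
  ⟨hf.1.congr_ae (ae_restrict_of_ae h), fun x hx => by
    rw [hf.2 x hx]
    congr 1
    exact intervalIntegral.integral_congr_ae (h.mono fun y hy _ => hy)⟩

lemma star (hf : IsPrimitiveOn f f' a b) :
    IsPrimitiveOn (fun x => conj (f x)) (fun x => conj (f' x)) a b := by
  refine ⟨?_, fun x hx => ?_⟩
  · have := hf.1
    rw [intervalIntegrable_iff] at this ⊢
    exact (Complex.conjCLE : ℂ →L[ℝ] ℂ).integrable_comp this
  · simp only
    rw [hf.2 x hx, map_add, intervalIntegral.integral_of_le hx.1,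
      intervalIntegral.integral_of_le hx.1, integral_conj]

end IsPrimitiveOn

namespace MemH1

variable {f g : ℝ → ℂ}

lemma isPrimitiveOn (hf : MemH1 f) (a b : ℝ) : IsPrimitiveOn f (deriv f) a b := by
  obtain ⟨h0, g, hg, hfg⟩ := hf
  have hi := intervalIntegrable_of_memLp hg
  have hd : g =ᵐ[volume] deriv f := by
    have hl : LocallyIntegrable g volume := hg.locallyIntegrable (by norm_num)
    filter_upwards [LocallyIntegrable.ae_hasDerivAt_integral hl] with x hx
    have h := (hx 0).const_add (f 0)
    rw [← funext hfg] at h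
    exact h.deriv.symm
  refine IsPrimitiveOn.congr ⟨hi a b, fun x _ => ?_⟩ hd
  rw [hfg x, hfg a, ← intervalIntegral.integral_add_adjacent_intervals (hi 0 a) (hi a x)]
  ring

lemma sub_eq_integral (hf : MemH1 f) (a b : ℝ) : f b - f a = ∫ x in a..b, deriv f x := by
  rcases le_total a b with h | h
  · exact ((hf.isPrimitiveOn a b).integral_eq_sub h).symm
  · rw [intervalIntegral.integral_symm, (hf.isPrimitiveOn b a).integral_eq_sub h]
    ring

/-- Elements of `H¹(ℝ)` are Hölder continuous of exponent `1/2`. -/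
lemma exists_norm_sub_le (hf : MemH1 f) : ∃ C, 0 ≤ C ∧ ∀ x, 0 ≤ x → ‖f x - f 0‖ ≤ C * √x := by
  have hL := hf.memLp_deriv
  have hsq := (memLp_two_iff_integrable_sq_norm hL.1).1 hL
  refine ⟨√(∫ x, ‖deriv f x‖ ^ 2), Real.sqrt_nonneg _, fun x hx => ?_⟩
  rw [hf.sub_eq_integral 0 x, intervalIntegral.integral_of_le hx]
  refine (norm_integral_le_integral_norm _).trans ?_
  have h := integral_mul_le_Lp_mul_Lq_of_nonneg (μ := volume.restrict (Ioc 0 x))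
    Real.HolderConjugate.two_two
    (f := fun x => ‖deriv f x‖) (g := fun _ => 1) (Eventually.of_forall fun _ => norm_nonneg _)
    (Eventually.of_forall fun _ => zero_le_one) (by simpa using hL.norm.restrict (Ioc 0 x))
    (memLp_const 1)
  simp only [mul_one, Real.one_rpow, integral_const, measureReal_restrict_apply_univ,
    Real.volume_real_Ioc_of_le hx, sub_zero, smul_eq_mul, ← Real.sqrt_eq_rpow] at h
  refine h.trans (mul_le_mul_of_nonneg_right (Real.sqrt_le_sqrt ?_) (Real.sqrt_nonneg _))
  simp only [Real.rpow_ofNat]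
  exact setIntegral_le_integral hsq (Eventually.of_forall fun _ => by positivity)

lemma comp_neg (hf : MemH1 f) : MemH1 (fun x => f (-x)) := by
  obtain ⟨h0, g, hg, hfg⟩ := hf
  refine ⟨h0.comp_measurePreserving (Measure.measurePreserving_neg volume), fun x => -g (-x),
    (hg.comp_measurePreserving (Measure.measurePreserving_neg volume)).neg, fun x => ?_⟩
  simp only
  rw [hfg (-x), intervalIntegral.integral_neg, intervalIntegral.integral_comp_neg,
    intervalIntegral.integral_symm]
  simp

lemma mul_isPrimitiveOn (hf : MemH1 f) (hg : MemH1 g) {a b : ℝ} (hab : a ≤ b) :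
    IsPrimitiveOn (fun x => conj (f x) * g x)
      (fun x => conj (deriv f x) * g x + conj (f x) * deriv g x) a b :=
  ((hf.isPrimitiveOn a b).star).mul (hg.isPrimitiveOn a b) hab

lemma deriv_conj_mul_ae (hf : MemH1 f) (hg : MemH1 g) :
    deriv (fun y => conj (f y) * g y) =ᵐ[volume]
      fun x => conj (deriv f x) * g x + conj (f x) * deriv g x := by
  filter_upwards [hf.ae_hasDerivAt, hg.ae_hasDerivAt] with x hx hy
  exact (hasDerivAt_conj_mul hx hy).deriv

/-- A continuous function with a square integrable derivative outside `0` lies in `H¹(ℝ)`. -/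
lemma of_hasDerivAt {f' : ℝ → ℂ} (hc : Continuous f) (hd : ∀ x, x ≠ 0 → HasDerivAt f (f' x) x)
    (h0 : MemLp f 2 volume) (h1 : MemLp f' 2 volume) : MemH1 f := by
  refine ⟨h0, f', h1, fun x => ?_⟩
  rw [integral_eq_of_hasDerivAt_off_countable f f' (countable_singleton 0)
    hc.continuousOn (fun y hy => hd y hy.2) (intervalIntegrable_of_memLp h1 0 x)]
  ring

end MemH1

/-! ### Splitting the form at the origin -/

/-- The contribution of the half-line `(0, ∞)` to `t_C(φ, u) - E ⟨φ, u⟩`; the point interaction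
`2 ln(r) φ̄(0) u(0)` is shared equally between the two half-lines. -/
noncomputable def halfForm (r E : ℝ) (φ u : ℝ → ℂ) : ℂ :=
  1 / 2 * (∫ x in Ioi (0 : ℝ), conj (deriv φ x) * deriv u x)
    + (Real.log r : ℂ) * (conj (φ 0) * u 0)
    - (-(∫ x in (0 : ℝ)..(1 / 2), (Real.log (2 * x) : ℂ) * deriv (fun y => conj (φ y) * u y) x)
      + ∫ x in Ioi (1 / 2 : ℝ), ((1 / x : ℝ) : ℂ) * (conj (φ x) * u x))
    - E * ∫ x in Ioi (0 : ℝ), conj (φ x) * u x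

lemma integral_eq_add_integral_comp_neg {f : ℝ → ℂ} (hf : Integrable f) :
    ∫ x, f x = (∫ x in Ioi (0 : ℝ), f x) + ∫ x in Ioi (0 : ℝ), f (-x) := by
  rw [integral_comp_neg_Ioi, neg_zero, add_comm,
    intervalIntegral.integral_Iic_add_Ioi hf.integrableOn hf.integrableOn]

lemma formTC_sub_eq_halfForm_add (r E : ℝ) {φ u : ℝ → ℂ} (hφ : MemH1 φ) (hu : MemH1 u) :
    formTC r φ u - E * (∫ x, conj (φ x) * u x)
      = halfForm r E φ u + halfForm r E (fun x => φ (-x)) (fun x => u (-x)) := by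
  have h1 := integral_eq_add_integral_comp_neg (integrable_conj_mul hφ.memLp_deriv hu.memLp_deriv)
  have h2 := integral_eq_add_integral_comp_neg (integrable_conj_mul hφ.memLp hu.memLp)
  have hs : {x : ℝ | 1 / 2 < |x|} = Ioi (1 / 2) ∪ Iio (-(1 / 2)) := by
    ext x
    change 1 / 2 < |x| ↔ 1 / 2 < x ∨ x < -(1 / 2)
    rw [lt_abs]
    constructor <;> rintro (h | h) <;> first | (left; linarith) | (right; linarith)
  have hdj : Disjoint (Ioi (1 / 2 : ℝ)) (Iio (-(1 / 2))) := by
    rw [Set.disjoint_left]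
    intro x (hx : 1 / 2 < x) (hy : x < -(1 / 2))
    linarith
  have hc := integrableOn_coulomb hφ hu
  rw [hs] at hc
  have h3 : (∫ x in {x : ℝ | 1 / 2 < |x|}, ((1 / |x| : ℝ) : ℂ) * (conj (φ x) * u x))
      = (∫ x in Ioi (1 / 2 : ℝ), ((1 / x : ℝ) : ℂ) * (conj (φ x) * u x))
        + ∫ x in Ioi (1 / 2 : ℝ), ((1 / x : ℝ) : ℂ) * (conj (φ (-x)) * u (-x)) := by
    rw [hs, setIntegral_union hdj measurableSet_Iio hc.left_of_union hc.right_of_union]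
    congr 1
    · refine setIntegral_congr_fun measurableSet_Ioi fun x (hx : 1 / 2 < x) => ?_
      rw [abs_of_pos (by linarith)]
    · rw [← integral_Iic_eq_integral_Iio, ← integral_comp_neg_Ioi]
      refine setIntegral_congr_fun measurableSet_Ioi fun x (hx : 1 / 2 < x) => ?_
      simp only [abs_neg]
      rw [abs_of_pos (by linarith)]
  have h4 : (∫ x in (-(1 / 2) : ℝ)..0,
        (Real.log (-2 * x) : ℂ) * deriv (fun y => conj (φ y) * u y) x)
      = -∫ x in (0 : ℝ)..(1 / 2),
        (Real.log (2 * x) : ℂ) * deriv (fun y => conj (φ (-y)) * u (-y)) x := by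
    rw [← intervalIntegral.integral_neg, ← neg_zero, ← intervalIntegral.integral_comp_neg, neg_zero]
    refine intervalIntegral.integral_congr fun x _ => ?_
    have h := deriv_comp_neg (fun y => conj (φ y) * u y) x
    rw [h]
    simp
  have h5 : ∀ f : ℝ → ℂ, deriv (fun x => f (-x)) = fun x => -deriv f (-x) := fun f =>
    funext fun x => deriv_comp_neg f x
  unfold formTC coulombForm halfForm
  rw [h1, h2, h3, h4, h5, h5]
  simp only [map_neg, neg_mul_neg, neg_zero]
  ring

lemma tendsto_setIntegral_Ioi_zero {f : ℝ → ℂ} (hf : Integrable f) :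
    Tendsto (fun ε => ∫ x in Ioi ε, f x) (𝓝[>] 0) (𝓝 (∫ x in Ioi (0 : ℝ), f x)) := by
  have h : ∀ ε, ∫ x in Ioi ε, f x = (∫ x in Ioi (0 : ℝ), f x) - ∫ x in (0 : ℝ)..ε, f x := by
    intro ε
    rw [← intervalIntegral.integral_interval_add_Ioi (a := 0) (b := ε) hf.integrableOn
      hf.integrableOn]
    ring
  rw [funext h]
  have := (intervalIntegral.continuous_primitive (fun a b => hf.intervalIntegrable) 0).tendsto 0
  simpa using (this.mono_left nhdsWithin_le_nhds).const_sub (∫ x in Ioi (0 : ℝ), f x)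

lemma integrableOn_inv_mul_Ioi {f : ℝ → ℂ} (hf : Integrable f) {ε : ℝ} (hε : 0 < ε) :
    IntegrableOn (fun x => ((1 / x : ℝ) : ℂ) * f x) (Ioi ε) := by
  refine Integrable.bdd_mul (c := 1 / ε) hf.restrict
    (Complex.measurable_ofReal.comp (measurable_const.div measurable_id)).aestronglyMeasurable ?_
  filter_upwards [ae_restrict_mem measurableSet_Ioi] with x (hx : ε < x)
  rw [Complex.norm_real, Real.norm_of_nonneg (by have := hε.trans hx; positivity)]
  exact one_div_le_one_div_of_le hε hx.le

lemma tendsto_sqrt_mul_log : Tendsto (fun x : ℝ => √x * Real.log (2 * x)) (𝓝[>] 0) (𝓝 0) := by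
  have h := tendsto_log_mul_rpow_nhdsGT_zero (show (0 : ℝ) < 1 / 2 by norm_num)
  have h2 : Tendsto (fun x : ℝ => √x * Real.log 2) (𝓝[>] 0) (𝓝 0) := by
    have : Tendsto (fun x : ℝ => √x * Real.log 2) (𝓝 0) (𝓝 (√0 * Real.log 2)) :=
      (Real.continuous_sqrt.tendsto 0).mul_const _
    rw [Real.sqrt_zero, zero_mul] at this
    exact this.mono_left nhdsWithin_le_nhds
  have := h2.add h
  rw [add_zero] at this
  refine this.congr' ?_
  filter_upwards [self_mem_nhdsWithin] with x (hx : 0 < x)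
  rw [Real.log_mul (by norm_num) hx.ne', Real.sqrt_eq_rpow]
  ring

/-- Multiplied by a logarithm, an increment of an `H¹` function near the origin is negligible. -/
lemma MemH1.tendsto_log_mul_sub {f : ℝ → ℂ} (hf : MemH1 f) :
    Tendsto (fun x => (Real.log (2 * x) : ℂ) * (f x - f 0)) (𝓝[>] 0) (𝓝 0) := by
  obtain ⟨C, -, h⟩ := hf.exists_norm_sub_le
  have := (tendsto_sqrt_mul_log.abs).const_mul C
  rw [abs_zero, mul_zero] at this
  refine squeeze_zero_norm' ?_ this
  filter_upwards [self_mem_nhdsWithin] with x (hx : 0 < x)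
  rw [norm_mul, Complex.norm_real, Real.norm_eq_abs, abs_mul, abs_of_nonneg (Real.sqrt_nonneg x)]
  calc _ ≤ |Real.log (2 * x)| * (C * √x) := by gcongr; exact h x hx.le
    _ = _ := by ring

lemma MemH1.tendsto_nhdsGT_zero {f : ℝ → ℂ} (hf : MemH1 f) : Tendsto f (𝓝[>] 0) (𝓝 (f 0)) :=
  (hf.continuous.tendsto 0).mono_left nhdsWithin_le_nhds

/-- The half-line form as the limit of the forms with the interval `(0, ε)` cut out: the
logarithmic divergence of the Coulomb energy is compensated by `ln(2ε) φ̄(0) u(0)`. -/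
lemma tendsto_halfForm (r E : ℝ) {φ u : ℝ → ℂ} (hφ : MemH1 φ) (hu : MemH1 u) :
    Tendsto (fun ε : ℝ => (∫ x in Ioi ε, (1 / 2 * (conj (deriv φ x) * deriv u x)
        - ((E + 1 / x : ℝ) : ℂ) * (conj (φ x) * u x)))
        + ((Real.log r : ℂ) - Real.log (2 * ε)) * (conj (φ 0) * u 0))
      (𝓝[>] 0) (𝓝 (halfForm r E φ u)) := by
  have i1 := integrable_conj_mul hφ.memLp_deriv hu.memLp_deriv
  have i2 := integrable_conj_mul hφ.memLp hu.memLp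
  have il := intervalIntegrable_log_mul_deriv hφ hu memLp_log_right
  have t1 := tendsto_setIntegral_Ioi_zero i1
  have t2 := tendsto_setIntegral_Ioi_zero i2
  have t3 : Tendsto (fun ε : ℝ => (Real.log (2 * ε) : ℂ) * (conj (φ ε) * u ε - conj (φ 0) * u 0))
      (𝓝[>] 0) (𝓝 0) := by
    have a1 := (hφ.tendsto_log_mul_sub.star).mul hu.tendsto_nhdsGT_zero
    have a2 := hu.tendsto_log_mul_sub.const_mul (conj (φ 0))
    have := a1.add a2
    simp only [star_zero, zero_mul, mul_zero, add_zero] at this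
    refine this.congr fun ε => ?_
    simp only [star_mul', star_sub, RCLike.star_def, Complex.conj_ofReal]
    ring
  have t4 : Tendsto (fun ε => ∫ x in ε..(1 / 2 : ℝ),
      (Real.log (2 * x) : ℂ) * deriv (fun y => conj (φ y) * u y) x) (𝓝[>] 0)
      (𝓝 (∫ x in (0 : ℝ)..(1 / 2),
        (Real.log (2 * x) : ℂ) * deriv (fun y => conj (φ y) * u y) x)) := by
    have hc := intervalIntegral.continuousOn_primitive_interval'
      (a := 0) (b₁ := 0) (b₂ := 1 / 2) il (by simp)
    have h0 := (hc 0 (by simp)).mono_left (nhdsWithin_mono 0 (s := Ioc 0 (1 / 2)) (by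
      rw [uIcc_of_le (by norm_num)]; exact Ioc_subset_Icc_self))
    rw [nhdsWithin_Ioc_eq_nhdsGT (by norm_num : (0 : ℝ) < 1 / 2)] at h0
    simp only [intervalIntegral.integral_same] at h0
    have h1 := h0.const_sub (∫ x in (0 : ℝ)..(1 / 2),
        (Real.log (2 * x) : ℂ) * deriv (fun y => conj (φ y) * u y) x)
    rw [sub_zero] at h1
    refine h1.congr' ?_
    filter_upwards [Ioo_mem_nhdsGT (by norm_num : (0 : ℝ) < 1 / 2)] with ε hε
    rw [sub_eq_iff_eq_add', intervalIntegral.integral_add_adjacent_intervals]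
    · refine il.mono_set ?_
      rw [uIcc_of_le hε.1.le, uIcc_of_le (by norm_num)]
      exact Icc_subset_Icc_right hε.2.le
    · refine il.mono_set ?_
      rw [uIcc_of_le hε.2.le, uIcc_of_le (by norm_num)]
      exact Icc_subset_Icc_left hε.1.le
  have key : ∀ ε ∈ Ioo (0 : ℝ) (1 / 2),
      (∫ x in Ioi ε, ((1 / x : ℝ) : ℂ) * (conj (φ x) * u x))
      = -(∫ x in ε..(1 / 2 : ℝ), (Real.log (2 * x) : ℂ) * deriv (fun y => conj (φ y) * u y) x)
        - (Real.log (2 * ε) : ℂ) * (conj (φ ε) * u ε)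
        + ∫ x in Ioi (1 / 2 : ℝ), ((1 / x : ℝ) : ℂ) * (conj (φ x) * u x) := by
    intro ε hε
    have hlog : IsPrimitiveOn (fun x : ℝ => (Real.log (2 * x) : ℂ)) (fun x => ((1 / x : ℝ) : ℂ))
        ε (1 / 2) := by
      refine IsPrimitiveOn.of_hasDerivAt (fun x hx => ?_) ?_ hε.2.le
      · have hx0 : 0 < x := hε.1.trans_le hx.1
        have h := ((hasDerivAt_id x).const_mul 2).log (by simp only [id]; linarith)
        have e : 2 * 1 / (2 * id x) = 1 / x := by
          rw [id, mul_div_mul_left _ _ (by norm_num)]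
        rw [e] at h
        exact h.ofReal_comp
      · refine Complex.continuous_ofReal.comp_continuousOn ?_
        exact continuousOn_const.div continuousOn_id fun x hx => (hε.1.trans_le hx.1).ne'
    have hp := hφ.mul_isPrimitiveOn hu hε.2.le
    have hq := hlog.mul hp hε.2.le
    have h1 := hq.integral_eq_sub hε.2.le
    have ij1 : IntervalIntegrable (fun x => ((1 / x : ℝ) : ℂ) * (conj (φ x) * u x))
        volume ε (1 / 2) := by
      have hcc := hp.continuousOn hε.2.le
      rw [← uIcc_of_le hε.2.le] at hcc
      exact hlog.1.mul_continuousOn hcc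
    have ij2 : IntervalIntegrable (fun x => (Real.log (2 * x) : ℂ) *
        (conj (deriv φ x) * u x + conj (φ x) * deriv u x)) volume ε (1 / 2) := by
      have hcc := hlog.continuousOn hε.2.le
      rw [← uIcc_of_le hε.2.le] at hcc
      exact hp.1.continuousOn_mul hcc
    rw [intervalIntegral.integral_add ij1 ij2] at h1
    have h2 : (∫ x in ε..(1 / 2 : ℝ), (Real.log (2 * x) : ℂ) *
        (conj (deriv φ x) * u x + conj (φ x) * deriv u x))
        = ∫ x in ε..(1 / 2 : ℝ), (Real.log (2 * x) : ℂ) * deriv (fun y => conj (φ y) * u y) x := by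
      refine intervalIntegral.integral_congr_ae ?_
      filter_upwards [hφ.deriv_conj_mul_ae hu] with x hx _
      rw [hx]
    rw [h2] at h1
    have h3 := intervalIntegral.integral_interval_add_Ioi (integrableOn_inv_mul_Ioi i2 hε.1)
      (integrableOn_inv_mul_Ioi i2 (by norm_num : (0 : ℝ) < 1 / 2))
    norm_num at h1 h3 ⊢
    linear_combination h1 - h3
  have hlim := (((t1.const_mul (1 / 2)).sub (t2.const_mul (E : ℂ))).add (t4.add t3)).add
    (tendsto_const_nhds (x := (Real.log r : ℂ) * (conj (φ 0) * u 0)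
      - ∫ x in Ioi (1 / 2 : ℝ), ((1 / x : ℝ) : ℂ) * (conj (φ x) * u x)))
  have hval : 1 / 2 * (∫ x in Ioi (0 : ℝ), conj (deriv φ x) * deriv u x)
      - (E : ℂ) * (∫ x in Ioi (0 : ℝ), conj (φ x) * u x)
      + ((∫ x in (0 : ℝ)..(1 / 2), (Real.log (2 * x) : ℂ) * deriv (fun y => conj (φ y) * u y) x)
        + 0) + ((Real.log r : ℂ) * (conj (φ 0) * u 0)
      - ∫ x in Ioi (1 / 2 : ℝ), ((1 / x : ℝ) : ℂ) * (conj (φ x) * u x)) = halfForm r E φ u := by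
    unfold halfForm
    ring
  rw [hval] at hlim
  refine hlim.congr' ?_
  filter_upwards [Ioo_mem_nhdsGT (by norm_num : (0 : ℝ) < 1 / 2)] with ε hε
  have e : ∀ x : ℝ, 1 / 2 * (conj (deriv φ x) * deriv u x)
      - ((E + 1 / x : ℝ) : ℂ) * (conj (φ x) * u x)
      = 1 / 2 * (conj (deriv φ x) * deriv u x) - E * (conj (φ x) * u x)
        - ((1 / x : ℝ) : ℂ) * (conj (φ x) * u x) := by
    intro x
    push_cast
    ring
  simp only [e]
  have hsub := integral_sub ((i1.restrict (s := Ioi ε).const_mul (1 / 2)).sub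
    (i2.restrict.const_mul (E : ℂ))) (integrableOn_inv_mul_Ioi i2 hε.1)
  simp only [Pi.sub_apply] at hsub
  rw [hsub, integral_sub (i1.restrict.const_mul _) (i2.restrict.const_mul _), integral_const_mul,
    integral_const_mul, key ε hε]
  ring

/-! ### The differential equation on the half-line -/

/-- On `(0, ∞)` the function `u` satisfies `-½ u'' - u / x = E u`. -/
def IsCoulombSolution (E : ℝ) (u : ℝ → ℂ) : Prop :=
  ∀ x, 0 < x → HasDerivAt u (deriv u x) x ∧
    HasDerivAt (deriv u) (-2 * ((E + 1 / x : ℝ) : ℂ) * u x) x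

/-- The renormalised slope at `0+`, `s = lim (u'(x) + 2 ln(2x) u(0))`. The Coulomb singularity
forces `u'` to diverge like `-2 u(0) ln x`. -/
def HasSlope (u : ℝ → ℂ) (s : ℂ) : Prop :=
  Tendsto (fun x : ℝ => deriv u x + 2 * (Real.log (2 * x) : ℂ) * u 0) (𝓝[>] 0) (𝓝 s)

lemma continuousOn_potential (E : ℝ) {u : ℝ → ℂ} (hu : ContinuousOn u (Ioi 0)) :
    ContinuousOn (fun x : ℝ => ((E + 1 / x : ℝ) : ℂ) * u x) (Ioi 0) := by
  refine ContinuousOn.mul (Complex.continuous_ofReal.comp_continuousOn ?_) hu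
  exact continuousOn_const.add (continuousOn_const.div continuousOn_id fun x hx => ne_of_gt hx)

lemma integrableOn_halfForm_integrand (E : ℝ) {φ u : ℝ → ℂ} (hφ : MemH1 φ) (hu : MemH1 u) {ε : ℝ}
    (hε : 0 < ε) : IntegrableOn (fun x => 1 / 2 * (conj (deriv φ x) * deriv u x)
        - ((E + 1 / x : ℝ) : ℂ) * (conj (φ x) * u x)) (Ioi ε) := by
  have i2 := integrable_conj_mul hφ.memLp hu.memLp
  have h := ((integrable_conj_mul hφ.memLp_deriv hu.memLp_deriv).restrict (s := Ioi ε)).const_mul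
    (1 / 2) |>.sub ((i2.restrict.const_mul (E : ℂ)).add (integrableOn_inv_mul_Ioi i2 hε))
  refine h.congr (Eventually.of_forall fun x => ?_)
  simp only [Pi.sub_apply, Pi.add_apply]
  push_cast
  ring

namespace IsCoulombSolution

variable {E : ℝ} {u : ℝ → ℂ}

lemma continuousOn (h : IsCoulombSolution E u) : ContinuousOn u (Ioi 0) :=
  fun x hx => (h x hx).1.continuousAt.continuousWithinAt

lemma integral_Ioi (h : IsCoulombSolution E u) (hu : MemH1 u) {φ : ℝ → ℂ} (hφ : MemH1 φ) {ε : ℝ}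
    (hε : 0 < ε) : ∫ x in Ioi ε, (1 / 2 * (conj (deriv φ x) * deriv u x)
        - ((E + 1 / x : ℝ) : ℂ) * (conj (φ x) * u x)) = -(1 / 2) * (conj (φ ε) * deriv u ε) := by
  have hi := integrableOn_halfForm_integrand E hφ hu hε
  have hfin : ∀ R, ε ≤ R → ∫ x in ε..R, (1 / 2 * (conj (deriv φ x) * deriv u x)
        - ((E + 1 / x : ℝ) : ℂ) * (conj (φ x) * u x))
      = 1 / 2 * (conj (φ R) * deriv u R) - 1 / 2 * (conj (φ ε) * deriv u ε) := by
    intro R hR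
    have hsub : Icc ε R ⊆ Ioi 0 := fun x hx => hε.trans_le hx.1
    have hp : IsPrimitiveOn (deriv u) (fun x => -2 * ((E + 1 / x : ℝ) : ℂ) * u x) ε R := by
      refine IsPrimitiveOn.of_hasDerivAt (fun x hx => (h x (hsub hx)).2) ?_ hR
      simp only [mul_assoc]
      exact continuousOn_const.mul ((continuousOn_potential E h.continuousOn).mono hsub)
    have := ((hφ.isPrimitiveOn ε R).star.mul hp hR).integral_eq_sub hR
    rw [← mul_sub, ← this, ← intervalIntegral.integral_const_mul]
    refine intervalIntegral.integral_congr fun x _ => ?_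
    ring
  have hlim := intervalIntegral_tendsto_integral_Ioi ε hi tendsto_id
  have hlim2 : Tendsto (fun R => conj (φ R) * deriv u R) atTop (𝓝 (2 * ((∫ x in Ioi ε,
      (1 / 2 * (conj (deriv φ x) * deriv u x) - ((E + 1 / x : ℝ) : ℂ) * (conj (φ x) * u x)))
      + 1 / 2 * (conj (φ ε) * deriv u ε)))) := by
    refine ((hlim.add_const (1 / 2 * (conj (φ ε) * deriv u ε))).const_mul 2).congr' ?_
    filter_upwards [eventually_ge_atTop ε] with R hR
    rw [id, hfin R hR]
    ring
  have h0 := IntegrableAtFilter.eq_zero_of_tendsto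
    (⟨univ, univ_mem, (integrable_conj_mul hφ.memLp hu.memLp_deriv).integrableOn⟩ :
      IntegrableAtFilter (fun R => conj (φ R) * deriv u R) atTop volume)
    (fun s hs => by
      obtain ⟨a, ha⟩ := mem_atTop_sets.1 hs
      refine top_le_iff.1 ?_
      rw [← Real.volume_Ici (a := a)]
      exact measure_mono ha) hlim2
  linear_combination h0 / 2

/-- Integration by parts: for a solution of the differential equation only the boundary term at
the origin survives. -/
lemma halfForm_eq (h : IsCoulombSolution E u) (hu : MemH1 u) {s : ℂ} (hs : HasSlope u s) (r : ℝ)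
    {φ : ℝ → ℂ} (hφ : MemH1 φ) :
    halfForm r E φ u = conj (φ 0) * ((Real.log r : ℂ) * u 0 - s / 2) := by
  refine tendsto_nhds_unique (tendsto_halfForm r E hφ hu) ?_
  have h1 := (hφ.tendsto_nhdsGT_zero.star.mul hs).const_mul (-(1 / 2) : ℂ)
  have h2 := hφ.tendsto_log_mul_sub.star.mul_const (u 0)
  have h3 := (h1.add h2).add_const ((Real.log r : ℂ) * (conj (φ 0) * u 0))
  have hval : -(1 / 2) * (star (φ 0) * s) + star (0 : ℂ) * u 0
      + (Real.log r : ℂ) * (conj (φ 0) * u 0)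
      = conj (φ 0) * ((Real.log r : ℂ) * u 0 - s / 2) := by
    simp only [RCLike.star_def, map_zero]
    ring
  rw [hval] at h3
  refine h3.congr' ?_
  filter_upwards [self_mem_nhdsWithin] with ε (hε : 0 < ε)
  rw [h.integral_Ioi hu hφ hε]
  simp only [star_mul', star_sub, RCLike.star_def, Complex.conj_ofReal]
  ring

/-- The renormalised slope exists, since `u'' + 2 u(0) / x` is integrable at the origin. -/
lemma exists_hasSlope (h : IsCoulombSolution E u) (hu : MemH1 u) : ∃ s, HasSlope u s := by
  -- `u' + 2 ln(2x) u(0)` has the derivative `w'`, which is integrable near `0` because `u` is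
  -- Hölder continuous of exponent `1/2`.
  obtain ⟨C, hC0, hC⟩ := hu.exists_norm_sub_le
  let w : ℝ → ℂ := fun x => deriv u x + 2 * (Real.log (2 * x) : ℂ) * u 0
  let w' : ℝ → ℂ := fun x => -2 * (E : ℂ) * u x - 2 * (((1 / x : ℝ) : ℂ) * (u x - u 0))
  have hd : ∀ x, 0 < x → HasDerivAt w (w' x) x := by
    intro x hx
    have h1 := ((hasDerivAt_id x).const_mul 2).log (by simp only [id]; linarith)
    have e : 2 * 1 / (2 * id x) = 1 / x := by
      rw [id, mul_div_mul_left _ _ (by norm_num)]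
    rw [e] at h1
    refine ((h x hx).2.add ((h1.ofReal_comp.const_mul 2).mul_const (u 0))).congr_deriv ?_
    simp only [w']
    push_cast
    ring
  have hcw : ContinuousOn w' (Ioi 0) := by
    refine (continuousOn_const.mul h.continuousOn).sub (continuousOn_const.mul
      (ContinuousOn.mul (Complex.continuous_ofReal.comp_continuousOn ?_)
        (h.continuousOn.sub continuousOn_const)))
    exact continuousOn_const.div continuousOn_id fun x hx => ne_of_gt hx
  have hi : IntervalIntegrable w' volume 0 1 := by
    have hdom : IntervalIntegrable (fun x : ℝ => 2 * C * x ^ (-(1 / 2) : ℝ)) volume 0 1 :=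
      (intervalIntegral.intervalIntegrable_rpow' (by norm_num)).const_mul _
    have hu1 : IntervalIntegrable (fun x => -2 * (E : ℂ) * u x) volume 0 1 :=
      (continuous_const.mul hu.continuous).intervalIntegrable _ _
    refine hu1.sub (hdom.mono_fun ?_ ?_)
    · refine ContinuousOn.aestronglyMeasurable ?_ measurableSet_uIoc
      rw [uIoc_of_le zero_le_one]
      refine continuousOn_const.mul
        (ContinuousOn.mul (Complex.continuous_ofReal.comp_continuousOn ?_)
          (hu.continuous.continuousOn.sub continuousOn_const))
      exact continuousOn_const.div continuousOn_id fun x hx => ne_of_gt hx.1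
    · filter_upwards [ae_restrict_mem measurableSet_uIoc] with x hx
      rw [uIoc_of_le zero_le_one] at hx
      have hx0 := hx.1
      have hr := Real.rpow_nonneg hx0.le (-(1 / 2))
      rw [norm_mul, norm_mul, Complex.norm_real, Real.norm_of_nonneg (by positivity),
        Real.norm_of_nonneg (by positivity), RCLike.norm_ofNat]
      have : x ^ (-(1 / 2) : ℝ) = 1 / x * √x := by
        rw [Real.sqrt_eq_rpow, one_div x, ← Real.rpow_neg_one x, ← Real.rpow_add hx0]
        norm_num
      rw [this]
      calc 2 * (1 / x * ‖u x - u 0‖) ≤ 2 * (1 / x * (C * √x)) := by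
            gcongr
            exact hC x hx0.le
        _ = _ := by ring
  have hc := intervalIntegral.continuousOn_primitive_interval' (a := 0) hi (by simp)
  have h0 := (hc 0 (by simp)).mono_left (nhdsWithin_mono 0 (s := Ioc 0 1) (by
    rw [uIcc_of_le zero_le_one]; exact Ioc_subset_Icc_self))
  rw [nhdsWithin_Ioc_eq_nhdsGT (zero_lt_one (α := ℝ))] at h0
  simp only [intervalIntegral.integral_same] at h0
  refine ⟨w 1 - ((∫ x in (0 : ℝ)..1, w' x) - 0), ?_⟩
  refine ((h0.const_sub (∫ x in (0 : ℝ)..1, w' x)).const_sub (w 1)).congr' ?_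
  filter_upwards [Ioo_mem_nhdsGT (zero_lt_one (α := ℝ))] with x hx
  have hsub : Icc x 1 ⊆ Ioi 0 := fun y hy => hx.1.trans_le hy.1
  have h1 := (IsPrimitiveOn.of_hasDerivAt (fun y hy => hd y (hsub hy)) (hcw.mono hsub)
    hx.2.le).integral_eq_sub hx.2.le
  have h2 := intervalIntegral.integral_add_adjacent_intervals (a := 0) (b := x) (c := 1)
    (μ := volume) (f := w') (hi.mono_set (by
      rw [uIcc_of_le hx.1.le, uIcc_of_le zero_le_one]; exact Icc_subset_Icc_right hx.2.le))
    (hi.mono_set (by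
      rw [uIcc_of_le hx.2.le, uIcc_of_le zero_le_one]; exact Icc_subset_Icc_left hx.1.le))
  change _ = w x
  linear_combination h2 - h1

end IsCoulombSolution

/-! ### Regularity of weak solutions -/

/-- The primitive of a square integrable function of mean zero on `(a, b)`, extended by `0`, is an
`H¹` function supported in `[a, b]`. -/
lemma memH1_integral_indicator {g : ℝ → ℂ} {a b : ℝ} (hab : a ≤ b)
    (hg : MemLp ((Ioc a b).indicator g) 2 volume) (h0 : ∫ x in a..b, g x = 0) :
    MemH1 (fun x => ∫ t in a..x, (Ioc a b).indicator g t) ∧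
      (∀ x ≤ a, ∫ t in a..x, (Ioc a b).indicator g t = 0) ∧
      (∀ x, b ≤ x → ∫ t in a..x, (Ioc a b).indicator g t = 0) := by
  have hi := MemH1.intervalIntegrable_of_memLp hg
  have hl : ∀ x ≤ a, ∫ t in a..x, (Ioc a b).indicator g t = 0 := by
    intro x hx
    rw [intervalIntegral.integral_symm, intervalIntegral.integral_of_le hx, neg_eq_zero]
    refine setIntegral_eq_zero_of_forall_eq_zero fun t ht => indicator_of_notMem ?_ _
    exact fun h => absurd h.1 (not_lt.2 ht.2)
  have hr : ∀ x, b ≤ x → ∫ t in a..x, (Ioc a b).indicator g t = 0 := by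
    intro x hx
    rw [← intervalIntegral.integral_add_adjacent_intervals (hi a b) (hi b x),
      intervalIntegral.integral_of_le hx, setIntegral_eq_zero_of_forall_eq_zero (t := Ioc b x)
        fun t ht => indicator_of_notMem (fun h => absurd h.2 (not_le.2 ht.1)) _, add_zero,
      intervalIntegral.integral_of_le hab, setIntegral_indicator measurableSet_Ioc, inter_self,
      ← intervalIntegral.integral_of_le hab, h0]
  refine ⟨⟨?_, _, hg, fun x => ?_⟩, hl, hr⟩
  · refine
      (intervalIntegral.continuous_primitive (fun a b => hi a b) a).memLp_of_hasCompactSupport ?_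
    refine HasCompactSupport.intro (isCompact_Icc (a := a) (b := b)) fun x hx => ?_
    rcases not_and_or.1 hx with h | h
    · exact hl x (not_le.1 h).le
    · exact hr x (not_le.1 h).le
  · rw [intervalIntegral.integral_add_adjacent_intervals (hi a 0) (hi 0 x)]

/-- The lemma of du Bois-Reymond: the test function is built from the deviation of
`½ u' + ∫ (E + 1 / x) u` from its mean, which therefore vanishes. -/
lemma exists_deriv_ae_eq {r E : ℝ} {u : ℝ → ℂ} (hu : MemH1 u)
    (h : ∀ φ : ℝ → ℂ, MemH1 φ → (∀ x ≤ 0, φ x = 0) → halfForm r E φ u = 0) {a b : ℝ} (ha : 0 < a)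
    (hab : a < b) : ∃ m : ℂ, ∀ᵐ x, x ∈ Ioc a b →
      deriv u x = 2 * (m - ∫ t in a..x, ((E + 1 / t : ℝ) : ℂ) * u t) := by
  let Q : ℝ → ℂ := fun x => ∫ t in a..x, ((E + 1 / t : ℝ) : ℂ) * u t
  have hsub : Icc a b ⊆ Ioi 0 := fun x hx => ha.trans_le hx.1
  have hcq := (continuousOn_potential E hu.continuous.continuousOn).mono hsub
  have hQ : IsPrimitiveOn Q (fun t => ((E + 1 / t : ℝ) : ℂ) * u t) a b := by
    refine ⟨(hcq.mono (by rw [uIcc_of_le hab.le])).intervalIntegrable, fun x hx => ?_⟩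
    simp [Q]
  have hQc := hQ.continuousOn hab.le
  let p : ℝ → ℂ := fun x => 1 / 2 * deriv u x + Q x
  have hpL : MemLp ((Ioc a b).indicator p) 2 volume := by
    rw [memLp_indicator_iff_restrict measurableSet_Ioc]
    refine (hu.memLp_deriv.restrict _ |>.const_mul _).add ?_
    obtain ⟨C, hC⟩ := isCompact_Icc.exists_bound_of_continuousOn hQc
    refine MemLp.of_bound ((hQc.mono Ioc_subset_Icc_self).aestronglyMeasurable measurableSet_Ioc)
      C ?_
    filter_upwards [ae_restrict_mem measurableSet_Ioc] with x hx
    exact hC x (Ioc_subset_Icc_self hx)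
  let m : ℂ := (∫ x in a..b, p x) / (b - a : ℝ)
  let g : ℝ → ℂ := fun x => p x - m
  have hba : ((b - a : ℝ) : ℂ) ≠ 0 := by
    rw [Complex.ofReal_ne_zero]
    linarith
  have hgL : MemLp ((Ioc a b).indicator g) 2 volume := by
    rw [memLp_indicator_iff_restrict measurableSet_Ioc] at hpL ⊢
    exact hpL.sub (memLp_const m)
  have hpi : IntervalIntegrable p volume a b :=
    ((MemH1.intervalIntegrable_of_memLp hu.memLp_deriv a b).const_mul _).add
      (hQc.mono (by rw [uIcc_of_le hab.le])).intervalIntegrable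
  have hg0 : ∫ x in a..b, g x = 0 := by
    rw [intervalIntegral.integral_sub hpi intervalIntegrable_const, intervalIntegral.integral_const,
      Complex.real_smul, mul_div_cancel₀ _ hba, sub_self]
  obtain ⟨hφ, hφl, hφr⟩ := memH1_integral_indicator hab.le hgL hg0
  set φ : ℝ → ℂ := fun x => ∫ t in a..x, (Ioc a b).indicator g t with hφdef
  have hdφ : deriv φ =ᵐ[volume] (Ioc a b).indicator g := by
    filter_upwards [LocallyIntegrable.ae_hasDerivAt_integral
      (hgL.locallyIntegrable (by norm_num))] with x hx using (hx a).deriv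
  have hw := h φ hφ fun x hx => hφl x (hx.trans ha.le)
  have hF : ∫ x in a..b, (1 / 2 * (conj (g x) * deriv u x)
      - ((E + 1 / x : ℝ) : ℂ) * (conj (φ x) * u x)) = 0 := by
    have hlim := tendsto_halfForm r E hφ hu
    rw [hw] at hlim
    refine tendsto_nhds_unique (tendsto_const_nhds.congr' ?_) hlim
    filter_upwards [Ioo_mem_nhdsGT ha] with ε hε
    rw [show φ 0 = 0 from hφl 0 ha.le, map_zero, zero_mul, mul_zero, add_zero,
      intervalIntegral.integral_of_le hab.le,
      setIntegral_eq_of_subset_of_ae_sdiff_eq_zero (s := Ioc a b) (t := Ioi ε)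
        measurableSet_Ioi.nullMeasurableSet (fun x hx => hε.2.trans hx.1)]
    · refine setIntegral_congr_ae measurableSet_Ioc ?_
      filter_upwards [hdφ] with x hx hx2
      rw [hx, indicator_of_mem hx2]
    · filter_upwards [hdφ] with x hx hx2
      rw [hx, indicator_of_notMem hx2.2]
      have : φ x = 0 := by
        rcases not_and_or.1 hx2.2 with h | h
        · exact hφl x (not_lt.1 h)
        · exact hφr x (not_le.1 h).le
      rw [this]
      simp
  have hdφ' : ∀ᵐ x, x ∈ Ioc a b → deriv φ x = g x := by
    filter_upwards [hdφ] with x hx hx2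
    rw [hx, indicator_of_mem hx2]
  have hpp := (((hφ.isPrimitiveOn a b).star).mul hQ hab.le).integral_eq_sub hab.le
  rw [show φ a = 0 from hφl a le_rfl, show φ b = 0 from hφr b le_rfl, map_zero, zero_mul, zero_mul,
    sub_zero] at hpp
  have hgi : IntervalIntegrable (fun x => conj (g x)) volume a b := by
    have := hpi.sub (intervalIntegrable_const (c := m))
    rw [intervalIntegrable_iff] at this ⊢
    exact (Complex.conjCLE : ℂ →L[ℝ] ℂ).integrable_comp this
  have hgm : ∫ x in a..b, conj (g x) * m = 0 := by
    rw [intervalIntegral.integral_mul_const, intervalIntegral.integral_of_le hab.le, integral_conj,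
      ← intervalIntegral.integral_of_le hab.le, hg0, map_zero, zero_mul]
  have hgu : IntervalIntegrable (fun x => 1 / 2 * (conj (g x) * deriv u x)) volume a b := by
    rw [intervalIntegrable_iff_integrableOn_Ioc_of_le hab.le]
    rw [memLp_indicator_iff_restrict measurableSet_Ioc] at hgL
    exact (hgL.star.integrable_mul (hu.memLp_deriv.restrict _)).const_mul _
  have hqu : IntervalIntegrable (fun x => ((E + 1 / x : ℝ) : ℂ) * (conj (φ x) * u x))
      volume a b := by
    have : ContinuousOn (fun x => conj (φ x)) (uIcc a b) :=
      (Complex.continuous_conj.comp hφ.continuous).continuousOn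
    refine (hQ.1.continuousOn_mul this).congr fun x _ => ?_
    ring
  have hsq : ∫ x in a..b, conj (g x) * g x = 0 := by
    have e : ∀ x, conj (g x) * g x = (1 / 2 * (conj (g x) * deriv u x)
        - ((E + 1 / x : ℝ) : ℂ) * (conj (φ x) * u x))
        + (conj (g x) * Q x + conj (φ x) * (((E + 1 / x : ℝ) : ℂ) * u x)) - conj (g x) * m := by
      intro x
      simp only [g, p]
      ring
    have i2 : IntervalIntegrable (fun x => conj (g x) * Q x
        + conj (φ x) * (((E + 1 / x : ℝ) : ℂ) * u x)) volume a b := by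
      refine (hgi.mul_continuousOn (by rwa [uIcc_of_le hab.le])).add (hqu.congr fun x _ => ?_)
      ring
    rw [intervalIntegral.integral_congr fun x _ => e x,
      intervalIntegral.integral_sub ((hgu.sub hqu).add i2) (hgi.mul_const m),
      intervalIntegral.integral_add (hgu.sub hqu) i2, hF, hgm, sub_zero, zero_add,
      ← hpp]
    refine intervalIntegral.integral_congr_ae ?_
    filter_upwards [hdφ'] with x hx hx2
    rw [uIoc_of_le hab.le] at hx2
    rw [hx hx2]
  have hz : ∫ x in Ioc a b, ‖g x‖ ^ 2 = 0 := by
    rw [intervalIntegral.integral_of_le hab.le] at hsq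
    have e : ∀ x, conj (g x) * g x = ((‖g x‖ ^ 2 : ℝ) : ℂ) := fun x => by
      rw [Complex.conj_mul']
      push_cast
      rfl
    simp only [e] at hsq
    rw [integral_complex_ofReal] at hsq
    exact_mod_cast hsq
  rw [memLp_indicator_iff_restrict measurableSet_Ioc] at hgL
  rw [setIntegral_eq_zero_iff_of_nonneg_ae (Eventually.of_forall fun _ => by positivity)
    ((memLp_two_iff_integrable_sq_norm hgL.1).1 hgL),
    EventuallyEq, ae_restrict_iff' measurableSet_Ioc] at hz
  refine ⟨m, ?_⟩
  filter_upwards [hz] with x hx hx2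
  have h1 : g x = 0 := by simpa using hx hx2
  simp only [g, p, Q] at h1
  linear_combination 2 * h1

/-- A weak solution on `(0, ∞)` is a classical solution. -/
lemma isCoulombSolution_of_halfForm_eq_zero {r E : ℝ} {u : ℝ → ℂ} (hu : MemH1 u)
    (h : ∀ φ : ℝ → ℂ, MemH1 φ → (∀ x ≤ 0, φ x = 0) → halfForm r E φ u = 0) :
    IsCoulombSolution E u := by
  intro x hx
  have ha : 0 < x / 2 := by linarith
  have hab : x / 2 < 2 * x := by linarith
  obtain ⟨m, hm⟩ := exists_deriv_ae_eq hu h ha hab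
  set a := x / 2
  set b := 2 * x
  let D : ℝ → ℂ := fun y => 2 * (m - ∫ t in a..y, ((E + 1 / t : ℝ) : ℂ) * u t)
  have hsub : Icc a b ⊆ Ioi 0 := fun x hx => ha.trans_le hx.1
  have hcq0 := continuousOn_potential E hu.continuous.continuousOn
  have hcq := hcq0.mono hsub
  have hqi : IntervalIntegrable (fun t => ((E + 1 / t : ℝ) : ℂ) * u t) volume a b :=
    (hcq.mono (by rw [uIcc_of_le hab.le])).intervalIntegrable
  have hD : ∀ y ∈ Ioo a b, HasDerivAt D (-2 * ((E + 1 / y : ℝ) : ℂ) * u y) y := by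
    intro y hy
    have hy0 : 0 < y := ha.trans hy.1
    have h1 := intervalIntegral.integral_hasDerivAt_right (a := a) (b := y)
      (hqi.mono_set (by
        rw [uIcc_of_le hy.1.le, uIcc_of_le hab.le]; exact Icc_subset_Icc_right hy.2.le))
      (hcq0.stronglyMeasurableAtFilter isOpen_Ioi y hy0)
      (hcq0.continuousAt (Ioi_mem_nhds hy0))
    refine ((h1.const_sub m).const_mul 2).congr_deriv ?_
    ring
  have hDc : ContinuousOn D (Icc a b) := by
    have := intervalIntegral.continuousOn_primitive_interval' (a := a) hqi (by simp)
    rw [uIcc_of_le hab.le] at this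
    exact continuousOn_const.mul (continuousOn_const.sub this)
  have hDi : IntervalIntegrable D volume a b :=
    (hDc.mono (by rw [uIcc_of_le hab.le])).intervalIntegrable
  have huD : ∀ y ∈ Ioo a b, u y = u a + ∫ t in a..y, D t := by
    intro y hy
    rw [← sub_eq_iff_eq_add', hu.sub_eq_integral]
    refine intervalIntegral.integral_congr_ae ?_
    filter_upwards [hm] with t ht ht2
    rw [uIoc_of_le hy.1.le] at ht2
    exact ht ⟨ht2.1, ht2.2.trans hy.2.le⟩
  have hdu : ∀ y ∈ Ioo a b, HasDerivAt u (D y) y := by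
    intro y hy
    have h1 := intervalIntegral.integral_hasDerivAt_right (a := a) (b := y)
      (hDi.mono_set (by
        rw [uIcc_of_le hy.1.le, uIcc_of_le hab.le]; exact Icc_subset_Icc_right hy.2.le))
      ((hDc.mono Ioo_subset_Icc_self).stronglyMeasurableAtFilter isOpen_Ioo y hy)
      (hD y hy).continuousAt
    refine (h1.const_add (u a)).congr_of_eventuallyEq ?_
    filter_upwards [isOpen_Ioo.mem_nhds hy] with z hz using huD z hz
  have hxab : x ∈ Ioo a b := ⟨by simp only [a]; linarith, by simp only [b]; linarith⟩
  refine ⟨(hdu x hxab).differentiableAt.hasDerivAt, (hD x hxab).congr_of_eventuallyEq ?_⟩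
  filter_upwards [isOpen_Ioo.mem_nhds hxab] with z hz using (hdu z hz).deriv

/-! ### Eigenfunctions as solutions of a boundary value problem -/

/-- `u` is a weak solution of `H_C u = E u`. -/
def IsWeakEigenfunction (r E : ℝ) (u : ℝ → ℂ) : Prop :=
  ∀ φ : ℝ → ℂ, MemH1 φ → formTC r φ u = E * ∫ x, conj (φ x) * u x

lemma halfForm_eq_zero_of_forall {r E : ℝ} {φ u : ℝ → ℂ} (h : ∀ x, 0 ≤ x → φ x = 0) :
    halfForm r E φ u = 0 := by
  have hd : ∀ x, 0 < x → deriv φ x = 0 := by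
    intro x hx
    have : φ =ᶠ[𝓝 x] fun _ => 0 := by
      filter_upwards [Ioi_mem_nhds hx] with y hy using h y hy.le
    rw [this.deriv_eq, deriv_const]
  have hp : ∀ x, 0 < x → deriv (fun y => conj (φ y) * u y) x = 0 := by
    intro x hx
    have : (fun y => conj (φ y) * u y) =ᶠ[𝓝 x] fun _ => 0 := by
      filter_upwards [Ioi_mem_nhds hx] with y hy
      rw [h y hy.le, map_zero, zero_mul]
    rw [this.deriv_eq, deriv_const]
  have e1 : ∫ x in Ioi (0 : ℝ), conj (deriv φ x) * deriv u x = 0 :=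
    setIntegral_eq_zero_of_forall_eq_zero fun x hx => by rw [hd x hx, map_zero, zero_mul]
  have e2 : ∫ x in Ioi (1 / 2 : ℝ), ((1 / x : ℝ) : ℂ) * (conj (φ x) * u x) = 0 :=
    setIntegral_eq_zero_of_forall_eq_zero fun x (hx : 1 / 2 < x) => by
      rw [h x (by linarith), map_zero, zero_mul, mul_zero]
  have e3 : ∫ x in Ioi (0 : ℝ), conj (φ x) * u x = 0 :=
    setIntegral_eq_zero_of_forall_eq_zero fun x (hx : 0 < x) => by
      rw [h x hx.le, map_zero, zero_mul]
  have e4 : ∫ x in (0 : ℝ)..(1 / 2),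
      (Real.log (2 * x) : ℂ) * deriv (fun y => conj (φ y) * u y) x = 0 := by
    rw [intervalIntegral.integral_of_le (by norm_num)]
    exact setIntegral_eq_zero_of_forall_eq_zero fun x hx => by rw [hp x hx.1, mul_zero]
  rw [halfForm, e1, e2, e3, e4, h 0 le_rfl]
  simp

lemma IsWeakEigenfunction.comp_neg {r E : ℝ} {u : ℝ → ℂ} (hu : MemH1 u)
    (h : IsWeakEigenfunction r E u) : IsWeakEigenfunction r E (fun x => u (-x)) := by
  intro φ hφ
  have h1 := formTC_sub_eq_halfForm_add r E hφ hu.comp_neg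
  have h2 := formTC_sub_eq_halfForm_add r E hφ.comp_neg hu
  simp only [neg_neg] at h1 h2
  rw [h _ hφ.comp_neg, sub_self] at h2
  rw [add_comm, ← h2] at h1
  exact sub_eq_zero.1 h1

lemma IsWeakEigenfunction.isCoulombSolution {r E : ℝ} {u : ℝ → ℂ} (hu : MemH1 u)
    (h : IsWeakEigenfunction r E u) : IsCoulombSolution E u := by
  refine isCoulombSolution_of_halfForm_eq_zero (r := r) hu fun φ hφ hφ0 => ?_
  have h1 := formTC_sub_eq_halfForm_add r E hφ hu
  rw [h φ hφ, sub_self, halfForm_eq_zero_of_forall (φ := fun x => φ (-x))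
    fun x hx => hφ0 (-x) (by linarith), add_zero] at h1
  exact h1.symm

lemma exists_memH1_apply_zero_eq_one : ∃ φ : ℝ → ℂ, MemH1 φ ∧ φ 0 = 1 := by
  let f : ContDiffBump (0 : ℝ) := ⟨1, 2, zero_lt_one, one_lt_two⟩
  have h1 : ContDiff ℝ 1 (fun x => (f x : ℂ)) := Complex.ofRealCLM.contDiff.comp f.contDiff
  have hc : HasCompactSupport (fun x => (f x : ℂ)) :=
    f.hasCompactSupport.comp_left (g := Complex.ofReal) (by simp)
  refine ⟨fun x => (f x : ℂ), MemH1.of_contDiff h1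
    (h1.continuous.memLp_of_hasCompactSupport hc)
    ((h1.continuous_deriv le_rfl).memLp_of_hasCompactSupport hc.deriv), ?_⟩
  simp only
  rw [f.one_of_mem_closedBall (by simp [f])]
  simp

/-- An `H¹` function is an eigenfunction of `H_C` if and only if it solves the differential equation
on both half-lines and its renormalised slopes satisfy the boundary condition of the point
interaction of strength `ln r`. -/
lemma isWeakEigenfunction_iff {r E : ℝ} {u : ℝ → ℂ} (hu : MemH1 u) {s t : ℂ} (hs : HasSlope u s)
    (ht : HasSlope (fun x => u (-x)) t) : IsWeakEigenfunction r E u ↔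
      IsCoulombSolution E u ∧ IsCoulombSolution E (fun x => u (-x)) ∧
        s + t = 4 * (Real.log r : ℂ) * u 0 := by
  constructor
  · intro h
    have h1 := h.isCoulombSolution hu
    have h2 := (h.comp_neg hu).isCoulombSolution hu.comp_neg
    refine ⟨h1, h2, ?_⟩
    obtain ⟨φ, hφ, hφ0⟩ := exists_memH1_apply_zero_eq_one
    have h3 := formTC_sub_eq_halfForm_add r E hφ hu
    rw [h φ hφ, sub_self, h1.halfForm_eq hu hs r hφ, h2.halfForm_eq hu.comp_neg ht r hφ.comp_neg,
      neg_zero, hφ0, map_one] at h3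
    linear_combination 2 * h3
  · rintro ⟨h1, h2, h3⟩ φ hφ
    have h4 := formTC_sub_eq_halfForm_add r E hφ hu
    rw [h1.halfForm_eq hu hs r hφ, h2.halfForm_eq hu.comp_neg ht r hφ.comp_neg, neg_zero] at h4
    linear_combination h4 - conj (φ 0) / 2 * h3

/-! ### Uniqueness for the differential equation -/

namespace IsCoulombSolution

variable {E : ℝ} {u v : ℝ → ℂ}

lemma of_hasDerivAt {u' : ℝ → ℂ} (h1 : ∀ x, 0 < x → HasDerivAt u (u' x) x)
    (h2 : ∀ x, 0 < x → HasDerivAt u' (-2 * ((E + 1 / x : ℝ) : ℂ) * u x) x) :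
    IsCoulombSolution E u := by
  refine fun x hx => ⟨(h1 x hx).differentiableAt.hasDerivAt, (h2 x hx).congr_of_eventuallyEq ?_⟩
  filter_upwards [Ioi_mem_nhds hx] with y hy using (h1 y hy).deriv

lemma sub_const_mul (hu : IsCoulombSolution E u) (hv : IsCoulombSolution E v) (c : ℂ) :
    IsCoulombSolution E (fun x => u x - c * v x) := by
  refine of_hasDerivAt (u' := fun x => deriv u x - c * deriv v x)
    (fun x hx => (hu x hx).1.sub ((hv x hx).1.const_mul c)) fun x hx => ?_
  refine ((hu x hx).2.sub ((hv x hx).2.const_mul c)).congr_deriv ?_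
  ring

/-- Solutions are determined by their Cauchy data at a point of `(0, ∞)`. -/
lemma eq_zero_of_cauchy (h : IsCoulombSolution E u) {y : ℝ} (hy : 0 < y) (h0 : u y = 0)
    (h1 : deriv u y = 0) : ∀ x, 0 < x → u x = 0 := by
  intro x hx
  set a := min x y / 2
  set b := max x y + 1
  have ha : 0 < a := half_pos (lt_min hx hy)
  have hay : a < y := (half_lt_self (lt_min hx hy)).trans_le (min_le_right _ _)
  have hax : a < x := (half_lt_self (lt_min hx hy)).trans_le (min_le_left _ _)
  have hyb : y < b := (le_max_right x y).trans_lt (lt_add_one _)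
  have hxb : x < b := (le_max_left x y).trans_lt (lt_add_one _)
  -- The equation as a first order system, which is Lipschitz away from the origin.
  let F : ℝ → ℂ × ℂ → ℂ × ℂ := fun t p => (p.2, -2 * ((E + 1 / t : ℝ) : ℂ) * p.1)
  let K : NNReal := 1 + 2 * (‖E‖₊ + ‖1 / a‖₊)
  have hF : ∀ t ∈ Ioo a b, LipschitzOnWith K (F t) univ := by
    intro t ht
    rw [lipschitzOnWith_univ]
    refine LipschitzWith.of_dist_le_mul fun p q => ?_
    have ht0 : 0 < t := ha.trans ht.1
    have hK : (K : ℝ) = 1 + 2 * (|E| + 1 / a) := by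
      simp only [K]
      push_cast
      rw [Real.norm_of_nonneg (by positivity : 0 ≤ 1 / a), Real.norm_eq_abs]
    have hd1 : dist p.1 q.1 ≤ dist p q := le_max_left _ _
    have hd2 : dist p.2 q.2 ≤ dist p q := le_max_right _ _
    rw [hK, Prod.dist_eq]
    have hpos : 0 ≤ |E| + 1 / a := by positivity
    refine max_le ?_ ?_
    · refine hd2.trans ?_
      nlinarith [dist_nonneg (x := p) (y := q)]
    · have hb : |E + 1 / t| ≤ |E| + 1 / a := by
        refine (abs_add_le _ _).trans ?_
        rw [abs_of_pos (by positivity : 0 < 1 / t)]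
        gcongr
        exact ht.1.le
      rw [dist_eq_norm, ← mul_sub, norm_mul, norm_mul, norm_neg, RCLike.norm_ofNat,
        Complex.norm_real, Real.norm_eq_abs, ← dist_eq_norm]
      calc 2 * |E + 1 / t| * dist p.1 q.1 ≤ 2 * (|E| + 1 / a) * dist p q := by gcongr
        _ ≤ _ := by nlinarith [dist_nonneg (x := p) (y := q)]
  have hsub : ∀ t ∈ Icc a b, 0 < t := fun t ht => ha.trans_le ht.1
  have hder : ∀ t, 0 < t → HasDerivAt (fun t => (u t, deriv u t)) (F t (u t, deriv u t)) t :=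
    fun t ht => (h t ht).1.prodMk (h t ht).2
  have := ODE_solution_unique_of_mem_Icc (f := fun t => (u t, deriv u t)) (g := fun _ => (0, 0))
    hF ⟨hay, hyb⟩ (fun t ht => (hder t (hsub t ht)).continuousAt.continuousWithinAt)
    (fun t ht => hder t (ha.trans ht.1)) (fun _ _ => mem_univ _) continuousOn_const
    (fun t _ => (hasDerivAt_const t ((0, 0) : ℂ × ℂ)).congr_deriv (by simp [F, Prod.ext_iff]))
    (fun _ _ => mem_univ _)
    (by simp only [h0, h1])
  exact congrArg Prod.fst (this ⟨hax.le, hxb.le⟩)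

/-- Solutions are determined by their value and their renormalised slope at the origin: near the
origin, the maximum `M` of `|u'|` satisfies `M ≤ (5/8) M`. -/
lemma eq_zero_of_hasSlope (h : IsCoulombSolution E u) (hu : MemH1 u) (h0 : u 0 = 0)
    (hs : HasSlope u 0) : ∀ x, 0 < x → u x = 0 := by
  have hv : Tendsto (deriv u) (𝓝[>] 0) (𝓝 0) := by
    have := hs
    simp only [HasSlope, h0, mul_zero, add_zero] at this
    exact this
  -- The choice of `δ` gives `(|E| + 1 / t) t ≤ 5 / 4` for `0 < t ≤ δ`, and `δ ≤ 1 / 4`.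
  set δ : ℝ := 1 / (4 * (|E| + 1)) with hδdef
  have hδ : 0 < δ := by positivity
  let w : ℝ → ℂ := fun x => if x ≤ 0 then 0 else deriv u x
  have hw : ∀ x, 0 < x → w x = deriv u x := fun x hx => if_neg (not_le.2 hx)
  have hwc : ContinuousOn w (Icc 0 δ) := by
    intro x hx
    rcases hx.1.eq_or_lt with rfl | hx0
    · have : ContinuousWithinAt w (Ioi 0) 0 := by
        have hw0 : w 0 = 0 := if_pos le_rfl
        rw [ContinuousWithinAt, hw0]
        refine hv.congr' ?_
        filter_upwards [self_mem_nhdsWithin] with x hx using (hw x hx).symm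
      rw [← continuousWithinAt_insert_self, Ioi_insert] at this
      exact this.mono Icc_subset_Ici_self
    · refine ((h x hx0).2.continuousAt.congr ?_).continuousWithinAt
      filter_upwards [Ioi_mem_nhds hx0] with y hy using (hw y hy).symm
  obtain ⟨z, hz, hmax⟩ := isCompact_Icc.exists_isMaxOn ⟨0, le_rfl, hδ.le⟩ hwc.norm
  set M := ‖w z‖ with hM
  have hM0 : 0 ≤ M := norm_nonneg _
  have hd : ∀ x ∈ Ioc 0 δ, ‖deriv u x‖ ≤ M := fun x hx => by
    rw [← hw x hx.1]
    exact hmax ⟨hx.1.le, hx.2⟩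
  have hub : ∀ x ∈ Ioc 0 δ, ‖u x‖ ≤ M * x := by
    intro x hx
    have h1 := hu.sub_eq_integral 0 x
    rw [h0, sub_zero] at h1
    rw [h1]
    refine (intervalIntegral.norm_integral_le_of_norm_le_const (C := M) fun t ht => ?_).trans ?_
    · rw [uIoc_of_le hx.1.le] at ht
      exact hd t ⟨ht.1, ht.2.trans hx.2⟩
    · rw [sub_zero, abs_of_pos hx.1]
  have hEδ : |E| * δ ≤ 1 / 4 := by
    rw [hδdef, mul_one_div, div_le_iff₀ (by positivity)]
    linarith
  have hδ4 : δ ≤ 1 / 4 := by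
    rw [hδdef]
    refine one_div_le_one_div_of_le (by norm_num) ?_
    linarith [abs_nonneg E]
  have hvb : ∀ x ∈ Ioc 0 δ, ‖deriv u x‖ ≤ 5 / 8 * M := by
    intro x hx
    have hlim : Tendsto (fun ε => ‖deriv u x - deriv u ε‖) (𝓝[>] 0) (𝓝 ‖deriv u x - 0‖) :=
      (hv.const_sub _).norm
    rw [sub_zero] at hlim
    refine le_of_tendsto hlim ?_
    filter_upwards [Ioo_mem_nhdsGT hx.1] with ε hε
    have hb := norm_image_sub_le_of_norm_deriv_le_segment' (f := deriv u) (a := ε) (b := x)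
      (f' := fun t => -2 * ((E + 1 / t : ℝ) : ℂ) * u t) (C := 5 / 2 * M)
      (fun t ht => (h t (hε.1.trans_le ht.1)).2.hasDerivWithinAt) (fun t ht => by
        have ht0 : 0 < t := hε.1.trans_le ht.1
        have htδ : t ≤ δ := ht.2.le.trans hx.2
        rw [norm_mul, norm_mul, norm_neg, RCLike.norm_ofNat, Complex.norm_real, Real.norm_eq_abs]
        have e1 : |E + 1 / t| ≤ |E| + 1 / t := by
          refine (abs_add_le _ _).trans ?_
          rw [abs_of_pos (by positivity : 0 < 1 / t)]
        have e2 : (|E| + 1 / t) * t ≤ 5 / 4 := by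
          rw [add_mul, one_div_mul_cancel ht0.ne']
          nlinarith [abs_nonneg E]
        calc 2 * |E + 1 / t| * ‖u t‖ ≤ 2 * (|E| + 1 / t) * (M * t) := by
              gcongr
              exact hub t ⟨ht0, htδ⟩
          _ = 2 * M * ((|E| + 1 / t) * t) := by ring
          _ ≤ 2 * M * (5 / 4) := by gcongr
          _ = _ := by ring) x ⟨hε.2.le, le_rfl⟩
    refine hb.trans ?_
    have : x - ε ≤ 1 / 4 := by linarith [hx.2, hε.1]
    nlinarith
  have hMz : M = 0 := by
    rcases hz.1.eq_or_lt with hz0 | hz0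
    · rw [hM, ← hz0]
      simp [w]
    · have := hvb z ⟨hz0, hz.2⟩
      rw [← hw z hz0, ← hM] at this
      linarith
  refine h.eq_zero_of_cauchy hδ ?_ ?_
  · have := hub δ ⟨hδ, le_rfl⟩
    rw [hMz, zero_mul] at this
    exact norm_le_zero_iff.1 this
  · have := hd δ ⟨hδ, le_rfl⟩
    rw [hMz] at this
    exact norm_le_zero_iff.1 this

/-- The Wronskian of two `H¹` solutions is constant and integrable on `(0, ∞)`. -/
lemma wronskian_eq_zero (hu : IsCoulombSolution E u) (hv : IsCoulombSolution E v) (hu1 : MemH1 u)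
    (hv1 : MemH1 v) : ∀ x, 0 < x → u x * deriv v x - deriv u x * v x = 0 := by
  have hW : ∀ x, 0 < x → HasDerivAt (fun x => u x * deriv v x - deriv u x * v x) 0 x := by
    intro x hx
    refine (((hu x hx).1.mul (hv x hx).2).sub ((hu x hx).2.mul (hv x hx).1)).congr_deriv ?_
    ring
  have hconst : ∀ x y, 0 < x → x ≤ y → u y * deriv v y - deriv u y * v y
      = u x * deriv v x - deriv u x * v x := by
    intro x y hx hxy
    have := (IsPrimitiveOn.of_hasDerivAt (f' := fun _ => 0)
      (fun t ht => hW t (hx.trans_le ht.1)) continuousOn_const hxy).integral_eq_sub hxy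
    rw [intervalIntegral.integral_zero] at this
    exact (sub_eq_zero.1 this.symm)
  intro x hx
  have hi : Integrable (fun x => u x * deriv v x - deriv u x * v x) :=
    (hu1.memLp.integrable_mul hv1.memLp_deriv).sub (hu1.memLp_deriv.integrable_mul hv1.memLp)
  refine IntegrableAtFilter.eq_zero_of_tendsto
    (⟨univ, univ_mem, hi.integrableOn⟩ : IntegrableAtFilter
      (fun x => u x * deriv v x - deriv u x * v x) atTop volume)
    (fun s hs => by
      obtain ⟨a, ha⟩ := mem_atTop_sets.1 hs
      refine top_le_iff.1 ?_
      rw [← Real.volume_Ici (a := a)]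
      exact measure_mono ha) (tendsto_const_nhds.congr' ?_)
  filter_upwards [eventually_ge_atTop x] with y hy using (hconst x y hx hy).symm

lemma exists_eq_const_mul (hu : IsCoulombSolution E u) (hv : IsCoulombSolution E v)
    (hu1 : MemH1 u) (hv1 : MemH1 v) {y : ℝ} (hy : 0 < y) (h0 : u y ≠ 0) :
    ∃ c : ℂ, ∀ x, 0 ≤ x → v x = c * u x := by
  refine ⟨v y / u y, ?_⟩
  have hpos : ∀ x, 0 < x → v x - v y / u y * u x = 0 := by
    refine (hv.sub_const_mul hu _).eq_zero_of_cauchy hy ?_ ?_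
    · rw [div_mul_cancel₀ _ h0, sub_self]
    · have h1 := ((hv y hy).1.sub ((hu y hy).1.const_mul (v y / u y))).deriv
      refine h1.trans ?_
      have := hu.wronskian_eq_zero hv hu1 hv1 y hy
      field_simp
      linear_combination this
  intro x hx
  rcases hx.eq_or_lt with rfl | hx
  · refine tendsto_nhds_unique hv1.tendsto_nhdsGT_zero
      ((hu1.tendsto_nhdsGT_zero.const_mul _).congr' ?_)
    filter_upwards [self_mem_nhdsWithin] with x hx using (sub_eq_zero.1 (hpos x hx)).symm
  · exact sub_eq_zero.1 (hpos x hx)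

end IsCoulombSolution

/-! ### Parity of eigenfunctions -/

lemma exists_pos_ne_zero {u : ℝ → ℂ} (hu : MemH1 u) {σ : ℂ} (hp : ∀ x, u (-x) = σ * u x)
    (h : u ≠ fun _ => 0) : ∃ y, 0 < y ∧ u y ≠ 0 := by
  by_contra! hc
  refine h (funext fun x => ?_)
  have h0 : u 0 = 0 := by
    refine tendsto_nhds_unique hu.tendsto_nhdsGT_zero (tendsto_const_nhds.congr' ?_)
    filter_upwards [self_mem_nhdsWithin] with x hx using (hc x hx).symm
  rcases lt_trichotomy x 0 with hx | rfl | hx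
  · rw [← neg_neg x, hp, hc (-x) (by linarith), mul_zero]
  · exact h0
  · exact hc x hx

/-- Two eigenfunctions of the same parity with the same eigenvalue are proportional. -/
lemma IsWeakEigenfunction.exists_eq_const_mul {r E : ℝ} {u v : ℝ → ℂ} {σ : ℂ}
    (hu : IsWeakEigenfunction r E u) (hv : IsWeakEigenfunction r E v) (hu1 : MemH1 u)
    (hv1 : MemH1 v) (hup : ∀ x, u (-x) = σ * u x) (hvp : ∀ x, v (-x) = σ * v x)
    (h : u ≠ fun _ => 0) : ∃ c : ℂ, ∀ x, v x = c * u x := by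
  obtain ⟨y, hy, hy0⟩ := exists_pos_ne_zero hu1 hup h
  obtain ⟨c, hc⟩ := (hu.isCoulombSolution hu1).exists_eq_const_mul (hv.isCoulombSolution hv1)
    hu1 hv1 hy hy0
  refine ⟨c, fun x => ?_⟩
  rcases le_total 0 x with hx | hx
  · exact hc x hx
  · rw [← neg_neg x, hup, hvp, hc (-x) (by linarith)]
    ring

/-- No eigenvalue has both an even and an odd eigenfunction: on `(0, ∞)` they would be
proportional, so that both the value and the renormalised slope at `0` would vanish. -/
lemma IsWeakEigenfunction.eq_zero_or_eq_zero {r E : ℝ} {u v : ℝ → ℂ}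
    (hu : IsWeakEigenfunction r E u) (hv : IsWeakEigenfunction r E v) (hu1 : MemH1 u)
    (hv1 : MemH1 v) (hup : ∀ x, u (-x) = u x) (hvp : ∀ x, v (-x) = -v x) :
    u = (fun _ => 0) ∨ v = fun _ => 0 := by
  by_contra! hne
  have hup' : ∀ x, u (-x) = 1 * u x := fun x => by rw [hup, one_mul]
  have hvp' : ∀ x, v (-x) = -1 * v x := fun x => by rw [hvp, neg_one_mul]
  have hus := hu.isCoulombSolution hu1
  obtain ⟨y, hy, hy0⟩ := exists_pos_ne_zero hu1 hup' hne.1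
  obtain ⟨z, hz, hz0⟩ := exists_pos_ne_zero hv1 hvp' hne.2
  obtain ⟨c, hc⟩ := hus.exists_eq_const_mul (hv.isCoulombSolution hv1) hu1 hv1 hy hy0
  have hc0 : c ≠ 0 := by
    rintro rfl
    exact hz0 (by rw [hc z hz.le, zero_mul])
  have hv0 : v 0 = 0 := by
    have := hvp 0
    rw [neg_zero] at this
    exact CharZero.eq_neg_self_iff.1 this
  have hu0 : u 0 = 0 := by
    have := hc 0 le_rfl
    rw [hv0, eq_comm, mul_eq_zero] at this
    exact this.resolve_left hc0
  obtain ⟨s, hs⟩ := hus.exists_hasSlope hu1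
  have ht : HasSlope (fun x => u (-x)) s := by
    rw [funext hup]
    exact hs
  have hb := ((isWeakEigenfunction_iff hu1 hs ht).1 hu).2.2
  rw [hu0, mul_zero, ← two_mul, mul_eq_zero] at hb
  rw [hb.resolve_left two_ne_zero] at hs
  exact hy0 (hus.eq_zero_of_hasSlope hu1 hu0 hs y hy)

/-! ### Eigenspaces and parity in `L²(ℝ)` -/

lemma mem_eigenspaceHC_iff_exists {r E : ℝ} {ψ : L2R} : ψ ∈ eigenspaceHC r E ↔
    ∃ u : ℝ → ℂ, MemH1 u ∧ ψ =ᵐ[volume] u ∧ IsWeakEigenfunction r E u := by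
  have hint : ∀ u : ℝ → ℂ, ψ =ᵐ[volume] u → ∀ φ : ℝ → ℂ,
      ∫ x, conj (φ x) * ((E : ℂ) • ψ) x = E * ∫ x, conj (φ x) * u x := by
    intro u hu φ
    rw [← integral_const_mul]
    refine integral_congr_ae ?_
    filter_upwards [Lp.coeFn_smul (E : ℂ) ψ, hu] with x hx hy
    rw [hx, Pi.smul_apply, hy, smul_eq_mul]
    ring
  have h : ψ ∈ eigenspaceHC r E ↔ (ψ, (E : ℂ) • ψ) ∈ graphHC r := by
    rw [← graph_operatorHC]
    rfl
  rw [h]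
  constructor
  · rintro ⟨u, hu, hψ, hw⟩
    exact ⟨u, hu, hψ, fun φ hφ => (hw φ hφ).trans (hint u hψ φ)⟩
  · rintro ⟨u, hu, hψ, hw⟩
    exact ⟨u, hu, hψ, fun φ hφ => (hw φ hφ).trans (hint u hψ φ).symm⟩

lemma isEigenfunctionHC_iff {r E : ℝ} {ψ : L2R} :
    IsEigenfunctionHC r E ψ ↔ ψ ≠ 0 ∧ ψ ∈ eigenspaceHC r E := by
  rw [mem_eigenspaceHC]
  rfl

lemma reflection_coeFn (ψ : L2R) : reflection ψ =ᵐ[volume] fun x => ψ (-x) :=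
  Lp.coeFn_compMeasurePreserving ψ (Measure.measurePreserving_neg volume)

lemma ae_comp_neg {f g : ℝ → ℂ} (h : f =ᵐ[volume] g) :
    (fun x => f (-x)) =ᵐ[volume] fun x => g (-x) :=
  (Measure.measurePreserving_neg (volume : Measure ℝ)).quasiMeasurePreserving.ae_eq_comp h

lemma reflection_reflection (ψ : L2R) : reflection (reflection ψ) = ψ := by
  refine Lp.ext ?_
  filter_upwards [reflection_coeFn (reflection ψ), ae_comp_neg (reflection_coeFn ψ)] with x hx hy
  rw [hx, hy, neg_neg]

lemma parityPlus_apply (ψ : L2R) : parityPlus ψ = (1 / 2 : ℂ) • (ψ + reflection ψ) := rfl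

lemma parityMinus_apply (ψ : L2R) : parityMinus ψ = (1 / 2 : ℂ) • (ψ - reflection ψ) := rfl

lemma parityPlus_add_parityMinus (ψ : L2R) : parityPlus ψ + parityMinus ψ = ψ := by
  rw [parityPlus_apply, parityMinus_apply]
  module

lemma reflection_parityPlus (ψ : L2R) : reflection (parityPlus ψ) = parityPlus ψ := by
  rw [parityPlus_apply, map_smul, map_add, reflection_reflection, add_comm]

lemma reflection_parityMinus (ψ : L2R) : reflection (parityMinus ψ) = -parityMinus ψ := by
  rw [parityMinus_apply, map_smul, map_sub, reflection_reflection, ← smul_neg, neg_sub]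

lemma isEven_iff {ψ : L2R} : IsEven ψ ↔ reflection ψ = ψ := by
  constructor
  · rintro ⟨φ, rfl⟩
    exact reflection_parityPlus φ
  · intro h
    refine ⟨ψ, ?_⟩
    rw [parityPlus_apply, h]
    module

lemma isOdd_iff {ψ : L2R} : IsOdd ψ ↔ reflection ψ = -ψ := by
  constructor
  · rintro ⟨φ, rfl⟩
    exact reflection_parityMinus φ
  · intro h
    refine ⟨ψ, ?_⟩
    rw [parityMinus_apply, h]
    module

lemma reflection_mem_eigenspaceHC {r E : ℝ} {ψ : L2R} (h : ψ ∈ eigenspaceHC r E) :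
    reflection ψ ∈ eigenspaceHC r E := by
  obtain ⟨u, hu, hψ, hw⟩ := mem_eigenspaceHC_iff_exists.1 h
  exact mem_eigenspaceHC_iff_exists.2
    ⟨_, hu.comp_neg, (reflection_coeFn ψ).trans (ae_comp_neg hψ), hw.comp_neg hu⟩

lemma eq_zero_iff_of_ae_eq {ψ : L2R} {u : ℝ → ℂ} (hu : MemH1 u) (h : ψ =ᵐ[volume] u) :
    ψ = 0 ↔ u = fun _ => 0 := by
  rw [Lp.eq_zero_iff_ae_eq_zero, ← Continuous.ae_eq_iff_eq volume hu.continuous continuous_const]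
  exact ⟨fun h0 => h.symm.trans h0, fun h0 => h.trans h0⟩

/-- The continuous representative of an `L²` function with a parity has this parity pointwise. -/
lemma comp_neg_eq_of_reflection_eq {ψ : L2R} {u : ℝ → ℂ} (hu : MemH1 u) (h : ψ =ᵐ[volume] u)
    {σ : ℂ} (hp : reflection ψ = σ • ψ) : ∀ x, u (-x) = σ * u x := by
  refine congrFun ((Continuous.ae_eq_iff_eq volume (hu.continuous.comp continuous_neg)
    (continuous_const.mul hu.continuous)).1 ?_)
  filter_upwards [reflection_coeFn ψ, ae_comp_neg h, Lp.coeFn_smul σ ψ, h] with x h1 h2 h3 h4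
  rw [Function.comp_apply, ← h2, ← h1, hp, h3, Pi.smul_apply, h4, smul_eq_mul]
  rfl

/-- Conversely, an `L²` function whose representative has a parity has this parity. -/
lemma reflection_eq_of_comp_neg_eq {ψ : L2R} {u : ℝ → ℂ} (h : ψ =ᵐ[volume] u)
    {σ : ℂ} (hp : ∀ x, u (-x) = σ * u x) : reflection ψ = σ • ψ := by
  refine Lp.ext ?_
  filter_upwards [reflection_coeFn ψ, ae_comp_neg h, Lp.coeFn_smul σ ψ, h] with x h1 h2 h3 h4
  rw [h1, h2, hp, h3, Pi.smul_apply, h4, smul_eq_mul]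

lemma eq_zero_or_eq_zero_of_mem_eigenspaceHC {r E : ℝ} {ψ φ : L2R} (hψ : ψ ∈ eigenspaceHC r E)
    (hφ : φ ∈ eigenspaceHC r E) (hψp : reflection ψ = ψ) (hφp : reflection φ = -φ) :
    ψ = 0 ∨ φ = 0 := by
  obtain ⟨u, hu, hψu, hwu⟩ := mem_eigenspaceHC_iff_exists.1 hψ
  obtain ⟨v, hv, hφv, hwv⟩ := mem_eigenspaceHC_iff_exists.1 hφ
  rw [eq_zero_iff_of_ae_eq hu hψu, eq_zero_iff_of_ae_eq hv hφv]
  have h1 := comp_neg_eq_of_reflection_eq hu hψu (σ := 1) (by rw [one_smul, hψp])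
  have h2 := comp_neg_eq_of_reflection_eq hv hφv (σ := -1) (by rw [neg_one_smul, hφp])
  exact hwu.eq_zero_or_eq_zero hwv hu hv (fun x => by rw [h1, one_mul])
    fun x => by rw [h2, neg_one_mul]

/-- Eigenfunctions have a parity. -/
lemma parity_of_mem_eigenspaceHC {r E : ℝ} {ψ : L2R} (hψ : ψ ∈ eigenspaceHC r E) :
    (parityPlus ψ = ψ ∧ parityMinus ψ = 0) ∨ (parityPlus ψ = 0 ∧ parityMinus ψ = ψ) := by
  have h1 : parityPlus ψ ∈ eigenspaceHC r E := by
    rw [parityPlus_apply]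
    exact Submodule.smul_mem _ _ (Submodule.add_mem _ hψ (reflection_mem_eigenspaceHC hψ))
  have h2 : parityMinus ψ ∈ eigenspaceHC r E := by
    rw [parityMinus_apply]
    exact Submodule.smul_mem _ _ (Submodule.sub_mem _ hψ (reflection_mem_eigenspaceHC hψ))
  have hs := parityPlus_add_parityMinus ψ
  rcases eq_zero_or_eq_zero_of_mem_eigenspaceHC h1 h2 (reflection_parityPlus ψ)
    (reflection_parityMinus ψ) with h | h
  · right
    rw [h, zero_add] at hs
    exact ⟨h, hs⟩
  · left
    rw [h, add_zero] at hs
    exact ⟨hs, h⟩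

lemma exists_eq_smul_of_reflection_eq {r E : ℝ} {ψ φ : L2R} (hψ : ψ ∈ eigenspaceHC r E)
    (hφ : φ ∈ eigenspaceHC r E) {σ : ℂ} (hψp : reflection ψ = σ • ψ) (hφp : reflection φ = σ • φ)
    (h0 : ψ ≠ 0) : ∃ c : ℂ, φ = c • ψ := by
  obtain ⟨u, hu, hψu, hwu⟩ := mem_eigenspaceHC_iff_exists.1 hψ
  obtain ⟨v, hv, hφv, hwv⟩ := mem_eigenspaceHC_iff_exists.1 hφ
  rw [Ne, eq_zero_iff_of_ae_eq hu hψu] at h0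
  obtain ⟨c, hc⟩ := hwu.exists_eq_const_mul hwv hu hv (comp_neg_eq_of_reflection_eq hu hψu hψp)
    (comp_neg_eq_of_reflection_eq hv hφv hφp) h0
  refine ⟨c, Lp.ext ?_⟩
  filter_upwards [hψu, hφv, Lp.coeFn_smul c ψ] with x h1 h2 h3
  rw [h2, hc, h3, Pi.smul_apply, h1, smul_eq_mul]

/-- Eigenspaces are spanned by any of their nonzero elements. -/
lemma eigenspaceHC_eq_span {r E : ℝ} {ψ : L2R} (hψ : ψ ∈ eigenspaceHC r E) (h0 : ψ ≠ 0) :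
    eigenspaceHC r E = Submodule.span ℂ {ψ} := by
  refine le_antisymm (fun φ hφ => ?_) ((Submodule.span_singleton_le_iff_mem _ _).2 hψ)
  rw [Submodule.mem_span_singleton]
  by_cases hφ0 : φ = 0
  · exact ⟨0, by rw [hφ0, zero_smul]⟩
  have hev : ∀ χ : L2R, parityPlus χ = χ → reflection χ = χ := fun χ h => by
    rw [← h]; exact reflection_parityPlus χ
  have hod : ∀ χ : L2R, parityMinus χ = χ → reflection χ = -χ := fun χ h => by
    rw [← h]; exact reflection_parityMinus χ
  have key : ∃ σ : ℂ, reflection ψ = σ • ψ ∧ reflection φ = σ • φ := by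
    rcases parity_of_mem_eigenspaceHC hψ with h1 | h1 <;>
      rcases parity_of_mem_eigenspaceHC hφ with h2 | h2
    · exact ⟨1, by rw [one_smul, hev _ h1.1], by rw [one_smul, hev _ h2.1]⟩
    · rcases eq_zero_or_eq_zero_of_mem_eigenspaceHC hψ hφ (hev _ h1.1) (hod _ h2.2) with h | h
      · exact absurd h h0
      · exact absurd h hφ0
    · rcases eq_zero_or_eq_zero_of_mem_eigenspaceHC hφ hψ (hev _ h2.1) (hod _ h1.2) with h | h
      · exact absurd h hφ0
      · exact absurd h h0
    · exact ⟨-1, by rw [neg_one_smul, hod _ h1.2], by rw [neg_one_smul, hod _ h2.2]⟩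
  obtain ⟨σ, h1, h2⟩ := key
  obtain ⟨c, hc⟩ := exists_eq_smul_of_reflection_eq hψ hφ h1 h2 h0
  exact ⟨c, hc.symm⟩

/-! ### The digamma function -/

lemma logDeriv_Gamma_add_one {x : ℝ} (hx : ∀ m : ℕ, x ≠ -m) :
    logDeriv Real.Gamma (x + 1) = logDeriv Real.Gamma x + 1 / x := by
  have hx0 : x ≠ 0 := by simpa using hx 0
  have hG : Real.Gamma x ≠ 0 := Real.Gamma_ne_zero hx
  have h1 : (fun y => Real.Gamma (y + 1)) =ᶠ[𝓝 x] fun y => y * Real.Gamma y := by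
    filter_upwards [isOpen_ne.mem_nhds hx0] with y hy using Real.Gamma_add_one hy
  have h2 := h1.deriv_eq
  rw [deriv_comp_add_const, deriv_fun_mul differentiableAt_fun_id (Real.differentiableAt_Gamma hx),
    deriv_id''] at h2
  rw [logDeriv_apply, logDeriv_apply, h2, Real.Gamma_add_one hx0]
  field_simp
  ring

lemma logDeriv_Gamma_one : logDeriv Real.Gamma 1 = -Real.eulerMascheroniConstant := by
  rw [logDeriv_apply, Real.hasDerivAt_Gamma_one.deriv, Real.Gamma_one, div_one]

lemma ne_neg_natCast_of_pos {x : ℝ} (hx : 0 < x) (m : ℕ) : x ≠ -m := by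
  have : (0 : ℝ) ≤ m := m.cast_nonneg
  linarith

/-- The digamma function is monotone on `(0, ∞)` because `Γ` is logarithmically convex. -/
lemma monotoneOn_logDeriv_Gamma : MonotoneOn (logDeriv Real.Gamma) (Ioi 0) := by
  have hd : ∀ x ∈ Ioi (0 : ℝ), HasDerivAt (Real.log ∘ Real.Gamma) (logDeriv Real.Gamma x) x := by
    intro x hx
    exact ((Real.differentiableAt_Gamma (ne_neg_natCast_of_pos hx)).hasDerivAt).log
      (Real.Gamma_pos_of_pos hx).ne'
  have := Real.convexOn_log_Gamma.monotoneOn_deriv fun x hx => (hd x hx).differentiableAt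
  exact this.congr fun x hx => (hd x hx).deriv

lemma continuousOn_logDeriv_Gamma : ContinuousOn (logDeriv Real.Gamma) (Ioi 0) := by
  have hU : IsOpen {s : ℂ | 0 < s.re} := isOpen_lt continuous_const Complex.continuous_re
  have hG : ∀ s : ℂ, 0 < s.re → DifferentiableAt ℂ Complex.Gamma s := fun s hs =>
    Complex.differentiableAt_Gamma s fun m h => by
      rw [h, Complex.neg_re, Complex.natCast_re] at hs
      have : (0 : ℝ) ≤ m := m.cast_nonneg
      linarith
  have hdiff : DifferentiableOn ℂ Complex.Gamma {s : ℂ | 0 < s.re} :=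
    fun s hs => (hG s hs).differentiableWithinAt
  have hd := hdiff.deriv hU
  have hreal : ∀ x ∈ Ioi (0 : ℝ), deriv Real.Gamma x = (deriv Complex.Gamma (x : ℂ)).re :=
    fun x hx => ((hG x (by simpa using hx)).hasDerivAt.real_of_complex).deriv
  have hc : ContinuousOn (fun x : ℝ => (deriv Complex.Gamma (x : ℂ)).re) (Ioi 0) :=
    Complex.continuous_re.comp_continuousOn (hd.continuousOn.comp
      Complex.continuous_ofReal.continuousOn fun x hx => by simpa using hx)
  exact (hc.congr hreal).div Real.differentiableOn_Gamma_Ioi.continuousOn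
    fun x hx => (Real.Gamma_pos_of_pos hx).ne'

/-- The digamma function is the only monotone solution of its difference equation: the difference
of two solutions is periodic and tends to `0`. -/
lemma eq_logDeriv_Gamma_of_monotoneOn {f : ℝ → ℝ} (hf : MonotoneOn f (Ioi 0))
    (h1 : f 1 = -Real.eulerMascheroniConstant) (hadd : ∀ x, 0 < x → f (x + 1) = f x + 1 / x) :
    ∀ x, 0 < x → f x = logDeriv Real.Gamma x := by
  set ψ := logDeriv Real.Gamma
  have hψ : ∀ x, 0 < x → ψ (x + 1) = ψ x + 1 / x := fun x hx =>
    logDeriv_Gamma_add_one (ne_neg_natCast_of_pos hx)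
  have hnat : ∀ n : ℕ, f (n + 1) = ψ (n + 1) := by
    intro n
    induction n with
    | zero => simpa [ψ, logDeriv_Gamma_one] using h1
    | succ n ih =>
      push_cast
      rw [hadd _ (by positivity), hψ _ (by positivity), ih]
  have hper : ∀ x, 0 < x → ∀ n : ℕ, f (x + n) - ψ (x + n) = f x - ψ x := by
    intro x hx n
    induction n with
    | zero => simp
    | succ n ih =>
      push_cast
      rw [← add_assoc, hadd _ (by positivity), hψ _ (by positivity), ← ih]
      ring
  -- Both functions are caught between their common values at consecutive integers.
  have hbound : ∀ x, 1 ≤ x → |f x - ψ x| ≤ 1 / (⌊x⌋₊ : ℝ) := by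
    intro x hx
    obtain ⟨n, hn⟩ : ∃ n : ℕ, ⌊x⌋₊ = n + 1 := ⟨⌊x⌋₊ - 1, by
      have := (Nat.one_le_floor_iff x).2 hx
      omega⟩
    have hx0 : 0 < x := by linarith
    have hlo : (n + 1 : ℝ) ≤ x := by
      have := Nat.floor_le hx0.le
      rw [hn] at this
      exact_mod_cast this
    have hhi : x ≤ (n + 1 : ℕ) + 1 := by
      have := (Nat.lt_floor_add_one x).le
      rwa [hn] at this
    have hn0 : (0 : ℝ) < n + 1 := by positivity
    have a1 := hf hn0 hx0 hlo
    have a2 := hf hx0 (show (0 : ℝ) < (n + 1 : ℕ) + 1 by positivity) hhi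
    have b1 := monotoneOn_logDeriv_Gamma hn0 hx0 hlo
    have b2 := monotoneOn_logDeriv_Gamma hx0 (show (0 : ℝ) < (n + 1 : ℕ) + 1 by positivity) hhi
    have c1 := hψ (n + 1) hn0
    rw [hnat] at a1 a2
    change ψ _ ≤ ψ _ at b1 b2
    push_cast at a2 b2
    rw [hn]
    push_cast
    rw [abs_le]
    constructor <;> linarith
  intro x hx
  have hlim : Tendsto (fun n : ℕ => 1 / (n : ℝ)) atTop (𝓝 0) := tendsto_one_div_atTop_nhds_zero_nat
  have hle : |f x - ψ x| ≤ 0 := by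
    refine ge_of_tendsto hlim ?_
    filter_upwards [eventually_ge_atTop 1] with n hn
    have hn1 : (1 : ℝ) ≤ n := by exact_mod_cast hn
    rw [← hper x hx n]
    refine (hbound _ (by linarith)).trans (one_div_le_one_div_of_le (by linarith) ?_)
    rw [Nat.floor_add_natCast hx.le]
    push_cast
    have : (0 : ℝ) ≤ ⌊x⌋₊ := Nat.cast_nonneg _
    linarith
  exact sub_eq_zero.1 (abs_nonpos_iff.1 hle)

lemma hasDerivAt_div_one_add {t : ℝ} (ht : 0 < t) :
    HasDerivAt (fun t : ℝ => t / (1 + t)) (1 / (1 + t) ^ 2) t := by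
  refine ((hasDerivAt_id t).div ((hasDerivAt_id t).const_add 1)
    (by simp only [id]; linarith)).congr_deriv ?_
  simp only [id]
  ring

/-- The substitution `s = t / (1 + t)` in `∫₀¹ s ^ (x - 1) ds = 1 / x`. -/
lemma integral_rpow_div_one_add {x : ℝ} (hx : 0 < x) :
    IntegrableOn (fun t : ℝ => (t / (1 + t)) ^ (x - 1) / (1 + t) ^ 2) (Ioi 0) ∧
    ∫ t in Ioi (0 : ℝ), (t / (1 + t)) ^ (x - 1) / (1 + t) ^ 2 = 1 / x := by
  have hd : ∀ t ∈ Ioi (0 : ℝ), HasDerivAt (fun t : ℝ => (t / (1 + t)) ^ x / x)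
      ((t / (1 + t)) ^ (x - 1) / (1 + t) ^ 2) t := by
    intro t (ht : 0 < t)
    have hu : 0 < t / (1 + t) := by positivity
    refine (((hasDerivAt_div_one_add ht).rpow_const (p := x) (Or.inl hu.ne')).div_const
      x).congr_deriv ?_
    field_simp
  have hc : ContinuousWithinAt (fun t : ℝ => (t / (1 + t)) ^ x / x) (Ici 0) 0 := by
    refine ContinuousAt.continuousWithinAt ?_
    refine ContinuousAt.div_const (ContinuousAt.rpow_const ?_ (Or.inr hx.le)) _
    exact continuousAt_id.div (continuousAt_const.add continuousAt_id) (by simp)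
  have hinf : Tendsto (fun t : ℝ => (t / (1 + t)) ^ x / x) atTop (𝓝 (1 ^ x / x)) := by
    refine Tendsto.div_const (Tendsto.rpow_const ?_ (Or.inl one_ne_zero)) _
    have h : Tendsto (fun t : ℝ => 1 - 1 / (1 + t)) atTop (𝓝 (1 - 0)) := by
      refine tendsto_const_nhds.sub ?_
      simp only [one_div]
      exact tendsto_inv_atTop_zero.comp (tendsto_atTop_add_const_left _ _ tendsto_id)
    rw [sub_zero] at h
    refine h.congr' ?_
    filter_upwards [eventually_gt_atTop 0] with t ht
    field_simp
    ring
  have hnn : ∀ t ∈ Ioi (0 : ℝ), 0 ≤ (t / (1 + t)) ^ (x - 1) / (1 + t) ^ 2 := by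
    intro t (ht : 0 < t)
    positivity
  refine ⟨integrableOn_Ioi_deriv_of_nonneg hc hd hnn hinf, ?_⟩
  rw [integral_Ioi_of_hasDerivAt_of_nonneg hc hd hnn hinf]
  simp [Real.zero_rpow hx.ne']

lemma abs_one_sub_rpow_le {u : ℝ} (hu : 0 < u) (hu1 : u ≤ 1) {x : ℝ} (hx : 0 < x) :
    |1 - u ^ (x - 1)| ≤ (1 + x) * (u ^ (x - 1) + 1) * (1 - u) := by
  have hp : 0 < u ^ (x - 1) := Real.rpow_pos_of_pos hu _
  rcases le_total 1 x with h1 | h1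
  · have hle : u ^ (x - 1) ≤ 1 := Real.rpow_le_one hu.le hu1 (by linarith)
    rw [abs_of_nonneg (by linarith)]
    rcases le_total (x - 1) 1 with h2 | h2
    · have : u ≤ u ^ (x - 1) := by
        simpa using Real.rpow_le_rpow_of_exponent_ge hu hu1 h2
      nlinarith [mul_nonneg (by linarith : 0 ≤ 1 - u)
        (by positivity : 0 ≤ x + (1 + x) * u ^ (x - 1))]
    · have := one_add_mul_self_le_rpow_one_add (s := u - 1) (by linarith) h2
      rw [add_sub_cancel] at this
      nlinarith [mul_nonneg (by linarith : 0 ≤ 1 - u)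
        (by positivity : 0 ≤ 2 + (1 + x) * u ^ (x - 1))]
  · have hle : 1 ≤ u ^ (x - 1) := Real.one_le_rpow_of_pos_of_le_one_of_nonpos hu hu1 (by linarith)
    rw [abs_of_nonpos (by linarith)]
    have h2 : u ≤ u ^ (1 - x) := by
      simpa using Real.rpow_le_rpow_of_exponent_ge hu hu1 (by linarith : 1 - x ≤ 1)
    have h3 : u ^ (x - 1) * u ^ (1 - x) = 1 := by
      rw [← Real.rpow_add hu]
      simp
    have h4 : u ^ (x - 1) * u ≤ 1 := (mul_le_mul_of_nonneg_left h2 hp.le).trans h3.le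
    nlinarith [mul_nonneg (by linarith : 0 ≤ 1 - u) (by positivity : 0 ≤ 1 + x + x * u ^ (x - 1))]

/-- The integrand of Gauss' formula for the digamma function is integrable. -/
lemma integrableOn_gauss {x : ℝ} (hx : 0 < x) :
    IntegrableOn (fun t : ℝ => (1 - (t / (1 + t)) ^ (x - 1)) / (1 + t)) (Ioi 0) := by
  have h1 := ((integral_rpow_div_one_add hx).1.add
    (integral_rpow_div_one_add one_pos).1).const_mul (1 + x)
  refine Integrable.mono' h1 ?_ ?_
  · refine ContinuousOn.aestronglyMeasurable (fun t (ht : 0 < t) => ?_) measurableSet_Ioi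
    have hu : 0 < t / (1 + t) := by positivity
    refine (ContinuousAt.div (continuousAt_const.sub (ContinuousAt.rpow_const
      (hasDerivAt_div_one_add ht).continuousAt (Or.inl hu.ne')))
      (continuousAt_const.add continuousAt_id) ?_).continuousWithinAt
    change 1 + t ≠ 0
    linarith
  · filter_upwards [ae_restrict_mem measurableSet_Ioi] with t (ht : 0 < t)
    have hu : 0 < t / (1 + t) := by positivity
    have hu1 : t / (1 + t) ≤ 1 := by rw [div_le_one (by linarith)]; linarith
    have h := abs_one_sub_rpow_le hu hu1 hx
    have e : 1 - t / (1 + t) = 1 / (1 + t) := by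
      field_simp
      ring
    rw [Real.norm_eq_abs, abs_div, abs_of_pos (by linarith : 0 < 1 + t),
      div_le_iff₀ (by linarith : 0 < 1 + t)]
    refine h.trans (le_of_eq ?_)
    rw [e]
    simp only [Pi.add_apply, sub_self, Real.rpow_zero]
    field_simp

/-- Gauss' integral for the digamma function, in the variable `t` with `s = t / (1 + t)`. -/
lemma integral_gauss {x : ℝ} (hx : 0 < x) :
    ∫ t in Ioi (0 : ℝ), (1 - (t / (1 + t)) ^ (x - 1)) / (1 + t)
      = logDeriv Real.Gamma x + Real.eulerMascheroniConstant := by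
  rw [← sub_eq_iff_eq_add]
  -- The integral minus Euler's constant is monotone and solves the difference equation.
  refine eq_logDeriv_Gamma_of_monotoneOn (f := fun x => (∫ t in Ioi (0 : ℝ),
    (1 - (t / (1 + t)) ^ (x - 1)) / (1 + t)) - Real.eulerMascheroniConstant) ?_ ?_ ?_ x hx
  · intro x hx y hy hxy
    refine sub_le_sub_right (setIntegral_mono_on (integrableOn_gauss hx) (integrableOn_gauss hy)
      measurableSet_Ioi fun t (ht : 0 < t) => ?_) _
    have hu : 0 < t / (1 + t) := by positivity
    have hu1 : t / (1 + t) ≤ 1 := by rw [div_le_one (by linarith)]; linarith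
    have := Real.rpow_le_rpow_of_exponent_ge hu hu1 (sub_le_sub_right hxy 1)
    gcongr
  · simp
  · intro x hx
    rw [← (integral_rpow_div_one_add hx).2, sub_add_eq_add_sub,
      ← integral_add (integrableOn_gauss hx) (integral_rpow_div_one_add hx).1]
    congr 1
    refine setIntegral_congr_fun measurableSet_Ioi fun t (ht : 0 < t) => ?_
    have hu : 0 < t / (1 + t) := by positivity
    rw [add_sub_right_comm, Real.rpow_add_one hu.ne']
    field_simp
    ring

/-! ### Roots of the quantisation condition -/

/-- Shifting the argument of the digamma function into `(1, 2)` splits off its poles. -/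
lemma logDeriv_Gamma_one_sub {k : ℕ} {α : ℝ} (hα : ∀ n : ℕ, α ≠ n) :
    logDeriv Real.Gamma (1 - α)
      = logDeriv Real.Gamma (k + 1 - α) + ∑ i ∈ Finset.range k, 1 / (α - (i + 1)) := by
  induction k with
  | zero => simp
  | succ k ih =>
    have h := logDeriv_Gamma_add_one (x := k + 1 - α) fun m hm => hα (k + 1 + m) (by
      push_cast
      linarith)
    have h1 : (k : ℝ) + 1 - α ≠ 0 := fun h0 => hα (k + 1) (by push_cast; linarith)
    have h2 : α - (k + 1) ≠ 0 := fun h0 => hα (k + 1) (by push_cast; linarith)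
    have h3 : 1 / (k + 1 - α) + 1 / (α - (k + 1)) = 0 := by
      field_simp
      ring
    rw [ih, Finset.sum_range_succ]
    push_cast
    rw [show (k : ℝ) + 1 + 1 - α = k + 1 - α + 1 by ring, h]
    linarith

lemma ne_natCast_of_mem_Ioo {k : ℕ} {α : ℝ} (hα : α ∈ Ioo ((k : ℝ) - 1) k) (n : ℕ) : α ≠ n := by
  rintro rfl
  have h1 : n < k := by exact_mod_cast hα.2
  have h2 : k < n + 1 := by
    have := hα.1
    rw [sub_lt_iff_lt_add] at this
    exact_mod_cast this
  omega

lemma quantF_eq {k : ℕ} {α : ℝ} (hα : α ∈ Ioo ((k : ℝ) - 1) k) (r : ℝ) :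
    quantF α r = logDeriv Real.Gamma (k + 1 - α) + ∑ i ∈ Finset.range k, 1 / (α - (i + 1))
      + 2 * Real.eulerMascheroniConstant + 1 / (2 * α) - Real.log α + Real.log r := by
  rw [quantF, logDeriv_Gamma_one_sub (k := k) (ne_natCast_of_mem_Ioo hα)]

/-- On the interval between two poles the quantisation function is strictly decreasing. -/
lemma strictAntiOn_quantF {k : ℕ} (hk : 1 ≤ k) (r : ℝ) :
    StrictAntiOn (fun α => quantF α r) (Ioo ((k : ℝ) - 1) k) := by
  intro α hα β hβ hαβ
  have hk1 : (1 : ℝ) ≤ k := by exact_mod_cast hk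
  have hα0 : 0 < α := by linarith [hα.1]
  simp only
  rw [quantF_eq hα, quantF_eq hβ]
  have h1 : logDeriv Real.Gamma (k + 1 - β) ≤ logDeriv Real.Gamma (k + 1 - α) :=
    monotoneOn_logDeriv_Gamma (show (0 : ℝ) < k + 1 - β by linarith [hβ.2])
      (show (0 : ℝ) < k + 1 - α by linarith [hα.2]) (by linarith)
  have h2 : ∑ i ∈ Finset.range k, 1 / (β - ((i : ℝ) + 1))
      ≤ ∑ i ∈ Finset.range k, 1 / (α - ((i : ℝ) + 1)) := by
    refine Finset.sum_le_sum fun i hi => ?_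
    have hik : i + 1 ≤ k := Finset.mem_range.1 hi
    rcases hik.eq_or_lt with h | h
    · have hc : (i : ℝ) + 1 = k := by exact_mod_cast h
      rw [hc]
      exact one_div_le_one_div_of_neg_of_le (by linarith [hβ.2]) (by linarith)
    · have hc : (i : ℝ) + 1 + 1 ≤ k := by exact_mod_cast h
      exact one_div_le_one_div_of_le (by linarith [hα.1]) (by linarith)
  have h3 : 1 / (2 * β) < 1 / (2 * α) := one_div_lt_one_div_of_lt (by linarith) (by linarith)
  have h4 : Real.log α < Real.log β := Real.log_lt_log hα0 hαβ
  linarith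

lemma continuousOn_quantF {k : ℕ} (hk : 1 ≤ k) (r : ℝ) :
    ContinuousOn (fun α => quantF α r) (Ioo ((k : ℝ) - 1) k) := by
  have hk1 : (1 : ℝ) ≤ k := by exact_mod_cast hk
  refine ContinuousOn.congr (f := fun α => logDeriv Real.Gamma (k + 1 - α)
    + ∑ i ∈ Finset.range k, 1 / (α - (i + 1)) + 2 * Real.eulerMascheroniConstant + 1 / (2 * α)
    - Real.log α + Real.log r) ?_ fun α hα => quantF_eq hα r
  have hpos : ∀ α ∈ Ioo ((k : ℝ) - 1) k, 0 < α := fun α hα => by linarith [hα.1]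
  refine ContinuousOn.add (ContinuousOn.sub (ContinuousOn.add (ContinuousOn.add (ContinuousOn.add
    (continuousOn_logDeriv_Gamma.comp (continuousOn_const.sub continuousOn_id) fun α hα => ?_)
    (continuousOn_finsetSum _ fun i _ => continuousOn_const.div
      (continuousOn_id.sub continuousOn_const) fun α hα => ?_)) continuousOn_const)
    (continuousOn_const.div (continuousOn_const.mul continuousOn_id) fun α hα => ?_))
    (continuousOn_id.log fun α hα => (hpos α hα).ne')) continuousOn_const
  · change (0 : ℝ) < k + 1 - α
    linarith [hα.2]
  · change α - ((i : ℝ) + 1) ≠ 0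
    rw [sub_ne_zero]
    exact_mod_cast ne_natCast_of_mem_Ioo hα (i + 1)
  · have := hpos α hα
    change 2 * α ≠ 0
    positivity

lemma tendsto_one_div_sub_nhdsLT (c : ℝ) : Tendsto (fun α : ℝ => 1 / (α - c)) (𝓝[<] c) atBot := by
  simp only [one_div]
  refine tendsto_inv_nhdsLT_zero.comp (tendsto_nhdsWithin_iff.2 ⟨?_, ?_⟩)
  · have : Tendsto (fun α : ℝ => α - c) (𝓝 c) (𝓝 (c - c)) := tendsto_id.sub_const c
    rw [sub_self] at this
    exact this.mono_left nhdsWithin_le_nhds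
  · filter_upwards [self_mem_nhdsWithin] with α (hα : α < c) using sub_neg.2 hα

lemma tendsto_one_div_sub_nhdsGT (c : ℝ) : Tendsto (fun α : ℝ => 1 / (α - c)) (𝓝[>] c) atTop := by
  simp only [one_div]
  refine tendsto_inv_nhdsGT_zero.comp (tendsto_nhdsWithin_iff.2 ⟨?_, ?_⟩)
  · have : Tendsto (fun α : ℝ => α - c) (𝓝 c) (𝓝 (c - c)) := tendsto_id.sub_const c
    rw [sub_self] at this
    exact this.mono_left nhdsWithin_le_nhds
  · filter_upwards [self_mem_nhdsWithin] with α (hα : c < α) using sub_pos.2 hα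

lemma tendsto_quantF_nhdsLT {k : ℕ} (hk : 1 ≤ k) (r : ℝ) :
    Tendsto (fun α => quantF α r) (𝓝[<] (k : ℝ)) atBot := by
  obtain ⟨m, rfl⟩ : ∃ m, k = m + 1 := ⟨k - 1, by omega⟩
  set c : ℝ := ((m + 1 : ℕ) : ℝ) with hc
  have hcm : c = m + 1 := by rw [hc]; push_cast; ring
  have hm : (0 : ℝ) ≤ m := m.cast_nonneg
  have hc0 : 0 < c := by linarith
  have hcont : ContinuousAt (fun α => logDeriv Real.Gamma (c + 1 - α)
      + ∑ i ∈ Finset.range m, 1 / (α - (i + 1)) + 2 * Real.eulerMascheroniConstant + 1 / (2 * α)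
      - Real.log α + Real.log r) c := by
    refine ContinuousAt.add (ContinuousAt.sub (ContinuousAt.add (ContinuousAt.add (ContinuousAt.add
      (ContinuousAt.comp (g := logDeriv Real.Gamma) (continuousOn_logDeriv_Gamma.continuousAt
        (Ioi_mem_nhds ?_)) (continuousAt_const.sub continuousAt_id))
      (tendsto_finsetSum _ fun i hi => ContinuousAt.div continuousAt_const
        (continuousAt_id.sub continuousAt_const) ?_)) continuousAt_const)
      (continuousAt_const.div (continuousAt_const.mul continuousAt_id) ?_))
      (continuousAt_id.log hc0.ne')) continuousAt_const
    · linarith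
    · have hi' : (i : ℝ) + 1 ≤ m := by exact_mod_cast Finset.mem_range.1 hi
      intro h
      linarith
    · exact mul_ne_zero two_ne_zero hc0.ne'
  refine ((hcont.tendsto.mono_left nhdsWithin_le_nhds).add_atBot
    (tendsto_one_div_sub_nhdsLT c)).congr' ?_
  filter_upwards [Ioo_mem_nhdsLT (show c - 1 < c by linarith)] with α hα
  rw [quantF_eq (k := m + 1) hα, Finset.sum_range_succ, ← hcm]
  ring

lemma tendsto_quantF_nhdsGT {k : ℕ} (hk : 1 ≤ k) (r : ℝ) :
    Tendsto (fun α => quantF α r) (𝓝[>] ((k : ℝ) - 1)) atTop := by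
  rcases hk.eq_or_lt with rfl | hk2
  · rw [Nat.cast_one, sub_self]
    have hcont : ContinuousAt (fun α : ℝ => logDeriv Real.Gamma (1 - α)
        + 2 * Real.eulerMascheroniConstant + Real.log r) 0 := by
      refine ContinuousAt.add (ContinuousAt.add (ContinuousAt.comp (g := logDeriv Real.Gamma)
        (continuousOn_logDeriv_Gamma.continuousAt (Ioi_mem_nhds ?_))
        (continuousAt_const.sub continuousAt_id)) continuousAt_const) continuousAt_const
      simp
    have hinv : Tendsto (fun α : ℝ => 1 / 2 * (1 / (α - 0))) (𝓝[>] 0) atTop :=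
      (tendsto_one_div_sub_nhdsGT 0).const_mul_atTop (by norm_num)
    have hlog : Tendsto (fun α : ℝ => -Real.log α) (𝓝[>] 0) atTop :=
      tendsto_neg_atBot_atTop.comp Real.tendsto_log_nhdsGT_zero
    refine ((hcont.tendsto.mono_left nhdsWithin_le_nhds).add_atTop
      (hinv.atTop_add_atTop hlog)).congr fun α => ?_
    rw [quantF, sub_zero, one_div_mul_one_div]
    ring
  · obtain ⟨m, rfl⟩ : ∃ m, k = m + 1 + 1 := ⟨k - 2, by omega⟩
    have hcm : ((m + 1 + 1 : ℕ) : ℝ) - 1 = m + 1 := by push_cast; ring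
    set c : ℝ := ((m + 1 + 1 : ℕ) : ℝ) - 1
    have hm : (0 : ℝ) ≤ m := m.cast_nonneg
    have hc0 : 0 < c := by linarith
    have hcont : ContinuousAt (fun α => logDeriv Real.Gamma (c + 1 + 1 - α)
        + (∑ i ∈ Finset.range m, 1 / (α - (i + 1)) + 1 / (α - (c + 1)))
        + 2 * Real.eulerMascheroniConstant + 1 / (2 * α) - Real.log α + Real.log r) c := by
      refine ContinuousAt.add (ContinuousAt.sub (ContinuousAt.add (ContinuousAt.add
        (ContinuousAt.add (ContinuousAt.comp (g := logDeriv Real.Gamma)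
          (continuousOn_logDeriv_Gamma.continuousAt
          (Ioi_mem_nhds ?_)) (continuousAt_const.sub continuousAt_id))
        (ContinuousAt.add (tendsto_finsetSum _ fun i hi => ContinuousAt.div continuousAt_const
          (continuousAt_id.sub continuousAt_const) ?_) (continuousAt_const.div
          (continuousAt_id.sub continuousAt_const) ?_))) continuousAt_const)
        (continuousAt_const.div (continuousAt_const.mul continuousAt_id) ?_))
        (continuousAt_id.log hc0.ne')) continuousAt_const
      · linarith
      · have hi' : (i : ℝ) + 1 ≤ m := by exact_mod_cast Finset.mem_range.1 hi
        intro h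
        linarith
      · simp
      · exact mul_ne_zero two_ne_zero hc0.ne'
    refine ((hcont.tendsto.mono_left nhdsWithin_le_nhds).add_atTop
      (tendsto_one_div_sub_nhdsGT c)).congr' ?_
    filter_upwards [Ioo_mem_nhdsGT (show c < c + 1 by linarith)] with α hα
    have hck : ((m + 1 + 1 : ℕ) : ℝ) = c + 1 := (sub_add_cancel _ _).symm
    rw [quantF_eq (k := m + 1 + 1) ⟨hα.1, by rw [hck]; exact hα.2⟩, Finset.sum_range_succ,
      Finset.sum_range_succ, hck]
    push_cast
    rw [← hcm]
    ring

/-- Between two poles the quantisation function has exactly one zero. -/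
lemma exists_quantF_eq_zero {k : ℕ} (hk : 1 ≤ k) (r : ℝ) :
    ∃ α ∈ Ioo ((k : ℝ) - 1) k, quantF α r = 0 ∧
      ∀ β ∈ Ioo ((k : ℝ) - 1) k, quantF β r = 0 → β = α := by
  have hlt : (k : ℝ) - 1 < k := by linarith
  obtain ⟨a, ha, haI⟩ := (((tendsto_quantF_nhdsGT hk r).eventually_ge_atTop 0).and
    (Ioo_mem_nhdsGT hlt)).exists
  obtain ⟨b, hb, hbI⟩ := (((tendsto_quantF_nhdsLT hk r).eventually_le_atBot 0).and
    (Ioo_mem_nhdsLT hlt)).exists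
  obtain ⟨α, hα, h0⟩ := isPreconnected_Ioo.intermediate_value hbI haI (continuousOn_quantF hk r)
    ⟨hb, ha⟩
  exact ⟨α, hα, h0, fun β hβ hβ0 => (strictAntiOn_quantF hk r).injOn hβ hα (hβ0.trans h0.symm)⟩

/-! ### The exponential integral near the origin -/

lemma integrableOn_rpow_mul_exp_neg_mul {s z : ℝ} (hs : -1 < s) (hz : 0 < z) :
    IntegrableOn (fun t : ℝ => t ^ s * Real.exp (-z * t)) (Ioi 0) := by
  simpa using integrableOn_rpow_mul_exp_neg_mul_rpow hs one_pos hz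

lemma abs_log_le_rpow_add {s : ℝ} (hs : 0 < s) : |Real.log s| ≤ 2 * s ^ (-(1 / 2) : ℝ) + s := by
  have hp : 0 < s ^ (1 / 2 : ℝ) := Real.rpow_pos_of_pos hs _
  rcases le_total s 1 with h1 | h1
  · have h := Real.abs_log_mul_self_rpow_lt s (1 / 2) hs h1 (by norm_num)
    rw [abs_mul, abs_of_pos hp] at h
    have : |Real.log s| ≤ 2 * s ^ (-(1 / 2) : ℝ) := by
      rw [Real.rpow_neg hs.le, ← div_eq_mul_inv, le_div_iff₀ hp]
      linarith
    linarith
  · rw [abs_of_nonneg (Real.log_nonneg h1)]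
    have := Real.log_le_self hs.le
    have := Real.rpow_nonneg hs.le (-(1 / 2))
    linarith

lemma integrableOn_abs_log_bound :
    IntegrableOn (fun s : ℝ => (2 * s ^ (-(1 / 2) : ℝ) + 2 * s) * Real.exp (-s)) (Ioi 0) := by
  have h1 := (integrableOn_rpow_mul_exp_neg_mul (s := -(1 / 2)) (by norm_num) one_pos).const_mul 2
  have h2 := (integrableOn_rpow_mul_exp_neg_mul (s := 1) (by norm_num) one_pos).const_mul 2
  refine (h1.add h2).congr (Eventually.of_forall fun s => ?_)
  simp only [Pi.add_apply, Real.rpow_one, neg_one_mul]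
  ring

/-- `Γ'(1) = -γ` as an integral. -/
lemma integral_log_mul_exp_neg :
    ∫ s in Ioi (0 : ℝ), Real.log s * Real.exp (-s) = -Real.eulerMascheroniConstant := by
  have h := Complex.hasDerivAt_GammaIntegral (s := 1) (by simp)
  have h2 : Complex.GammaIntegral =ᶠ[𝓝 1] Complex.Gamma := by
    have hU : IsOpen {s : ℂ | 0 < s.re} := isOpen_lt continuous_const Complex.continuous_re
    filter_upwards [hU.mem_nhds (show (0 : ℝ) < (1 : ℂ).re by simp)] with s hs
    exact (Complex.Gamma_eq_integral hs).symm
  have h3 := (h.congr_of_eventuallyEq h2.symm).unique Complex.hasDerivAt_Gamma_one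
  simp only [sub_self, Complex.cpow_zero, one_mul, ← Complex.ofReal_mul] at h3
  rw [integral_complex_ofReal] at h3
  exact_mod_cast h3

/-- Continuity at `z = 0` of `∫₀^∞ ln(z + s) e^{-s} ds`. -/
lemma tendsto_integral_exp_mul_log_add :
    Tendsto (fun z : ℝ => ∫ s in Ioi (0 : ℝ), Real.log (z + s) * Real.exp (-s)) (𝓝[>] 0)
      (𝓝 (-Real.eulerMascheroniConstant)) := by
  rw [← integral_log_mul_exp_neg]
  refine tendsto_integral_filter_of_dominated_convergence
    (fun s : ℝ => (2 * s ^ (-(1 / 2) : ℝ) + 2 * s) * Real.exp (-s)) ?_ ?_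
    integrableOn_abs_log_bound ?_
  · exact Eventually.of_forall fun z => ((Real.measurable_log.comp
      (measurable_const.add measurable_id)).mul (by fun_prop)).aestronglyMeasurable
  · filter_upwards [Ioo_mem_nhdsGT (zero_lt_one (α := ℝ))] with z hz
    filter_upwards [ae_restrict_mem measurableSet_Ioi] with s (hs : 0 < s)
    rw [norm_mul, Real.norm_eq_abs, Real.norm_of_nonneg (Real.exp_pos _).le]
    gcongr
    have h1 : Real.log s ≤ Real.log (z + s) := Real.log_le_log hs (by linarith [hz.1])
    have h2 : Real.log (z + s) ≤ z + s - 1 := Real.log_le_sub_one_of_pos (by linarith [hz.1])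
    have h3 := abs_log_le_rpow_add hs
    have h4 := Real.rpow_nonneg hs.le (-(1 / 2))
    rw [abs_le] at h3 ⊢
    constructor <;> linarith [h3.1, h3.2, hz.2]
  · filter_upwards [ae_restrict_mem measurableSet_Ioi] with s (hs : 0 < s)
    have hc : ContinuousAt (fun z : ℝ => Real.log (z + s) * Real.exp (-s)) 0 :=
      ((continuousAt_id.add continuousAt_const).log (by simpa using hs.ne')).mul continuousAt_const
    have := hc.tendsto.mono_left (nhdsWithin_le_nhds (s := Ioi 0))
    simpa using this

/-- The logarithmic singularity of `∫₀^∞ e^{-zt} / (1 + t) dt` at `z = 0`. -/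
lemma tendsto_integral_exp_div_one_add_add_log :
    Tendsto (fun z : ℝ => (∫ t in Ioi (0 : ℝ), Real.exp (-z * t) / (1 + t)) + Real.log z) (𝓝[>] 0)
      (𝓝 (-Real.eulerMascheroniConstant)) := by
  refine tendsto_integral_exp_mul_log_add.congr' ?_
  filter_upwards [self_mem_nhdsWithin] with z (hz : 0 < z)
  have hle : ∀ t : ℝ, 0 < t → |Real.log (1 + t)| ≤ t := fun t ht => by
    rw [abs_of_nonneg (Real.log_nonneg (by linarith))]
    have := Real.log_le_sub_one_of_pos (show 0 < 1 + t by linarith)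
    linarith
  have i1 : IntegrableOn (fun t : ℝ => Real.exp (-z * t) / (1 + t)) (Ioi 0) := by
    refine (integrableOn_exp_mul_Ioi (neg_neg_of_pos hz) 0).mono' ?_ ?_
    · exact (Measurable.div (by fun_prop) (by fun_prop)).aestronglyMeasurable
    · filter_upwards [ae_restrict_mem measurableSet_Ioi] with t (ht : 0 < t)
      rw [Real.norm_of_nonneg (by positivity)]
      exact div_le_self (Real.exp_pos _).le (by linarith)
  have i2 : IntegrableOn (fun t : ℝ => Real.log (1 + t) * Real.exp (-z * t)) (Ioi 0) := by
    have h1 := integrableOn_rpow_mul_exp_neg_mul (s := 1) (by norm_num) hz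
    refine h1.mono' ?_ ?_
    · exact ((Real.measurable_log.comp (measurable_const.add measurable_id)).mul
        (by fun_prop)).aestronglyMeasurable
    · filter_upwards [ae_restrict_mem measurableSet_Ioi] with t (ht : 0 < t)
      rw [norm_mul, Real.norm_eq_abs, Real.norm_of_nonneg (Real.exp_pos _).le, Real.rpow_one]
      gcongr
      exact hle t ht
  -- Integration by parts turns `1 / (1 + t)` into a logarithm; the substitution `s = z t` follows.
  have hparts : ∫ t in Ioi (0 : ℝ), (z * (Real.log (1 + t) * Real.exp (-z * t))
      - Real.exp (-z * t) / (1 + t)) = 0 := by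
    have := integral_Ioi_of_hasDerivAt_of_tendsto' (a := (0 : ℝ)) (m := (0 : ℝ))
      (f := fun t => -(Real.log (1 + t) * Real.exp (-z * t))) (f' := fun t =>
        z * (Real.log (1 + t) * Real.exp (-z * t)) - Real.exp (-z * t) / (1 + t))
      (fun t (ht : 0 ≤ t) => ?_) ((i2.const_mul z).sub i1) ?_
    · simpa using this
    · have h1 := ((hasDerivAt_id t).const_add 1).log (by simp only [id]; linarith)
      have h2 := ((hasDerivAt_id t).const_mul (-z)).exp
      refine (h1.mul h2).neg.congr_deriv ?_
      simp only [id]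
      ring
    · have h := tendsto_rpow_mul_exp_neg_mul_atTop_nhds_zero 1 z hz
      refine squeeze_zero_norm' ?_ h
      filter_upwards [eventually_gt_atTop 0] with t ht
      rw [norm_neg, norm_mul, Real.norm_eq_abs, Real.norm_of_nonneg (Real.exp_pos _).le,
        Real.rpow_one]
      gcongr
      exact hle t ht
  rw [integral_sub (i2.const_mul z) i1, integral_const_mul, sub_eq_zero] at hparts
  rw [← hparts]
  have hsub := integral_comp_mul_left_Ioi' (fun s => Real.log (1 + s / z) * Real.exp (-s)) 0 hz
  rw [mul_zero, smul_eq_mul] at hsub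
  have e1 : ∫ t in Ioi (0 : ℝ), Real.log (1 + z * t / z) * Real.exp (-(z * t))
      = ∫ t in Ioi (0 : ℝ), Real.log (1 + t) * Real.exp (-z * t) := by
    refine setIntegral_congr_fun measurableSet_Ioi fun t _ => ?_
    rw [mul_div_cancel_left₀ _ hz.ne', neg_mul]
  rw [← e1, hsub]
  have i3 : IntegrableOn (fun s : ℝ => Real.log (1 + s / z) * Real.exp (-s)) (Ioi 0) := by
    rw [← mul_zero z, ← integrableOn_Ioi_comp_mul_left_iff _ _ hz]
    refine i2.congr_fun (fun t _ => ?_) measurableSet_Ioi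
    rw [mul_div_cancel_left₀ _ hz.ne']
    simp only [neg_mul]
  have e2 : Real.log z = ∫ s in Ioi (0 : ℝ), Real.log z * Real.exp (-s) := by
    rw [integral_const_mul, integral_exp_neg_Ioi_zero, mul_one]
  rw [e2, ← integral_add i3 ((integrableOn_exp_neg_Ioi 0).const_mul _)]
  refine setIntegral_congr_fun measurableSet_Ioi fun s (hs : 0 < s) => ?_
  have e3 : 1 + s / z = (z + s) / z := by
    field_simp
  rw [e3, Real.log_div (by linarith) hz.ne']
  ring

/-! ### Decaying solutions of Whittaker's equation -/

/-- `W` is a solution of Whittaker's equation `W'' = (1/4 - κ / z) W` on `(0, ∞)` with derivative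
`W'`, which decays exponentially at infinity and has at the origin the value `w` and the
regularised derivative `b = lim (W'(z) + κ w ln z)`. -/
structure IsWhittaker (κ : ℝ) (W W' : ℝ → ℝ) (w b : ℝ) : Prop where
  hasDerivAt : ∀ z, 0 < z → HasDerivAt W (W' z) z
  hasDerivAt_deriv : ∀ z, 0 < z → HasDerivAt W' ((1 / 4 - κ / z) * W z) z
  tendsto : Tendsto W (𝓝[>] 0) (𝓝 w)
  tendsto_deriv : Tendsto (fun z => W' z + κ * w * Real.log z) (𝓝[>] 0) (𝓝 b)
  decay : ∃ c, 0 < c ∧ (W =O[atTop] fun z => Real.exp (-c * z)) ∧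
    (W' =O[atTop] fun z => Real.exp (-c * z))

lemma tendsto_mul_log_nhdsGT_zero : Tendsto (fun z : ℝ => z * Real.log z) (𝓝[>] 0) (𝓝 0) := by
  have := Real.continuous_mul_log.tendsto 0
  rw [zero_mul] at this
  exact this.mono_left nhdsWithin_le_nhds

lemma tendsto_id_nhdsGT_zero : Tendsto (fun z : ℝ => z) (𝓝[>] 0) (𝓝 0) :=
  tendsto_id.mono_left nhdsWithin_le_nhds

lemma isBigO_affine_mul {c : ℝ} (hc : 0 < c) (p q : ℝ) (f : ℝ → ℝ)
    (hf : f =O[atTop] fun z => Real.exp (-c * z)) :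
    (fun z => (p * z + q) * f z) =O[atTop] fun z => Real.exp (-(c / 2) * z) := by
  have hexp : ∀ z : ℝ, Real.exp (c / 2 * z) * Real.exp (-c * z) = Real.exp (-(c / 2) * z) :=
    fun z => by
      rw [← Real.exp_add]
      ring_nf
  have a1 := (isLittleO_pow_exp_pos_mul_atTop 1 (half_pos hc)).isBigO
  have a0 := (isLittleO_pow_exp_pos_mul_atTop 0 (half_pos hc)).isBigO
  have a2 := ((a1.const_mul_left p).add (a0.const_mul_left q)).mul hf
  simpa only [hexp, pow_one, pow_zero, mul_one] using a2

/-- Raising the index: `(z / 2 - κ) W - z W'` solves Whittaker's equation with `κ + 1`. -/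
lemma IsWhittaker.raise {κ w b : ℝ} {W W' : ℝ → ℝ} (h : IsWhittaker κ W W' w b) :
    IsWhittaker (κ + 1) (fun z => (z / 2 - κ) * W z - z * W' z)
      (fun z => (1 / 2 - z / 4 + κ) * W z + (z / 2 - κ - 1) * W' z)
      (-κ * w) ((1 / 2 + κ) * w - (κ + 1) * b) where
  hasDerivAt z hz := by
    refine ((((((hasDerivAt_id z).div_const 2).sub_const κ).mul (h.hasDerivAt z hz)).sub
      ((hasDerivAt_id z).mul (h.hasDerivAt_deriv z hz)))).congr_deriv ?_
    simp only [id]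
    field_simp
    ring
  hasDerivAt_deriv z hz := by
    refine (((((((hasDerivAt_id z).div_const 4).const_sub (1 / 2)).add_const κ).mul
      (h.hasDerivAt z hz)).add (((((hasDerivAt_id z).div_const 2).sub_const κ).sub_const 1).mul
      (h.hasDerivAt_deriv z hz)))).congr_deriv ?_
    simp only [id]
    field_simp
    ring
  tendsto := by
    have hz := tendsto_id_nhdsGT_zero
    have h1 := ((hz.div_const 2).sub_const κ).mul h.tendsto
    have h2 := (hz.mul h.tendsto_deriv).sub (tendsto_mul_log_nhdsGT_zero.const_mul (κ * w))
    have := h1.sub h2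
    rw [show (0 / 2 - κ) * w - (0 * b - κ * w * 0) = -κ * w by ring] at this
    refine this.congr fun z => ?_
    ring
  tendsto_deriv := by
    have hz := tendsto_id_nhdsGT_zero
    have h1 := ((((hz.div_const 4).const_sub (1 / 2)).add_const κ).mul h.tendsto).add
      ((((hz.div_const 2).sub_const κ).sub_const 1).mul h.tendsto_deriv)
    have h2 := h1.sub (tendsto_mul_log_nhdsGT_zero.const_mul (κ * w / 2))
    rw [show (1 / 2 - 0 / 4 + κ) * w + (0 / 2 - κ - 1) * b - κ * w / 2 * 0
      = (1 / 2 + κ) * w - (κ + 1) * b by ring] at h2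
    refine h2.congr fun z => ?_
    ring
  decay := by
    obtain ⟨c, hc, h1, h2⟩ := h.decay
    refine ⟨c / 2, half_pos hc, ?_, ?_⟩
    · refine ((isBigO_affine_mul hc (1 / 2) (-κ) W h1).sub
        (isBigO_affine_mul hc 1 0 W' h2)).congr_left fun z => ?_
      ring
    · refine ((isBigO_affine_mul hc (-(1 / 4)) (1 / 2 + κ) W h1).add
        (isBigO_affine_mul hc (1 / 2) (-κ - 1) W' h2)).congr_left
        fun z => ?_
      ring

/-- The solution with index `0`. -/
lemma isWhittaker_zero :
    IsWhittaker 0 (fun z => Real.exp (-z / 2)) (fun z => -(1 / 2) * Real.exp (-z / 2)) 1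
      (-(1 / 2)) := by
  have hd : ∀ z : ℝ, HasDerivAt (fun z => Real.exp (-z / 2)) (-(1 / 2) * Real.exp (-z / 2)) z := by
    intro z
    refine (((hasDerivAt_id z).neg.div_const 2).exp).congr_deriv ?_
    simp only [Pi.neg_apply, id]
    ring
  have ht : Tendsto (fun z : ℝ => Real.exp (-z / 2)) (𝓝[>] 0) (𝓝 1) := by
    have : Tendsto (fun z : ℝ => Real.exp (-z / 2)) (𝓝 0) (𝓝 (Real.exp (-0 / 2))) :=
      (hd 0).continuousAt
    rw [neg_zero, zero_div, Real.exp_zero] at this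
    exact this.mono_left nhdsWithin_le_nhds
  have hO : (fun z : ℝ => Real.exp (-z / 2)) =O[atTop] fun z => Real.exp (-(1 / 2) * z) := by
    refine (Asymptotics.isBigO_refl _ _).congr_left fun z => ?_
    ring_nf
  refine ⟨fun z _ => hd z, fun z _ => ?_, ht, ?_, 1 / 2, by norm_num, hO, hO.const_mul_left _⟩
  · refine ((hd z).const_mul _).congr_deriv ?_
    ring
  · have := ht.const_mul (-(1 / 2))
    simpa using this

/-- The integral `∫₀^∞ t^j e^{-zt} t^{-κ} (1 + t)^{κ - 1} dt`; for `j = 0` it is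
`Γ(1 - κ) U(1 - κ, 1, z)` with Tricomi's function `U`, for other `j` a derivative of this up to
sign. -/
noncomputable def tricomiIntegral (κ : ℝ) (j : ℕ) (z : ℝ) : ℝ :=
  ∫ t in Ioi (0 : ℝ), t ^ j * (t ^ (-κ) * (1 + t) ^ (κ - 1)) * Real.exp (-z * t)

section Tricomi

variable {κ : ℝ}

lemma tricomi_weight_le (h1 : κ ≤ 1) {t : ℝ} (ht : 0 < t) (j : ℕ) :
    t ^ j * (t ^ (-κ) * (1 + t) ^ (κ - 1)) ≤ t ^ ((j : ℝ) - κ) := by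
  have h2 : (1 + t) ^ (κ - 1) ≤ 1 :=
    Real.rpow_le_one_of_one_le_of_nonpos (by linarith) (by linarith)
  rw [sub_eq_add_neg (j : ℝ), Real.rpow_add ht, Real.rpow_natCast]
  gcongr
  exact mul_le_of_le_one_right (Real.rpow_nonneg ht.le _) h2

lemma continuousOn_tricomi_integrand (j : ℕ) (z : ℝ) :
    ContinuousOn (fun t : ℝ => t ^ j * (t ^ (-κ) * (1 + t) ^ (κ - 1)) * Real.exp (-z * t))
      (Ioi 0) := by
  intro t (ht : 0 < t)
  have h1 : 1 + t ≠ 0 := by linarith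
  exact (((continuousAt_id.pow j).mul ((continuousAt_id.rpow_const (Or.inl ht.ne')).mul
    ((continuousAt_const.add continuousAt_id).rpow_const (Or.inl h1)))).mul
    (by fun_prop)).continuousWithinAt

lemma integrableOn_tricomi (h1 : κ < 1) (j : ℕ) {z : ℝ} (hz : 0 < z) :
    IntegrableOn (fun t : ℝ => t ^ j * (t ^ (-κ) * (1 + t) ^ (κ - 1)) * Real.exp (-z * t))
      (Ioi 0) := by
  have hj : (0 : ℝ) ≤ j := j.cast_nonneg
  refine (integrableOn_rpow_mul_exp_neg_mul (s := (j : ℝ) - κ) (by linarith) hz).mono'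
    ((continuousOn_tricomi_integrand j z).aestronglyMeasurable measurableSet_Ioi) ?_
  filter_upwards [ae_restrict_mem measurableSet_Ioi] with t (ht : 0 < t)
  rw [Real.norm_of_nonneg (by positivity)]
  gcongr
  exact tricomi_weight_le h1.le ht j

lemma hasDerivAt_tricomiIntegral (h1 : κ < 1) (j : ℕ) {z : ℝ} (hz : 0 < z) :
    HasDerivAt (tricomiIntegral κ j) (-tricomiIntegral κ (j + 1) z) z := by
  have h := (hasDerivAt_integral_of_dominated_loc_of_deriv_le (μ := volume.restrict (Ioi (0 : ℝ)))
    (F := fun z t => t ^ j * (t ^ (-κ) * (1 + t) ^ (κ - 1)) * Real.exp (-z * t))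
    (F' := fun z t => -(t ^ (j + 1) * (t ^ (-κ) * (1 + t) ^ (κ - 1)) * Real.exp (-z * t)))
    (bound := fun t => t ^ (j + 1) * (t ^ (-κ) * (1 + t) ^ (κ - 1)) * Real.exp (-(z / 2) * t))
    (x₀ := z) (s := Ioi (z / 2)) (Ioi_mem_nhds (by linarith))
    (Eventually.of_forall fun z =>
      (continuousOn_tricomi_integrand j z).aestronglyMeasurable measurableSet_Ioi)
    (integrableOn_tricomi h1 j hz)
    ((continuousOn_tricomi_integrand (j + 1) z).neg.aestronglyMeasurable measurableSet_Ioi) ?_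
    (integrableOn_tricomi h1 (j + 1) (half_pos hz)) ?_).2
  · rw [integral_neg] at h
    exact h
  · filter_upwards [ae_restrict_mem measurableSet_Ioi] with t (ht : 0 < t) y (hy : z / 2 < y)
    rw [norm_neg, Real.norm_of_nonneg (by positivity)]
    have : -y * t ≤ -(z / 2) * t := by nlinarith
    gcongr
  · filter_upwards with t y _
    refine ((((hasDerivAt_id y).neg.mul_const t).exp).const_mul _).congr_deriv ?_
    simp only [Pi.neg_apply, id]
    ring

lemma tricomiIntegral_nonneg (j : ℕ) (z : ℝ) : 0 ≤ tricomiIntegral κ j z :=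
  setIntegral_nonneg measurableSet_Ioi fun t (ht : 0 < t) => by positivity

lemma tricomiIntegral_le (h1 : κ < 1) (j : ℕ) {z : ℝ} (hz : 1 ≤ z) :
    tricomiIntegral κ j z ≤ tricomiIntegral κ j 1 := by
  refine setIntegral_mono_on (integrableOn_tricomi h1 j (by linarith))
    (integrableOn_tricomi h1 j one_pos) measurableSet_Ioi fun t (ht : 0 < t) => ?_
  have : -z * t ≤ -1 * t := by nlinarith
  gcongr

/-- The confluent hypergeometric equation, from the integral of the derivative of
`e^{-zt} t^{1 - κ} (1 + t)^κ`. -/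
lemma tricomiIntegral_relation (h0 : 0 < κ) (h1 : κ < 1) {z : ℝ} (hz : 0 < z) :
    z * tricomiIntegral κ 2 z + z * tricomiIntegral κ 1 z
      = (1 - κ) * tricomiIntegral κ 0 z + tricomiIntegral κ 1 z := by
  have i0 := integrableOn_tricomi h1 0 hz
  have i1 := integrableOn_tricomi h1 1 hz
  have i2 := integrableOn_tricomi h1 2 hz
  have hi := ((i0.const_mul (1 - κ)).add i1).sub ((i2.const_mul z).add (i1.const_mul z))
  have h := integral_Ioi_of_hasDerivAt_of_tendsto (a := (0 : ℝ)) (m := (0 : ℝ))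
    (f := fun t : ℝ => t ^ (1 - κ) * (1 + t) ^ κ * Real.exp (-z * t)) ?_ (fun t ht => ?_) hi ?_
  · have e := integral_sub ((i0.const_mul (1 - κ)).add i1) ((i2.const_mul z).add (i1.const_mul z))
    have e1 := integral_add (i0.const_mul (1 - κ)) i1
    have e2 := integral_add (i2.const_mul z) (i1.const_mul z)
    simp only [integral_const_mul] at e1 e2
    simp only [Pi.sub_apply] at h e
    rw [e] at h
    simp only [Pi.add_apply] at h e1 e2
    rw [e1, e2, Real.zero_rpow (by linarith)] at h
    simp only [tricomiIntegral]
    linarith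
  · refine ContinuousAt.continuousWithinAt ?_
    exact ((continuousAt_id.rpow_const (Or.inr (by linarith))).mul
      ((continuousAt_const.add continuousAt_id).rpow_const (Or.inl (by simp)))).mul
      (by fun_prop)
  · have ht0 : (0 : ℝ) < t := ht
    have h1t : 1 + t ≠ 0 := by linarith
    refine ((((hasDerivAt_id t).rpow_const (p := 1 - κ) (Or.inl ht0.ne')).mul
      (((hasDerivAt_id t).const_add 1).rpow_const (p := κ) (Or.inl h1t))).mul
      (((hasDerivAt_id t).const_mul (-z)).exp)).congr_deriv ?_
    have e1 : t ^ (1 - κ) = t * t ^ (-κ) := by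
      rw [sub_eq_add_neg, Real.rpow_add ht0, Real.rpow_one]
    have e2 : (1 + t) ^ κ = (1 + t) * (1 + t) ^ (κ - 1) := by
      rw [Real.rpow_sub_one h1t]
      field_simp
    have e3 : t ^ (1 - κ - 1) = t ^ (-κ) := by
      congr 1
      ring
    simp only [id, Pi.sub_apply, Pi.add_apply, Pi.mul_apply]
    rw [e1, e2, e3]
    ring
  · have t1 := tendsto_rpow_mul_exp_neg_mul_atTop_nhds_zero (1 - κ) z hz
    have t2 := tendsto_rpow_mul_exp_neg_mul_atTop_nhds_zero (2 - κ) z hz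
    have t3 := t1.add t2
    rw [add_zero] at t3
    refine squeeze_zero' ?_ ?_ t3
    · filter_upwards [eventually_gt_atTop 0] with t ht
      positivity
    · filter_upwards [eventually_gt_atTop 0] with t ht
      have hb : (1 + t) ^ κ ≤ 1 + t := by
        simpa using Real.rpow_le_rpow_of_exponent_le (by linarith : 1 ≤ 1 + t) h1.le
      have e : t ^ (2 - κ) = t ^ (1 - κ) * t := by
        rw [← Real.rpow_add_one ht.ne']
        congr 1
        ring
      rw [e]
      calc t ^ (1 - κ) * (1 + t) ^ κ * Real.exp (-z * t)
          ≤ t ^ (1 - κ) * (1 + t) * Real.exp (-z * t) := by gcongr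
        _ = _ := by ring

/-- The weight falls short of `1 / (1 + t)` by the integrand in Gauss' formula for the digamma
function at `1 - κ`. -/
lemma tricomi_weight_eq {t : ℝ} (ht : 0 < t) : t ^ (-κ) * (1 + t) ^ (κ - 1)
    = 1 / (1 + t) - (1 - (t / (1 + t)) ^ (1 - κ - 1)) / (1 + t) := by
  have h1 : 0 < 1 + t := by linarith
  rw [show 1 - κ - 1 = -κ by ring, Real.div_rpow ht.le h1.le, Real.rpow_sub_one h1.ne',
    Real.rpow_neg h1.le]
  field_simp
  ring

lemma tricomiIntegral_zero_eq (h1 : κ < 1) {z : ℝ} (hz : 0 < z) : tricomiIntegral κ 0 z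
    = (∫ t in Ioi (0 : ℝ), Real.exp (-z * t) / (1 + t))
      - ∫ t in Ioi (0 : ℝ), Real.exp (-z * t) * ((1 - (t / (1 + t)) ^ (1 - κ - 1)) / (1 + t)) := by
  have i1 : IntegrableOn (fun t : ℝ => Real.exp (-z * t) / (1 + t)) (Ioi 0) := by
    refine (integrableOn_exp_mul_Ioi (neg_neg_of_pos hz) 0).mono' ?_ ?_
    · exact (Measurable.div (by fun_prop) (by fun_prop)).aestronglyMeasurable
    · filter_upwards [ae_restrict_mem measurableSet_Ioi] with t (ht : 0 < t)
      rw [Real.norm_of_nonneg (by positivity)]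
      exact div_le_self (Real.exp_pos _).le (by linarith)
  have i2 : IntegrableOn (fun t : ℝ => Real.exp (-z * t) *
      ((1 - (t / (1 + t)) ^ (1 - κ - 1)) / (1 + t))) (Ioi 0) := by
    refine Integrable.bdd_mul (c := 1) (integrableOn_gauss (by linarith))
      (by fun_prop : Measurable fun t : ℝ => Real.exp (-z * t)).aestronglyMeasurable ?_
    filter_upwards [ae_restrict_mem measurableSet_Ioi] with t (ht : 0 < t)
    rw [Real.norm_of_nonneg (Real.exp_pos _).le, Real.exp_le_one_iff]
    nlinarith
  rw [tricomiIntegral, ← integral_sub i1 i2]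
  refine setIntegral_congr_fun measurableSet_Ioi fun t ht => ?_
  simp only [pow_zero, one_mul]
  rw [tricomi_weight_eq ht]
  ring

/-- The logarithmic singularity of Tricomi's function. -/
lemma tendsto_tricomiIntegral_add_log (h1 : κ < 1) :
    Tendsto (fun z => tricomiIntegral κ 0 z + Real.log z) (𝓝[>] 0)
      (𝓝 (-logDeriv Real.Gamma (1 - κ) - 2 * Real.eulerMascheroniConstant)) := by
  have hg := integrableOn_gauss (x := 1 - κ) (by linarith)
  have hlim : Tendsto (fun z => ∫ t in Ioi (0 : ℝ),
      Real.exp (-z * t) * ((1 - (t / (1 + t)) ^ (1 - κ - 1)) / (1 + t))) (𝓝[>] 0)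
      (𝓝 (∫ t in Ioi (0 : ℝ), (1 - (t / (1 + t)) ^ (1 - κ - 1)) / (1 + t))) := by
    refine tendsto_integral_filter_of_dominated_convergence _ ?_ ?_ hg.norm ?_
    · exact Eventually.of_forall fun z => (by fun_prop : Measurable fun t : ℝ =>
        Real.exp (-z * t)).aestronglyMeasurable.mul hg.1
    · filter_upwards [self_mem_nhdsWithin] with z (hz : 0 < z)
      filter_upwards [ae_restrict_mem measurableSet_Ioi] with t (ht : 0 < t)
      rw [norm_mul, Real.norm_of_nonneg (Real.exp_pos _).le]
      refine mul_le_of_le_one_left (norm_nonneg _) (Real.exp_le_one_iff.2 ?_)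
      nlinarith
    · filter_upwards with t
      have hc : Continuous (fun z : ℝ => Real.exp (-z * t) *
        ((1 - (t / (1 + t)) ^ (1 - κ - 1)) / (1 + t))) := by fun_prop
      have := (hc.tendsto 0).mono_left (nhdsWithin_le_nhds (s := Ioi 0))
      simpa using this
  rw [integral_gauss (by linarith)] at hlim
  have := tendsto_integral_exp_div_one_add_add_log.sub hlim
  rw [show -Real.eulerMascheroniConstant - (logDeriv Real.Gamma (1 - κ)
    + Real.eulerMascheroniConstant) = -logDeriv Real.Gamma (1 - κ)
      - 2 * Real.eulerMascheroniConstant by ring] at this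
  refine this.congr' ?_
  filter_upwards [self_mem_nhdsWithin] with z hz
  rw [tricomiIntegral_zero_eq h1 hz]
  ring

/-- The weights of the two integrals add up to `1` minus `1 + t` times the integrand of Gauss'
formula. The factor `z (1 + t) e^{-zt}` is bounded and tends to `0`, and `∫₀^∞ z e^{-zt} dt = 1`. -/
lemma tendsto_mul_tricomiIntegral (h1 : κ < 1) :
    Tendsto (fun z => z * (tricomiIntegral κ 0 z + tricomiIntegral κ 1 z)) (𝓝[>] 0) (𝓝 1) := by
  have hg := integrableOn_gauss (x := 1 - κ) (by linarith)
  have hlim : Tendsto (fun z => ∫ t in Ioi (0 : ℝ),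
      z * (1 + t) * Real.exp (-z * t) * ((1 - (t / (1 + t)) ^ (1 - κ - 1)) / (1 + t))) (𝓝[>] 0)
      (𝓝 (∫ t in Ioi (0 : ℝ), 0)) := by
    refine tendsto_integral_filter_of_dominated_convergence _ ?_ ?_ (hg.norm.const_mul 2) ?_
    · exact Eventually.of_forall fun z => (by fun_prop : Measurable fun t : ℝ =>
        z * (1 + t) * Real.exp (-z * t)).aestronglyMeasurable.mul hg.1
    · filter_upwards [Ioo_mem_nhdsGT (zero_lt_one (α := ℝ))] with z hz
      filter_upwards [ae_restrict_mem measurableSet_Ioi] with t (ht : 0 < t)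
      have hz0 := hz.1
      rw [norm_mul, Real.norm_of_nonneg (by positivity)]
      refine mul_le_mul_of_nonneg_right ?_ (norm_nonneg _)
      have a1 : z * t + 1 ≤ Real.exp (z * t) := Real.add_one_le_exp _
      have a2 : Real.exp (z * t) * Real.exp (-z * t) = 1 := by
        rw [← Real.exp_add]
        simp
      have a3 := Real.exp_pos (-z * t)
      have a4 : (z * t + 1) * Real.exp (-z * t) ≤ 1 :=
        (mul_le_mul_of_nonneg_right a1 a3.le).trans a2.le
      have a5 : z * (1 + t) ≤ z * t + 1 := by linarith [hz.2]
      calc z * (1 + t) * Real.exp (-z * t) ≤ (z * t + 1) * Real.exp (-z * t) := by gcongr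
        _ ≤ 2 := by linarith
    · filter_upwards with t
      have hc : Continuous (fun z : ℝ => z * (1 + t) * Real.exp (-z * t) *
        ((1 - (t / (1 + t)) ^ (1 - κ - 1)) / (1 + t))) := by fun_prop
      have := (hc.tendsto 0).mono_left (nhdsWithin_le_nhds (s := Ioi 0))
      simpa using this
  rw [integral_zero] at hlim
  have h := hlim.const_sub 1
  rw [sub_zero] at h
  refine h.congr' ?_
  filter_upwards [self_mem_nhdsWithin] with z (hz : 0 < z)
  have i0 := integrableOn_tricomi h1 0 hz
  have i1 := integrableOn_tricomi h1 1 hz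
  have hexp : ∫ t in Ioi (0 : ℝ), z * Real.exp (-z * t) = 1 := by
    rw [integral_const_mul, integral_exp_mul_Ioi (neg_neg_of_pos hz)]
    simp
    field_simp
  have i2 : IntegrableOn (fun t : ℝ => z * Real.exp (-z * t)) (Ioi 0) :=
    (integrableOn_exp_mul_Ioi (neg_neg_of_pos hz) 0).const_mul z
  have e := integral_sub i2 ((i0.add i1).const_mul z)
  rw [hexp, integral_const_mul] at e
  have e1 := integral_add i0 i1
  simp only [Pi.add_apply] at e
  have e2 : ∫ t in Ioi (0 : ℝ), z * (1 + t) * Real.exp (-z * t) *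
      ((1 - (t / (1 + t)) ^ (1 - κ - 1)) / (1 + t))
      = 1 - z * (tricomiIntegral κ 0 z + tricomiIntegral κ 1 z) := by
    rw [tricomiIntegral, tricomiIntegral, ← e1, ← e]
    refine setIntegral_congr_fun measurableSet_Ioi fun t (ht : 0 < t) => ?_
    simp only [pow_zero, pow_one]
    rw [tricomi_weight_eq ht]
    field_simp
    ring
  rw [e2, sub_sub_cancel]

end Tricomi

/-! ### The decaying solution for every positive index -/

lemma tendsto_one_sub_exp_mul_log :
    Tendsto (fun z : ℝ => (1 - Real.exp (-z / 2)) * Real.log z) (𝓝[>] 0) (𝓝 0) := by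
  have hd : HasDerivAt (fun z : ℝ => 1 - Real.exp (-z / 2)) (1 / 2) 0 := by
    refine (((hasDerivAt_id (0 : ℝ)).neg.div_const 2).exp.const_sub 1).congr_deriv ?_
    norm_num
  have h1 := ((hasDerivAt_iff_tendsto_slope.1 hd).mono_left
    (nhdsWithin_mono _ fun z (hz : 0 < z) => hz.ne')).mul tendsto_mul_log_nhdsGT_zero
  rw [mul_zero] at h1
  refine h1.congr' ?_
  filter_upwards [self_mem_nhdsWithin] with z (hz : 0 < z)
  rw [slope_def_field]
  simp only [neg_zero, zero_div, Real.exp_zero, sub_self, sub_zero]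
  field_simp

/-- For `0 < κ < 1` the decaying solution is given by Laplace integrals. -/
lemma isWhittaker_tricomi {κ : ℝ} (h0 : 0 < κ) (h1 : κ < 1) :
    IsWhittaker κ
      (fun z => Real.exp (-z / 2) * (z * (tricomiIntegral κ 0 z + tricomiIntegral κ 1 z)))
      (fun z => Real.exp (-z / 2) * (κ * tricomiIntegral κ 0 z
        - z * (tricomiIntegral κ 0 z + tricomiIntegral κ 1 z) / 2)) 1
      (-(1 / 2) - κ * (logDeriv Real.Gamma (1 - κ) + 2 * Real.eulerMascheroniConstant)) := by
  -- With `K j` for the integrals and `G = z (K 0 + K 1)`, the hypergeometric equation reads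
  -- `G' = κ K 0`; the solution is `e^{-z/2} G`.
  have hG : ∀ z : ℝ, 0 < z →
      HasDerivAt (fun z => z * (tricomiIntegral κ 0 z + tricomiIntegral κ 1 z))
        (κ * tricomiIntegral κ 0 z) z := by
    intro z hz
    have hr := tricomiIntegral_relation h0 h1 hz
    refine ((hasDerivAt_id z).mul ((hasDerivAt_tricomiIntegral h1 0 hz).add
      (hasDerivAt_tricomiIntegral h1 1 hz))).congr_deriv ?_
    simp only [id, Pi.add_apply]
    linarith
  have hbd : ∀ j, (fun z => Real.exp (-z / 2) * tricomiIntegral κ j z) =O[atTop]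
      fun z => Real.exp (-(1 / 2) * z) := by
    intro j
    refine Asymptotics.IsBigO.of_bound (tricomiIntegral κ j 1) ?_
    filter_upwards [eventually_ge_atTop 1] with z hz
    rw [norm_mul, mul_comm, Real.norm_of_nonneg (tricomiIntegral_nonneg j z),
      show -(1 / 2) * z = -z / 2 by ring]
    gcongr
    exact tricomiIntegral_le h1 j hz
  have hhalf : (0 : ℝ) < 1 / 2 := by norm_num
  refine ⟨fun z hz => ?_, fun z hz => ?_, ?_, ?_, 1 / 2 / 2, by norm_num, ?_, ?_⟩
  · refine ((isWhittaker_zero.hasDerivAt z hz).mul (hG z hz)).congr_deriv ?_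
    ring
  · refine ((isWhittaker_zero.hasDerivAt z hz).mul (((hasDerivAt_tricomiIntegral h1 0
      hz).const_mul κ).sub ((hG z hz).div_const 2))).congr_deriv ?_
    simp only [Pi.sub_apply]
    field_simp
    ring
  · simpa using isWhittaker_zero.tendsto.mul (tendsto_mul_tricomiIntegral h1)
  · have := (isWhittaker_zero.tendsto.mul
      (((tendsto_tricomiIntegral_add_log h1).const_mul κ).sub
      ((tendsto_mul_tricomiIntegral h1).div_const 2))).add
      (tendsto_one_sub_exp_mul_log.const_mul κ)
    convert! this using 2
    · ring
    · ring
  · refine (isBigO_affine_mul hhalf 1 0 _ ((hbd 0).add (hbd 1))).congr_left fun z => ?_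
    ring
  · refine ((isBigO_affine_mul hhalf 0 κ _ (hbd 0)).sub
      (isBigO_affine_mul hhalf (1 / 2) 0 _ ((hbd 0).add (hbd 1)))).congr_left fun z => ?_
    ring

/-- If the index is not an integer, the decaying solution does not vanish at the origin, and its
regularised derivative there involves the digamma function. -/
lemma exists_isWhittaker_of_ne_natCast {κ : ℝ} (h0 : 0 < κ) (hn : ∀ n : ℕ, κ ≠ n) :
    ∃ W W' w b, IsWhittaker κ W W' w b ∧ w ≠ 0 ∧ b = w * (-(1 / 2) -
      κ * (logDeriv Real.Gamma (1 - κ) + 2 * Real.eulerMascheroniConstant)) := by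
  obtain ⟨m, hm⟩ : ∃ m : ℕ, (m : ℝ) ≤ κ ∧ κ < m + 1 :=
    ⟨⌊κ⌋₊, Nat.floor_le h0.le, Nat.lt_floor_add_one κ⟩
  induction m generalizing κ with
  | zero =>
    exact ⟨_, _, _, _, isWhittaker_tricomi h0 (by simpa using hm.2), one_ne_zero,
      (one_mul _).symm⟩
  | succ m ih =>
    push_cast at hm
    have hm0 : (0 : ℝ) ≤ m := m.cast_nonneg
    have hne : ∀ n : ℕ, κ - 1 ≠ n := fun n h => hn (n + 1) (by push_cast; linarith)
    have hpos : 0 < κ - 1 :=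
      lt_of_le_of_ne (by linarith [hm.1]) fun h => hne 0 (by simpa using h.symm)
    obtain ⟨W, W', w, b, h, hw, hb⟩ := ih hpos hne ⟨by linarith [hm.1], by linarith [hm.2]⟩
    -- The raised data match because `ψ(1 - (κ - 1)) = ψ(1 - κ) + 1 / (1 - κ)`.
    have hr := h.raise
    rw [sub_add_cancel] at hr
    refine ⟨_, _, _, _, hr, mul_ne_zero (neg_ne_zero.2 hpos.ne') hw, ?_⟩
    have hd := logDeriv_Gamma_add_one (x := 1 - κ) fun n hx => hne n (by linarith)
    rw [show 1 - κ + 1 = 1 - (κ - 1) by ring] at hd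
    rw [hb, hd]
    have h2 : 1 - κ ≠ 0 := by linarith
    field_simp
    ring

/-- If the index is a positive integer, the decaying solution vanishes at the origin. -/
lemma exists_isWhittaker_natCast {N : ℕ} (hN : 1 ≤ N) :
    ∃ W W' b, IsWhittaker N W W' 0 b ∧ b ≠ 0 := by
  induction N, hN using Nat.le_induction with
  | base =>
    have h := isWhittaker_zero.raise
    norm_num at h
    exact ⟨_, _, _, by simpa using h, one_ne_zero⟩
  | succ n hn ih =>
    obtain ⟨W, W', b, h, hb⟩ := ih
    have hr := h.raise
    rw [mul_zero, mul_zero, zero_sub] at hr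
    refine ⟨_, _, _, by exact_mod_cast hr, neg_ne_zero.2 (mul_ne_zero ?_ hb)⟩
    positivity

/-! ### Extension of Whittaker functions to eigenfunctions -/

lemma integrableOn_sq_of_isBigO {g : ℝ → ℝ} (hg : ContinuousOn g (Ioi 0)) {c : ℝ} (hc : 0 < c)
    (htop : g =O[atTop] fun z => Real.exp (-c * z))
    (hbot : g =O[𝓝[>] 0] fun z => z ^ (-(1 / 4) : ℝ)) :
    IntegrableOn (fun z => g z ^ 2) (Ioi 0) := by
  have h := mellinConvergent_of_isBigO_rpow_exp (a := c + c) (b := 1 / 2) (by linarith)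
    (f := fun z => ((g z ^ 2 : ℝ) : ℂ)) (s := 1)
    ((Complex.continuous_ofReal.comp_continuousOn (hg.pow 2)).locallyIntegrableOn
      measurableSet_Ioi)
    (Complex.isBigO_ofReal_left.2 ?_) (Complex.isBigO_ofReal_left.2 ?_) (by norm_num)
  · simp only [MellinConvergent, sub_self, Complex.cpow_zero, one_smul] at h
    exact h.re
  · refine (htop.mul htop).congr (fun z => (sq _).symm) fun z => ?_
    rw [← Real.exp_add]
    ring_nf
  · refine (hbot.mul hbot).congr' (Eventually.of_forall fun z => (sq _).symm) ?_
    filter_upwards [self_mem_nhdsWithin] with z (hz : 0 < z)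
    rw [← Real.rpow_add hz]
    norm_num

lemma isBigO_one_rpow_nhdsGT_zero :
    (fun _ : ℝ => (1 : ℝ)) =O[𝓝[>] 0] fun z => z ^ (-(1 / 4) : ℝ) := by
  refine Asymptotics.IsBigO.of_bound 1 ?_
  filter_upwards [Ioo_mem_nhdsGT (zero_lt_one (α := ℝ))] with z hz
  have h := Real.one_le_rpow_of_pos_of_le_one_of_nonpos (z := -(1 / 4)) hz.1 hz.2.le (by norm_num)
  rw [norm_one, one_mul, Real.norm_of_nonneg (by linarith)]
  exact h

lemma memLp_two_of_norm_comp_neg {f : ℝ → ℂ} (hm : AEStronglyMeasurable f volume)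
    (he : ∀ x, ‖f (-x)‖ = ‖f x‖) (hi : IntegrableOn (fun x => ‖f x‖ ^ 2) (Ioi 0)) :
    MemLp f 2 volume := by
  rw [memLp_two_iff_integrable_sq_norm hm, ← integrableOn_univ, ← Iic_union_Ioi (a := (0 : ℝ))]
  refine IntegrableOn.union ?_ hi
  rw [integrableOn_Iic_iff_integrableOn_Iio]
  have : IntegrableOn (fun x => ‖f x‖ ^ 2) (Ioi (-0)) := by rwa [neg_zero]
  simpa only [he] using this.comp_neg_Iio

lemma IsCoulombSolution.const_mul {E : ℝ} {u : ℝ → ℂ} (h : IsCoulombSolution E u) (c : ℂ) :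
    IsCoulombSolution E (fun x => c * u x) :=
  IsCoulombSolution.of_hasDerivAt (fun x hx => (h x hx).1.const_mul c) fun x hx =>
    ((h x hx).2.const_mul c).congr_deriv (by ring)

namespace IsWhittaker

variable {κ w b : ℝ} {W W' : ℝ → ℝ}

lemma integrableOn_sq (h : IsWhittaker κ W W' w b) : IntegrableOn (fun z => W z ^ 2) (Ioi 0) := by
  obtain ⟨c, hc, h1, -⟩ := h.decay
  refine integrableOn_sq_of_isBigO (fun z hz => (h.hasDerivAt z hz).continuousAt.continuousWithinAt)
    hc h1 ?_
  exact (h.tendsto.isBigO_one ℝ).trans isBigO_one_rpow_nhdsGT_zero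

lemma integrableOn_deriv_sq (h : IsWhittaker κ W W' w b) :
    IntegrableOn (fun z => W' z ^ 2) (Ioi 0) := by
  obtain ⟨c, hc, -, h1⟩ := h.decay
  refine integrableOn_sq_of_isBigO
    (fun z hz => (h.hasDerivAt_deriv z hz).continuousAt.continuousWithinAt) hc h1 ?_
  have h2 := ((h.tendsto_deriv.isBigO_one ℝ).trans isBigO_one_rpow_nhdsGT_zero).sub
    ((isLittleO_log_rpow_nhdsGT_zero (r := -(1 / 4)) (by norm_num)).isBigO.const_mul_left (κ * w))
  simpa using h2

/-- The extension `x ↦ W(2x/κ)` of a decaying solution of Whittaker's equation to a function on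
`ℝ` with parity `σ = ±1`. It belongs to `H¹(ℝ)` and solves the Coulomb equation with energy
`-1/(2κ²)`. -/
lemma exists_extension (h : IsWhittaker κ W W' w b) (hκ : 0 < κ) {σ : ℂ}
    (hσ : σ = 1 ∨ σ = -1 ∧ w = 0) :
    ∃ u : ℝ → ℂ, MemH1 u ∧ (∀ x, u (-x) = σ * u x) ∧ u 0 = w ∧
      IsCoulombSolution (-1 / (2 * κ ^ 2)) u ∧
      HasSlope u ((2 / κ * b + 2 * w * Real.log κ : ℝ) : ℂ) := by
  have hσσ : σ * σ = 1 := by rcases hσ with h | h <;> simp [h]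
  have hσw : σ * w = w := by rcases hσ with h | h <;> simp [h]
  have hσn : ‖σ‖ = 1 := by rcases hσ with h | h <;> simp [h]
  set a : ℝ := 2 / κ with ha
  have ha0 : 0 < a := by positivity
  let u : ℝ → ℂ := fun x =>
    if x = 0 then (w : ℂ) else if 0 < x then (W (a * x) : ℂ) else σ * (W (a * -x) : ℂ)
  have hu0 : u 0 = w := if_pos rfl
  have hup : ∀ x, 0 < x → u x = W (a * x) := fun x hx => by
    simp only [u, hx.ne', hx, if_true, if_false]
  have hpar : ∀ x, u (-x) = σ * u x := by
    intro x
    rcases lt_trichotomy x 0 with hx | rfl | hx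
    · simp only [u, neg_eq_zero, hx.ne, if_false, neg_pos, hx, if_true, hx.not_gt]
      rw [← mul_assoc, hσσ, one_mul]
    · rw [neg_zero, hu0, hσw]
    · simp only [u, neg_eq_zero, hx.ne', if_false, neg_pos, hx, if_true, hx.not_gt, neg_neg]
  -- The scaling `z = 2x/κ` turns Whittaker's equation into the Coulomb equation.
  have hlin : ∀ x : ℝ, HasDerivAt (fun x => a * x) a x := fun x => by
    simpa using (hasDerivAt_id x).const_mul a
  have hdp : ∀ x, 0 < x → HasDerivAt u ((a * W' (a * x) : ℝ) : ℂ) x := by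
    intro x hx
    have h1 := ((h.hasDerivAt (a * x) (by positivity)).comp x (hlin x)).ofReal_comp
    rw [mul_comm] at h1
    refine h1.congr_of_eventuallyEq ?_
    filter_upwards [Ioi_mem_nhds hx] with y hy using hup y hy
  have hdn : ∀ x, DifferentiableAt ℝ u x → HasDerivAt u (-σ * deriv u x) (-x) := by
    intro x hx
    have h1 : HasDerivAt u (deriv u x) (- -x) := by simpa using hx.hasDerivAt
    have h2 := (h1.scomp (-x) (hasDerivAt_neg (-x))).const_mul σ
    have e : (fun y => σ * (u ∘ Neg.neg) y) = u := by
      funext y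
      rw [Function.comp_apply, hpar, ← mul_assoc, hσσ, one_mul]
    rw [e] at h2
    refine h2.congr_deriv ?_
    rw [neg_one_smul]
    ring
  have hdiff : ∀ x, x ≠ 0 → DifferentiableAt ℝ u x := by
    intro x hx
    rcases hx.lt_or_gt with hx | hx
    · have := (hdn (-x) (hdp _ (by linarith)).differentiableAt).differentiableAt
      rwa [neg_neg] at this
    · exact (hdp x hx).differentiableAt
  have hsol : IsCoulombSolution (-1 / (2 * κ ^ 2)) u := by
    refine IsCoulombSolution.of_hasDerivAt hdp fun x hx => ?_
    have h1 := (((h.hasDerivAt_deriv (a * x) (by positivity)).comp x (hlin x)).const_mul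
      a).ofReal_comp
    refine h1.congr_deriv ?_
    rw [hup x hx, ha]
    push_cast
    have : (κ : ℂ) ≠ 0 := by exact_mod_cast hκ.ne'
    have : (x : ℂ) ≠ 0 := by exact_mod_cast hx.ne'
    field_simp
    ring
  have ht : Tendsto (fun x => a * x) (𝓝[>] 0) (𝓝[>] 0) := by
    refine tendsto_nhdsWithin_iff.2 ⟨?_, ?_⟩
    · have := tendsto_id_nhdsGT_zero.const_mul a
      rwa [mul_zero] at this
    · filter_upwards [self_mem_nhdsWithin] with x (hx : 0 < x)
      exact mul_pos ha0 hx
  have hright : Tendsto u (𝓝[>] 0) (𝓝 w) := by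
    refine ((Complex.continuous_ofReal.tendsto w).comp (h.tendsto.comp ht)).congr' ?_
    filter_upwards [self_mem_nhdsWithin] with x (hx : 0 < x) using (hup x hx).symm
  have hleft : Tendsto u (𝓝[<] 0) (𝓝 w) := by
    have h1 : Tendsto (fun x : ℝ => -x) (𝓝[<] 0) (𝓝[>] 0) := by
      simpa using tendsto_neg_nhdsLT (a := (0 : ℝ))
    have h2 := (hright.comp h1).const_mul σ
    rw [hσw] at h2
    refine h2.congr fun x => ?_
    rw [Function.comp_apply, hpar, ← mul_assoc, hσσ, one_mul]
  have hcont : Continuous u := by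
    refine continuous_iff_continuousAt.2 fun x => ?_
    rcases eq_or_ne x 0 with rfl | hx
    · refine continuousAt_iff_continuous_left'_right'.2 ⟨?_, ?_⟩
      · rw [ContinuousWithinAt, hu0]
        exact hleft
      · rw [ContinuousWithinAt, hu0]
        exact hright
    · exact (hdiff x hx).continuousAt
  have hnd : ∀ x, ‖deriv u (-x)‖ = ‖deriv u x‖ := by
    intro x
    rcases eq_or_ne x 0 with rfl | hx
    · rw [neg_zero]
    · rw [(hdn x (hdiff x hx)).deriv, norm_mul, norm_neg, hσn, one_mul]
  refine ⟨u, ?_, hpar, hu0, hsol, ?_⟩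
  · refine MemH1.of_hasDerivAt hcont (fun x hx => (hdiff x hx).hasDerivAt) ?_ ?_
    · refine memLp_two_of_norm_comp_neg hcont.aestronglyMeasurable
        (fun x => by rw [hpar, norm_mul, hσn, one_mul]) ?_
      refine IntegrableOn.congr_fun ((integrableOn_Ioi_comp_mul_left_iff (fun z => W z ^ 2) 0
        ha0).2 (by rw [mul_zero]; exact h.integrableOn_sq)) (fun x hx => ?_) measurableSet_Ioi
      rw [hup x hx, Complex.norm_real, Real.norm_eq_abs, sq_abs]
    · refine memLp_two_of_norm_comp_neg (measurable_deriv u).aestronglyMeasurable hnd ?_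
      refine IntegrableOn.congr_fun (((integrableOn_Ioi_comp_mul_left_iff (fun z => W' z ^ 2) 0
        ha0).2 (by rw [mul_zero]; exact h.integrableOn_deriv_sq)).const_mul (a ^ 2))
        (fun x hx => ?_) measurableSet_Ioi
      rw [(hdp x hx).deriv, Complex.norm_real, Real.norm_eq_abs, sq_abs, mul_pow]
  -- The slope is `(2/κ) (b + κ w ln κ)`, where `ln κ = ln(2x) - ln z` comes from the scaling.
  · have h1 := ((h.tendsto_deriv.comp ht).const_mul a).add_const (2 * w * Real.log κ)
    refine ((Complex.continuous_ofReal.tendsto _).comp h1).congr' ?_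
    filter_upwards [self_mem_nhdsWithin] with x (hx : 0 < x)
    have hl : Real.log (a * x) = Real.log (2 * x) - Real.log κ := by
      rw [← Real.log_div (by positivity) hκ.ne', ha]
      ring_nf
    simp only [Function.comp_apply]
    rw [(hdp x hx).deriv, hu0, hl, ha]
    push_cast
    have : (κ : ℂ) ≠ 0 := by exact_mod_cast hκ.ne'
    field_simp
    ring

end IsWhittaker

/-- For positive integers `N` the odd extension is an eigenfunction for every `r`, since functions
vanishing at the origin are not affected by the term with `ln r`. -/
lemma exists_odd_isWeakEigenfunction {N : ℕ} (hN : 1 ≤ N) :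
    ∃ u : ℝ → ℂ, MemH1 u ∧ (∀ x, u (-x) = -u x) ∧ (u ≠ fun _ => 0) ∧
      ∀ r, IsWeakEigenfunction r (-1 / (2 * (N : ℝ) ^ 2)) u := by
  obtain ⟨W, W', b, h, hb⟩ := exists_isWhittaker_natCast hN
  have hN0 : (0 : ℝ) < N := by exact_mod_cast hN
  obtain ⟨u, hu, hp, hu0, hsol, hs⟩ := h.exists_extension hN0 (σ := -1) (Or.inr ⟨rfl, rfl⟩)
  have hp' : (fun x => u (-x)) = fun x => -1 * u x := funext hp
  refine ⟨u, hu, fun x => by rw [hp, neg_one_mul], ?_, fun r => ?_⟩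
  · rintro rfl
    have h0 : HasSlope (fun _ => 0) 0 := by simp [HasSlope]
    have := tendsto_nhds_unique hs h0
    simp only [mul_zero, zero_mul, add_zero, Complex.ofReal_eq_zero, mul_eq_zero, hb, or_false,
      div_eq_zero_iff, hN0.ne'] at this
    norm_num at this
  · have ht : HasSlope (fun x => u (-x))
        (-1 * ((2 / (N : ℝ) * b + 2 * 0 * Real.log N : ℝ) : ℂ)) := by
      rw [hp']
      refine (hs.const_mul (-1)).congr' ?_
      filter_upwards [self_mem_nhdsWithin] with x (hx : 0 < x)
      rw [((hsol x hx).1.const_mul (-1)).deriv]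
      ring
    refine (isWeakEigenfunction_iff hu hs ht).2 ⟨hsol, hp' ▸ hsol.const_mul (-1), ?_⟩
    rw [hu0]
    simp

/-- If `α > 0` is not an integer, the even extension satisfies the matching condition at the
origin if and only if `α` is a root of the quantisation condition. -/
lemma exists_even_isWeakEigenfunction_iff {α : ℝ} (hα : 0 < α) (hn : ∀ n : ℕ, α ≠ n) :
    ∃ u : ℝ → ℂ, MemH1 u ∧ (∀ x, u (-x) = u x) ∧ u 0 ≠ 0 ∧
      IsCoulombSolution (-1 / (2 * α ^ 2)) u ∧
      ∀ r, IsWeakEigenfunction r (-1 / (2 * α ^ 2)) u ↔ quantF α r = 0 := by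
  obtain ⟨W, W', w, b, h, hw, hb⟩ := exists_isWhittaker_of_ne_natCast hα hn
  obtain ⟨u, hu, hp, hu0, hsol, hs⟩ := h.exists_extension hα (σ := 1) (Or.inl rfl)
  simp only [one_mul] at hp
  have hp' : (fun x => u (-x)) = u := funext hp
  refine ⟨u, hu, hp, by simpa [hu0] using hw, hsol, fun r => ?_⟩
  rw [isWeakEigenfunction_iff hu hs (by rw [hp']; exact hs), hp', hu0]
  simp only [hsol, true_and]
  norm_cast
  -- Both one-sided slopes equal `(2/α) b + 2 w ln α`, so the matching condition is `quantF α r = 0`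
  -- up to the factor `-4 w`.
  have e : 2 / α * b + 2 * w * Real.log α + (2 / α * b + 2 * w * Real.log α)
      - 4 * Real.log r * w = -4 * w * quantF α r := by
    rw [hb, quantF]
    field_simp
    ring
  rw [← sub_eq_zero, e]
  simp [hw]

lemma IsWeakEigenfunction.const_mul {r E : ℝ} {u : ℝ → ℂ} (h : IsWeakEigenfunction r E u)
    (hu : MemH1 u) (c : ℂ) : IsWeakEigenfunction r E (fun x => c * u x) := by
  intro φ hφ
  rw [formTC_const_mul r c hφ hu, h φ hφ, mul_left_comm, ← integral_const_mul]
  congr 2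
  ext x
  ring

/-- The odd bound states belong to integers: otherwise the decaying solution does not vanish at
the origin. -/
lemma IsWeakEigenfunction.exists_natCast_of_odd {r α : ℝ} {v : ℝ → ℂ} (hα : 0 < α)
    (hv : IsWeakEigenfunction r (-1 / (2 * α ^ 2)) v) (hv1 : MemH1 v) (hp : ∀ x, v (-x) = -v x)
    (hne : v ≠ fun _ => 0) : ∃ n : ℕ, α = n := by
  by_contra! hn
  obtain ⟨u, hu, hup, hu0, hsol, -⟩ := exists_even_isWeakEigenfunction_iff hα hn
  obtain ⟨y, hy, hy0⟩ := exists_pos_ne_zero hu (σ := 1) (fun x => by rw [hup, one_mul])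
    fun h => hu0 (by rw [h])
  obtain ⟨z, hz, hz0⟩ := exists_pos_ne_zero hv1 (σ := -1) (fun x => by rw [hp, neg_one_mul]) hne
  obtain ⟨c, hc⟩ := hsol.exists_eq_const_mul (hv.isCoulombSolution hv1) hu hv1 hy hy0
  have hv0 : v 0 = 0 := by
    have := hp 0
    rw [neg_zero] at this
    exact CharZero.eq_neg_self_iff.1 this
  -- `v = c u` on the half-line with `v(0) = 0 ≠ u(0)`, so that `c = 0`.
  have h0 := hc 0 le_rfl
  rw [hv0, eq_comm, mul_eq_zero] at h0
  exact hz0 (by rw [hc z hz.le, h0.resolve_right hu0, zero_mul])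

/-- The even bound states belong to roots of the quantisation condition which are not integers. -/
lemma IsWeakEigenfunction.quantF_eq_zero_of_even {r α : ℝ} {v : ℝ → ℂ} (hα : 0 < α)
    (hv : IsWeakEigenfunction r (-1 / (2 * α ^ 2)) v) (hv1 : MemH1 v) (hp : ∀ x, v (-x) = v x)
    (hne : v ≠ fun _ => 0) : (∀ n : ℕ, α ≠ n) ∧ quantF α r = 0 := by
  have hn : ∀ n : ℕ, α ≠ n := by
    -- For integers `α` there is an odd eigenfunction with the same eigenvalue.
    rintro n rfl
    have hn1 : 1 ≤ n := by exact_mod_cast hα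
    obtain ⟨u, hu, hup, hu0, he⟩ := exists_odd_isWeakEigenfunction hn1
    exact (hv.eq_zero_or_eq_zero (he r) hv1 hu hp hup).elim hne hu0
  refine ⟨hn, ?_⟩
  obtain ⟨u, hu, hup, hu0, hsol, he⟩ := exists_even_isWeakEigenfunction_iff hα hn
  obtain ⟨z, hz, hz0⟩ := exists_pos_ne_zero hv1 (σ := 1) (fun x => by rw [hp, one_mul]) hne
  obtain ⟨c, hc⟩ := (hv.isCoulombSolution hv1).exists_eq_const_mul hsol hv1 hu hz hz0
  have hcu : u = fun x => c * v x := by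
    funext x
    rcases le_total 0 x with hx | hx
    · exact hc x hx
    · rw [← neg_neg x, hup, hp, hc (-x) (by linarith)]
  rw [← he r, hcu]
  exact hv.const_mul hv1 c

/-! ### The negative spectrum -/

lemma exists_pos_eq_neg_one_div {E : ℝ} (hE : E < 0) : ∃ α : ℝ, 0 < α ∧ E = -1 / (2 * α ^ 2) := by
  refine ⟨(√(-2 * E))⁻¹, by have := Real.sqrt_pos.2 (show 0 < -2 * E by linarith); positivity, ?_⟩
  rw [inv_pow, Real.sq_sqrt (by linarith)]
  field_simp

lemma exists_odd_eigenfunction {N : ℕ} (hN : 1 ≤ N) :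
    ∃ φ : L2R, φ ≠ 0 ∧ IsOdd φ ∧ ∀ r, φ ∈ eigenspaceHC r (-1 / (2 * (N : ℝ) ^ 2)) := by
  obtain ⟨u, hu, hp, hne, hw⟩ := exists_odd_isWeakEigenfunction hN
  have h := hu.memLp.coeFn_toLp
  refine ⟨hu.memLp.toLp u, fun h0 => hne ((eq_zero_iff_of_ae_eq hu h).1 h0), ?_, fun r =>
    mem_eigenspaceHC_iff_exists.2 ⟨u, hu, h, hw r⟩⟩
  rw [isOdd_iff, ← neg_one_smul ℂ]
  exact reflection_eq_of_comp_neg_eq h fun x => by rw [hp, neg_one_mul]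

lemma exists_even_eigenfunction {α r : ℝ} (hα : 0 < α) (hn : ∀ n : ℕ, α ≠ n)
    (hq : quantF α r = 0) :
    ∃ φ : L2R, φ ≠ 0 ∧ IsEven φ ∧ φ ∈ eigenspaceHC r (-1 / (2 * α ^ 2)) := by
  obtain ⟨u, hu, hp, h0, -, hw⟩ := exists_even_isWeakEigenfunction_iff hα hn
  have h := hu.memLp.coeFn_toLp
  refine ⟨hu.memLp.toLp u, fun hz => h0 (by rw [(eq_zero_iff_of_ae_eq hu h).1 hz]), ?_,
    mem_eigenspaceHC_iff_exists.2 ⟨u, hu, h, (hw r).2 hq⟩⟩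
  rw [isEven_iff]
  have := reflection_eq_of_comp_neg_eq (σ := 1) h fun x => by rw [hp, one_mul]
  rwa [one_smul] at this

theorem mainTheorem3 :
    ∃ φodd : ℕ → L2R,
      (∀ N : ℕ, 1 ≤ N → φodd N ≠ 0 ∧ IsOdd (φodd N)) ∧
      ∀ r : ℝ, 0 < r →
        -- negative eigenvalues are non-degenerate
        (∀ E : ℝ, E < 0 → (∃ ψ : L2R, IsEigenfunctionHC r E ψ) →
          Module.finrank ℂ (eigenspaceHC r E) = 1) ∧
        -- eigenfunctions are eigenfunctions of the parity projections
        (∀ (E : ℝ) (ψ : L2R), IsEigenfunctionHC r E ψ →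
          (parityPlus ψ = ψ ∧ parityMinus ψ = 0) ∨ (parityPlus ψ = 0 ∧ parityMinus ψ = ψ)) ∧
        -- odd eigenfunctions: exactly one for each positive integer, independent of `r`
        (∀ N : ℕ, 1 ≤ N →
          eigenspaceHC r (-1 / (2 * (N : ℝ) ^ 2)) = Submodule.span ℂ {φodd N}) ∧
        (∀ E : ℝ, E < 0 → ∀ ψ : L2R, IsEigenfunctionHC r E ψ → IsOdd ψ →
          ∃ N : ℕ, 1 ≤ N ∧ E = -1 / (2 * (N : ℝ) ^ 2)) ∧
        -- even eigenfunctions: exactly one for each root of the quantisation condition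
        ∃ (α : ℕ → ℝ) (φeven : ℕ → L2R),
          (∀ k : ℕ, 1 ≤ k →
            α k ∈ Ioo ((k : ℝ) - 1) k ∧ quantF (α k) r = 0 ∧
            (∀ β ∈ Ioo ((k : ℝ) - 1) k, quantF β r = 0 → β = α k) ∧
            φeven k ≠ 0 ∧ IsEven (φeven k) ∧
            eigenspaceHC r (-1 / (2 * α k ^ 2)) = Submodule.span ℂ {φeven k}) ∧
          (∀ E : ℝ, E < 0 → ∀ ψ : L2R, IsEigenfunctionHC r E ψ → IsEven ψ →
            ∃ k : ℕ, 1 ≤ k ∧ E = -1 / (2 * α k ^ 2)) := by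
  -- For `N = 0` nothing is required, and an arbitrary value is chosen.
  have hodd : ∀ N : ℕ, ∃ φ : L2R, 1 ≤ N →
      φ ≠ 0 ∧ IsOdd φ ∧ ∀ r, φ ∈ eigenspaceHC r (-1 / (2 * (N : ℝ) ^ 2)) := by
    intro N
    by_cases hN : 1 ≤ N
    · obtain ⟨φ, h⟩ := exists_odd_eigenfunction hN
      exact ⟨φ, fun _ => h⟩
    · exact ⟨0, fun h => absurd h hN⟩
  choose φodd hφodd using hodd
  refine ⟨φodd, fun N hN => ⟨(hφodd N hN).1, (hφodd N hN).2.1⟩, fun r _ => ⟨?_, ?_, ?_, ?_, ?_⟩⟩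
  · rintro E - ⟨ψ, hψ⟩
    obtain ⟨h0, hm⟩ := isEigenfunctionHC_iff.1 hψ
    rw [eigenspaceHC_eq_span hm h0]
    exact finrank_span_singleton h0
  · intro E ψ hψ
    exact parity_of_mem_eigenspaceHC (isEigenfunctionHC_iff.1 hψ).2
  · intro N hN
    exact eigenspaceHC_eq_span ((hφodd N hN).2.2 r) (hφodd N hN).1
  · intro E hE ψ hψ hp
    obtain ⟨h0, hm⟩ := isEigenfunctionHC_iff.1 hψ
    obtain ⟨α, hα, rfl⟩ := exists_pos_eq_neg_one_div hE
    obtain ⟨v, hv, hψv, hw⟩ := mem_eigenspaceHC_iff_exists.1 hm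
    rw [isOdd_iff, ← neg_one_smul ℂ] at hp
    obtain ⟨n, rfl⟩ := hw.exists_natCast_of_odd hα hv
      (fun x => by rw [comp_neg_eq_of_reflection_eq hv hψv hp, neg_one_mul])
      fun h => h0 ((eq_zero_iff_of_ae_eq hv hψv).2 h)
    exact ⟨n, by exact_mod_cast hα, rfl⟩
  · have heven : ∀ k : ℕ, ∃ (α : ℝ) (φ : L2R), 1 ≤ k →
        α ∈ Ioo ((k : ℝ) - 1) k ∧ quantF α r = 0 ∧
        (∀ β ∈ Ioo ((k : ℝ) - 1) k, quantF β r = 0 → β = α) ∧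
        φ ≠ 0 ∧ IsEven φ ∧ φ ∈ eigenspaceHC r (-1 / (2 * α ^ 2)) := by
      intro k
      by_cases hk : 1 ≤ k
      · obtain ⟨α, hα, hq, hu⟩ := exists_quantF_eq_zero hk r
        have hk1 : (1 : ℝ) ≤ k := by exact_mod_cast hk
        obtain ⟨φ, hφ⟩ := exists_even_eigenfunction (by linarith [hα.1])
          (ne_natCast_of_mem_Ioo hα) hq
        exact ⟨α, φ, fun _ => ⟨hα, hq, hu, hφ⟩⟩
      · exact ⟨0, 0, fun h => absurd h hk⟩
    choose α φeven h using heven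
    refine ⟨α, φeven, fun k hk => ?_, ?_⟩
    · obtain ⟨h1, h2, h3, h4, h5, h6⟩ := h k hk
      exact ⟨h1, h2, h3, h4, h5, eigenspaceHC_eq_span h6 h4⟩
    · intro E hE ψ hψ hp
      obtain ⟨h0, hm⟩ := isEigenfunctionHC_iff.1 hψ
      obtain ⟨β, hβ, rfl⟩ := exists_pos_eq_neg_one_div hE
      obtain ⟨v, hv, hψv, hw⟩ := mem_eigenspaceHC_iff_exists.1 hm
      have hp1 : reflection ψ = (1 : ℂ) • ψ := by rw [one_smul, isEven_iff.1 hp]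
      obtain ⟨hn, hq⟩ := hw.quantF_eq_zero_of_even hβ hv
        (fun x => by rw [comp_neg_eq_of_reflection_eq hv hψv hp1, one_mul])
        fun h => h0 ((eq_zero_iff_of_ae_eq hv hψv).2 h)
      -- As `β` is not an integer, it lies in the open interval `(⌈β⌉ - 1, ⌈β⌉)`.
      have hk1 : 1 ≤ ⌈β⌉₊ := Nat.one_le_ceil_iff.2 hβ
      have hmem : β ∈ Ioo ((⌈β⌉₊ : ℝ) - 1) ⌈β⌉₊ :=
        ⟨by linarith [Nat.ceil_lt_add_one hβ.le], lt_of_le_of_ne (Nat.le_ceil β) (hn _)⟩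
      exact ⟨⌈β⌉₊, hk1, by rw [← (h _ hk1).2.2.1 β hmem hq]⟩
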